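/- **Theorem 1 (Convergence of the KKT residual).** *Problem.* Let $\mathcal P$ be a probability law on a measurable space, let $F(x;\xi)$, $x\in\mathbb R^d$, $\xi\sim\mathcal P$, be jointly measurable, integrable in $\xi$ and twice differentiable in $x$, and let $f(x)=\mathbb E_{\xi\sim\mathcal P}[F(x;\xi)]$ and $c:\mathbb R^d\to\mathbb R^m$ be twice continuously differentiable. Consider $\min_x f(x)$ subject to $c(x)=0$. Let $G(x)\in\mathbb R^{m\times d}$ be the Jacobian of $c$ and $\mathcal L(x,\lambda)=f(x)+\lambda^Tc(x)$. Vector norms are Euclidean, matrix norms are spectral norms, $(\cdot)^\dagger$ is the Moore–Penrose pseudoinverse, and $f_t=f(x_t)$, $G_t=G(x_t)$, $c_t=c(x_t)$, $\nabla\mathcal L_t=\nabla\mathcal L(x_t,\lambda_t)$, etc. *Algorithm (AI-StoSQP).* Let $(x_0,\lambda_0)$ be a deterministic starting point, $\tau\ge 1$ an integer, $\beta_t>0$, $\chi_t\ge 0$ and $\eta_t=\beta_t+\chi_t$ deterministic sequences, and $S$ a random sketching matrix with $d+m$ rows and a possibly random number of columns. In iteration $t=0,1,2,\dots$, let $\mathcal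 F_{t-1}$ denote the $\sigma$-algebra generated by all that was drawn in the iterations $0,\dots,t-1$ (so $\mathcal F_{-1}$ is trivial). 1. Draw $\xi_t\sim\mathcal P$ and set $\bar g_t=\nabla F(x_t;\xi_t)$, $\bar H_t=\nabla^2F(x_t;\xi_t)$, $\bar\nabla_x^2\mathcal L_t=\bar H_t+\sum_{i=1}^m(\lambda_t)_i\nabla^2c_i(x_t)$. Let $B_0=I$ and $B_t=\frac1t\sum_{i=0}^{t-1}\bar\nabla_x^2\mathcal L_i+\Delta_t$ for $t\ge1$, where $\Delta_t$ is an $\mathcal F_{t-1}$-measurable symmetric matrix. 2. Let $K_t=\begin{pmatrix}B_t&G_t^T\\G_t&0\end{pmatrix}$ and $\bar\nabla\mathcal L_t=\begin{pmatrix}\bar g_t+G_t^T\lambda_t\\c_t\end{pmatrix}$. Generate i.i.d. copies $S_{t,0},\dots,S_{t,\tau-1}$ of $S$ from i.i.d. random variables that are independent of $\xi_t$, where these variables and $\xi_t$ are jointly independent of $\mathcal F_{t-1}$. Let $z_{t,0}=0$ and, for $0\le j<\tau$, $$z_{t,j+1}=z_{t,j}-K_tS_{t,j}(S_{t,j}^TK_t^2S_{t,j})^\dagger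 S_{t,j}^T(K_tz_{t,j}+\bar\nabla\mathcal L_t).$$ 3. Choose any random stepsize $\bar\alpha_t\in[\beta_t,\eta_t]$, which may depend on the past, on $\xi_t$, on the sketching variables and on a further random variable drawn in this iteration, and set $(x_{t+1},\lambda_{t+1})=(x_t,\lambda_t)+\bar\alpha_tz_{t,\tau}$. *Assumptions.* There are convex compact sets $\mathcal X\subset\mathbb R^d$, $\Lambda\subset\mathbb R^m$ and constants $\Upsilon_L$, $\Upsilon_u,\Upsilon_B,\Upsilon_m\ge1$, $\gamma_G,\gamma_{RH}\in(0,1]$ and $\gamma_S>0$ such that almost surely, for all $t\ge0$: * $(x_t,\lambda_t)\in\mathcal X\times\Lambda$; on $\mathcal X\times\Lambda$ the Hessian $\nabla^2\mathcal L$ is $\Upsilon_L$-Lipschitz, and on $\mathcal X$ the gradient $\nabla f$ is $\Upsilon_L$-Lipschitz; $\|\nabla^2\mathcal L\|$, $\|\nabla\mathcal L\|$ and $\|\nabla f\|$ are at most $\Upsilon_u$ on $\mathcal X\times\Lambda$; * $G_t$ has full row rank, with $G_tG_t^T\succeq\gamma_GI$; $\|B_t\|\le\Upsilon_B$; and $v^TB_tv\ge\gamma_{RH}\|v\|^2$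 for all $v$ with $G_tv=0$; * $\mathbb E[\bar g_t\mid\mathcal F_{t-1}]=\nabla f_t$, $\mathbb E[\bar H_t\mid\mathcal F_{t-1}]=\nabla^2f_t$ and $\mathbb E[\|\bar g_t-\nabla f_t\|^2\mid\mathcal F_{t-1}]\le\Upsilon_m$; * $\mathbb E[K_tS_{t,j}(S_{t,j}^TK_t^2S_{t,j})^\dagger S_{t,j}^TK_t\mid\mathcal F_{t-1}]\succeq\gamma_SI$ for $0\le j<\tau$. *Conclusion.* Suppose that $$\tau\ \ge\ \frac{12\log2+5\log(\Upsilon_B+\Upsilon_u)+2\log(1/(\gamma_{RH}\gamma_G))}{\log(1/(1-\gamma_S))}$$ (no condition beyond $\tau\ge1$ if $\gamma_S=1$), and that $\sum_{t}\beta_t=\infty$, $\sum_{t}\eta_t^2<\infty$ and $\sum_{t}\chi_t<\infty$. Then, almost surely, $\|(x_{t+1}-x_t,\lambda_{t+1}-\lambda_t)\|\to0$ and $\|\nabla\mathcal L_t\|\to0$ as $t\to\infty$. -/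

import Mathlib

open Filter Topology MeasureTheory ProbabilityTheory
open scoped Gradient InnerProductSpace

noncomputable section

namespace AIStoSQP

/-- `ℝⁿ` with its Euclidean norm. -/
abbrev Vec (n : ℕ) := EuclideanSpace ℝ (Fin n)

/-- The space of primal-dual pairs `(x, lam) ∈ ℝᵈ × ℝᵐ`, with the Euclidean norm of `ℝ^(d+m)`.
Matrices are written as continuous linear maps between Euclidean spaces, so that their norm is the
spectral norm, their adjoint is the transpose and `≤` is the Loewner order. -/
abbrev PD (d m : ℕ) := WithLp 2 (Vec d × Vec m)

/-! ### Derivatives -/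

section Derivatives

variable {H : Type*} [NormedAddCommGroup H] [InnerProductSpace ℝ H] [CompleteSpace H]

/-- The Hessian matrix of a real function: the derivative of its gradient. -/
def hess (φ : H → ℝ) (x : H) : H →L[ℝ] H := fderiv ℝ (∇ φ) x

/-- Twice differentiable (everywhere). -/
def TwiceDifferentiable (φ : H → ℝ) : Prop := Differentiable ℝ φ ∧ Differentiable ℝ (∇ φ)

end Derivatives

/-! ### The Moore–Penrose pseudoinverse -/

section Pseudoinverse

variable {V W : Type*} [NormedAddCommGroup V] [InnerProductSpace ℝ V] [FiniteDimensional ℝ V]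
  [NormedAddCommGroup W] [InnerProductSpace ℝ W] [FiniteDimensional ℝ W]

/-- The four Penrose equations `AXA = A`, `XAX = X`, `(AX)ᵀ = AX`, `(XA)ᵀ = XA`. -/
structure IsMoorePenrose (A : V →L[ℝ] W) (X : W →L[ℝ] V) : Prop where
  mul_mul : A ∘L X ∘L A = A
  mul_mul' : X ∘L A ∘L X = X
  left_symm : IsSelfAdjoint (A ∘L X)
  right_symm : IsSelfAdjoint (X ∘L A)

theorem exists_isMoorePenrose (A : V →L[ℝ] W) : ∃ X, IsMoorePenrose A X := by
  obtain ⟨g, hg⟩ := LinearMap.exists_rightInverse_of_surjective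
    (A : V →ₗ[ℝ] W).rangeRestrict (LinearMap.range_rangeRestrict _)
  obtain ⟨B, hB⟩ := LinearMap.exists_extend g
  obtain ⟨R, hR⟩ : ∃ R, R = (A : V →ₗ[ℝ] W).range := ⟨_, rfl⟩
  obtain ⟨N, hN⟩ : ∃ N, N = (A : V →ₗ[ℝ] W).ker := ⟨_, rfl⟩
  set PR := R.starProjection with hPR
  set PN := Nᗮ.starProjection with hPN
  have hAB : ∀ w ∈ R, A (B w) = w := by
    intro w hw
    rw [hR] at hw
    have h1 : B w = g ⟨w, hw⟩ := LinearMap.congr_fun hB ⟨w, hw⟩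
    have h2 := congrArg Subtype.val (LinearMap.congr_fun hg ⟨w, hw⟩)
    rw [h1]
    exact h2
  have hRA : ∀ v, A v ∈ R := fun v => by rw [hR]; exact ⟨v, rfl⟩
  have hPRA : ∀ v, PR (A v) = A v := fun v =>
    Submodule.starProjection_eq_self_iff.2 (hRA v)
  have hAPN : ∀ v, A (PN v) = A v := by
    intro v
    have h : v - PN v ∈ N := by
      have := Submodule.sub_starProjection_mem_orthogonal (K := Nᗮ) v
      rwa [Submodule.orthogonal_orthogonal] at this
    have h' : A (v - PN v) = 0 := by
      rw [hN] at h
      exact h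
    rw [map_sub, sub_eq_zero] at h'
    exact h'.symm
  have hPNk : ∀ v w, A v = A w → PN v = PN w := by
    intro v w h
    have h1 : v - w ∈ Nᗮᗮ := by
      rw [Submodule.orthogonal_orthogonal, hN]
      change A (v - w) = 0
      rw [map_sub, h, sub_self]
    have h2 : PN (v - w) = 0 := (Submodule.starProjection_apply_eq_zero_iff _).2 h1
    rwa [map_sub, sub_eq_zero] at h2
  have hAX : A ∘L (PN ∘L LinearMap.toContinuousLinearMap B ∘L PR) = PR := by
    ext1 w
    change A (PN (B (PR w))) = PR w
    rw [hAPN, hAB _ (Submodule.starProjection_apply_mem _ _)]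
  have hXA : (PN ∘L LinearMap.toContinuousLinearMap B ∘L PR) ∘L A = PN := by
    ext1 v
    change PN (B (PR (A v))) = PN v
    rw [hPRA]
    exact hPNk _ _ (hAB _ (hRA v))
  refine ⟨PN ∘L LinearMap.toContinuousLinearMap B ∘L PR, ?_, ?_, ?_, ?_⟩
  · rw [hXA]
    ext1 v
    exact hAPN v
  · rw [hAX]
    ext1 w
    change PN (B (PR (PR w))) = PN (B (PR w))
    rw [Submodule.starProjection_eq_self_iff.2 (Submodule.starProjection_apply_mem R w)]
  · rw [hAX]
    exact isSelfAdjoint_starProjection R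
  · rw [hXA]
    exact isSelfAdjoint_starProjection Nᗮ

theorem IsMoorePenrose.unique {A : V →L[ℝ] W} {X Y : W →L[ℝ] V}
    (hX : IsMoorePenrose A X) (hY : IsMoorePenrose A Y) : X = Y := by
  have key : A ∘L X = A ∘L Y := by
    have h1 : (A ∘L Y) * (A ∘L X) = A ∘L X := by
      change (A ∘L Y ∘L A) ∘L X = A ∘L X
      rw [hY.mul_mul]
    have h2 : (A ∘L X) * (A ∘L Y) = A ∘L Y := by
      change (A ∘L X ∘L A) ∘L Y = A ∘L Y
      rw [hX.mul_mul]
    have h3 := congrArg star h1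
    rw [star_mul, hX.left_symm.star_eq, hY.left_symm.star_eq, h2] at h3
    exact h3.symm
  have key' : X ∘L A = Y ∘L A := by
    have h1 : (X ∘L A) * (Y ∘L A) = X ∘L A := by
      change X ∘L (A ∘L Y ∘L A) = X ∘L A
      rw [hY.mul_mul]
    have h2 : (Y ∘L A) * (X ∘L A) = Y ∘L A := by
      change Y ∘L (A ∘L X ∘L A) = Y ∘L A
      rw [hX.mul_mul]
    have h3 := congrArg star h1
    rw [star_mul, hX.right_symm.star_eq, hY.right_symm.star_eq, h2] at h3
    exact h3.symm
  calc X = X ∘L (A ∘L X) := hX.mul_mul'.symm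
    _ = (X ∘L A) ∘L Y := by rw [key]; rfl
    _ = Y ∘L A ∘L Y := by rw [key']; rfl
    _ = Y := hY.mul_mul'

/-- The Moore–Penrose pseudoinverse. -/
def pinv (A : V →L[ℝ] W) : W →L[ℝ] V := (exists_isMoorePenrose A).choose

theorem isMoorePenrose_pinv (A : V →L[ℝ] W) : IsMoorePenrose A (pinv A) :=
  (exists_isMoorePenrose A).choose_spec

end Pseudoinverse

/-! ### The problem `min f(x) = E[F(x; ξ)]` subject to `c(x) = 0`, and its Lagrangian -/

section Problem

variable {d m : ℕ} {S : Type*} [MeasurableSpace S]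

/-- The objective `f(x) = E[F(x; ξ)]` with `ξ ∼ P`. -/
def objective (F : Vec d → S → ℝ) (P : Measure S) (x : Vec d) : ℝ := ∫ s, F x s ∂P

/-- The Lagrangian `f(x) + lamᵀ c(x)`. -/
def lagrangian (f : Vec d → ℝ) (c : Vec d → Vec m) (p : PD d m) : ℝ :=
  f p.fst + ⟪p.snd, c p.fst⟫_ℝ

/-- The Jacobian `G(x) ∈ ℝ^(m × d)` of the constraints. -/
def jac (c : Vec d → Vec m) (x : Vec d) : Vec d →L[ℝ] Vec m := fderiv ℝ c x

/-- The stochastic gradient `∇F(x; s)`. -/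
def sGrad (F : Vec d → S → ℝ) (x : Vec d) (s : S) : Vec d := ∇ (fun y => F y s) x

/-- The stochastic Hessian `∇²F(x; s)`. -/
def sHess (F : Vec d → S → ℝ) (x : Vec d) (s : S) : Vec d →L[ℝ] Vec d := hess (fun y => F y s) x

/-- The estimate `(∇F(x; s) + G(x)ᵀ lam, c(x))` of the gradient of the Lagrangian. -/
def lagGradEst (F : Vec d → S → ℝ) (c : Vec d → Vec m) (p : PD d m) (s : S) : PD d m :=
  WithLp.toLp 2 (sGrad F p.fst s + (jac c p.fst).adjoint p.snd, c p.fst)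

/-- The estimate `∇²F(x; s) + ∑ᵢ lamᵢ ∇²cᵢ(x)` of the `x`-Hessian of the Lagrangian. -/
def lagHessEst (F : Vec d → S → ℝ) (c : Vec d → Vec m) (p : PD d m) (s : S) :
    Vec d →L[ℝ] Vec d :=
  sHess F p.fst s + ∑ i, p.snd i • hess (fun y => c y i) p.fst

/-! ### The algorithm along one realization -/

/-- The block matrix with rows `(B, Gᵀ)` and `(G, 0)`. -/
def kkt (B : Vec d →L[ℝ] Vec d) (G : Vec d →L[ℝ] Vec m) : PD d m →L[ℝ] PD d m :=
  (WithLp.prodContinuousLinearEquiv 2 ℝ (Vec d) (Vec m)).symm.toContinuousLinearMap ∘L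
    ((B ∘L ContinuousLinearMap.fst ℝ (Vec d) (Vec m) +
        G.adjoint ∘L ContinuousLinearMap.snd ℝ (Vec d) (Vec m)).prod
      (G ∘L ContinuousLinearMap.fst ℝ (Vec d) (Vec m))) ∘L
    (WithLp.prodContinuousLinearEquiv 2 ℝ (Vec d) (Vec m)).toContinuousLinearMap

/-- The modified Hessian `B_t`: `B_0 = I`, and for `t ≥ 1` the average of the estimates of the
steps `0, …, t - 1` plus the regularization `R t`. Here `p` are the iterates, `s` the samples. -/
def modHess (F : Vec d → S → ℝ) (c : Vec d → Vec m) (p : ℕ → PD d m) (s : ℕ → S)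
    (R : ℕ → Vec d →L[ℝ] Vec d) (t : ℕ) : Vec d →L[ℝ] Vec d :=
  if t = 0 then ContinuousLinearMap.id ℝ (Vec d)
  else (t : ℝ)⁻¹ • ∑ i ∈ Finset.range t, lagHessEst F c (p i) (s i) + R t

/-- The Newton matrix `K_t`. -/
def newtonMat (F : Vec d → S → ℝ) (c : Vec d → Vec m) (p : ℕ → PD d m) (s : ℕ → S)
    (R : ℕ → Vec d →L[ℝ] Vec d) (t : ℕ) : PD d m →L[ℝ] PD d m :=
  kkt (modHess F c p s R t) (jac c (p t).fst)

/-- A sketching matrix of size `(d + m) × q`, where `q` is part of the data. -/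
abbrev Sketch (d m : ℕ) := Σ q : ℕ, (Vec q →L[ℝ] PD d m)

/-- `K S (Sᵀ K² S)† Sᵀ`. -/
def sketchGain (K : PD d m →L[ℝ] PD d m) (A : Sketch d m) : PD d m →L[ℝ] PD d m :=
  K ∘L A.2 ∘L pinv (A.2.adjoint ∘L K ∘L K ∘L A.2) ∘L A.2.adjoint

/-- The sketch-and-project iterates for `K z = -b` from `z = 0`:
`z ↦ z - K S (Sᵀ K² S)† Sᵀ (K z + b)`, with the sketching matrix `A j` in step `j`. -/
def sketchSolve (K : PD d m →L[ℝ] PD d m) (b : PD d m) (A : ℕ → Sketch d m) : ℕ → PD d m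
  | 0 => 0
  | j + 1 => sketchSolve K b A j - sketchGain K (A j) (K (sketchSolve K b A j) + b)

end Problem

/-! ### The algorithm as a stochastic process -/

section RandomRun

variable {Ω S Z Y : Type*} [MeasurableSpace S] [MeasurableSpace Z] [MeasurableSpace Y]

/-- The σ-algebra generated by the samples `ξ i`, the sketching variables `ζ i j`, `j < τ`, and the
stepsize variables `ψ i` of the steps `i < t`. So `history ξ ζ ψ τ t` is `𝓕_(t-1)`, and it is trivial
for `t = 0`. -/
@[reducible] def history (ξ : ℕ → Ω → S) (ζ : ℕ → ℕ → Ω → Z) (ψ : ℕ → Ω → Y) (τ t : ℕ) :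
    MeasurableSpace Ω :=
  ⨆ i ∈ Finset.range t,
    MeasurableSpace.comap (ξ i) inferInstance ⊔
      (⨆ j ∈ Finset.range τ, MeasurableSpace.comap (ζ i j) inferInstance) ⊔
        MeasurableSpace.comap (ψ i) inferInstance

variable {d m : ℕ} [MeasurableSpace Ω]

/-- `w t = (x_t, lam_t)`, `t = 0, 1, …`, are the iterates of the algorithm AI-StoSQP, started
at `w₀` and run with `τ` sketching steps per iteration. `P` is the law of the samples `ξ t`, `Q` the law
of the variables `ζ t j` that generate the sketching matrices `A (ζ t j)`, `R t` is the regularization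
of the Hessian, and `α t` the random stepsize in `[β t, β t + χ t]`, which may depend on `ψ t`. -/
structure IsRun (μ : Measure Ω) (F : Vec d → S → ℝ) (c : Vec d → Vec m) (P : Measure S)
    (Q : Measure Z) (A : Z → Sketch d m) (τ : ℕ) (β χ : ℕ → ℝ)
    (ξ : ℕ → Ω → S) (ζ : ℕ → ℕ → Ω → Z) (ψ : ℕ → Ω → Y)
    (R : ℕ → Ω → Vec d →L[ℝ] Vec d) (α : ℕ → Ω → ℝ)
    (w₀ : PD d m) (w : ℕ → Ω → PD d m) : Prop where
  measurable_sample : ∀ t, Measurable (ξ t)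
  measurable_sketchVar : ∀ t j, Measurable (ζ t j)
  measurable_stepVar : ∀ t, Measurable (ψ t)
  measurable_sketch : Measurable A
  /-- the samples are drawn from `P` -/
  law_sample : ∀ t, μ.map (ξ t) = P
  /-- the sketching variables of a step are i.i.d. from `Q` … -/
  law_sketch : ∀ t, ∀ j < τ, μ.map (ζ t j) = Q
  indep_sketch : ∀ t, iIndepFun (fun j : Fin τ => ζ t j) μ
  /-- … and independent of the sample -/
  indep_sample_sketch : ∀ t, IndepFun (ξ t) (fun ω (j : Fin τ) => ζ t j ω) μ
  /-- both are drawn independently of the past -/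
  indep_history : ∀ t, Indep (history ξ ζ ψ τ t)
    (MeasurableSpace.comap (fun ω => (ξ t ω, fun j : Fin τ => ζ t j ω)) inferInstance) μ
  /-- the regularization is a symmetric matrix that is determined by the past -/
  reg_symm : ∀ t ω, IsSelfAdjoint (R t ω)
  reg_measurable : ∀ t, Measurable[history ξ ζ ψ τ t] (R t)
  /-- the stepsize is determined by what has been drawn up to and including step `t` -/
  step_measurable : ∀ t, Measurable[history ξ ζ ψ τ (t + 1)] (α t)
  step_mem : ∀ t ω, α t ω ∈ Set.Icc (β t) (β t + χ t)
  init : ∀ ω, w 0 ω = w₀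
  update : ∀ t ω, w (t + 1) ω = w t ω + α t ω •
    sketchSolve (newtonMat F c (fun i => w i ω) (fun i => ξ i ω) (fun i => R i ω) t)
      (lagGradEst F c (w t ω) (ξ t ω)) (fun j => A (ζ t j ω)) τ

end RandomRun

end AIStoSQP

end

open AIStoSQP

/-! The proof follows the merit function `φ = L + ρ/2 ‖c‖² + ν/2 ‖∇L‖²` (`merit`) with fixed weights
`ρ` and `ν`. Let `v` be the exact Newton direction, `K_t v = -∇L_t`. Along `v` the Lagrangian gains
the curvature of `B_t` on `ker G_t`, the `ρ`-term gives `-ρ ‖c‖²`, which dominates everything normal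
to the constraints, and the `ν`-term gives `-ν ‖∇L‖²` up to an error caused by the difference
between `B_t` and the true Hessian. This difference is only bounded, never small: `ν` is chosen so
small that the curvature absorbs the error, hence `B_t` need not approach the Hessian. The balance
is `descent_inequality`; it tolerates a relative error `γRH² γG² / (4096 (ΥB + Υu)^5)` in `v`.

The computed direction is noisy through the sample and the sketches, but its conditional mean is
accurate. The solver error `r_j` loses its projection `P_j r_j` in each sketching step. Since `K_t`
is known from the past and the `j`-th sketch is independent of the past, the sample and the earlier
sketches, `E[r_{j+1} | 𝓕] = (1 - E[P_j | 𝓕]) E[r_j | 𝓕]`, a contraction by `1 - γS`. The bound on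
`τ` says precisely that `(1 - γS)^τ` is below the tolerance. So the mean direction satisfies `⟪∇φ,
E[z | 𝓕]⟫ ≤ -δ ‖∇L‖²`, while pathwise `r_j` never grows, which bounds `E ‖z‖²`.

Replacing the random stepsize by `β_t` costs a multiple of `χ_t`, and the second-order remainder is
`O(η_t²)` in mean. As `φ` is bounded on the compact set, telescoping yields `∑ β_t E ‖∇L_t‖² < ∞`
(`summable_of_stochastic_descent`). Similarly `∑ η_t² ‖z_t‖² < ∞` almost surely, so the steps tend
to zero.

To pass from summability to convergence, split each step into `β_t E[z_t | 𝓕]`, of length `O(β_t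
‖∇L_t‖)`, a martingale difference whose sums converge, and an absolutely summable rest. For late
times these cannot move the iterate far enough for the Lipschitz function `‖∇L‖` to climb from below
`ε` to `2ε` (`tendsto_zero_of_summable_mul_sq`). -/

namespace AIStoSQP

/-! ### Measurability and symmetry of the Moore–Penrose pseudoinverse. -/

section PseudoinverseLimit

variable {V W : Type*} [NormedAddCommGroup V] [InnerProductSpace ℝ V] [FiniteDimensional ℝ V]
  [NormedAddCommGroup W] [InnerProductSpace ℝ W] [FiniteDimensional ℝ W]

theorem IsMoorePenrose.eq_adjoint_comp {A : V →L[ℝ] W} {X : W →L[ℝ] V} (h : IsMoorePenrose A X) :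
    A.adjoint = A.adjoint ∘L A ∘L X := by
  have h1 := congrArg ContinuousLinearMap.adjoint h.mul_mul
  have h2 : (A ∘L X).adjoint = A ∘L X := h.left_symm
  rw [← ContinuousLinearMap.comp_assoc, ContinuousLinearMap.adjoint_comp, h2] at h1
  exact h1.symm

/-- The range of the pseudoinverse lies in that of `AᵀA`. On this range `ε (AᵀA + ε)⁻¹` is of order
`ε`, which gives Tikhonov regularization its rate. -/
theorem IsMoorePenrose.eq_gram_comp {A : V →L[ℝ] W} {X : W →L[ℝ] V} (h : IsMoorePenrose A X) :
    X = (A.adjoint ∘L A) ∘L (X ∘L X.adjoint ∘L X) := by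
  have h2 : (X ∘L A).adjoint = X ∘L A := h.right_symm
  rw [ContinuousLinearMap.adjoint_comp] at h2
  calc X = (X ∘L A) ∘L X := h.mul_mul'.symm
    _ = (A.adjoint ∘L X.adjoint) ∘L X := by rw [h2]
    _ = (A.adjoint ∘L A ∘L X) ∘L X.adjoint ∘L X := by
      rw [← h.eq_adjoint_comp]; rfl
    _ = _ := rfl

/-- The regularized Gram matrix `AᵀA + ε I`. -/
noncomputable def regGram (A : V →L[ℝ] W) (ε : ℝ) : V →L[ℝ] V :=
  A.adjoint ∘L A + ε • 1

theorem regGram_apply (A : V →L[ℝ] W) (ε : ℝ) (v : V) :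
    regGram A ε v = A.adjoint (A v) + ε • v := rfl

theorem mul_norm_le_norm_regGram (A : V →L[ℝ] W) {ε : ℝ} (v : V) :
    ε * ‖v‖ ≤ ‖regGram A ε v‖ := by
  rcases eq_or_ne v 0 with rfl | hv
  · simp
  have h : ε * ‖v‖ ^ 2 ≤ ‖regGram A ε v‖ * ‖v‖ := by
    refine le_trans ?_ (real_inner_le_norm _ _)
    rw [regGram_apply, inner_add_left, ContinuousLinearMap.adjoint_inner_left, real_inner_smul_left,
      real_inner_self_eq_norm_sq, real_inner_self_eq_norm_sq]
    nlinarith [sq_nonneg ‖A v‖]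
  have hv' : 0 < ‖v‖ := norm_pos_iff.2 hv
  nlinarith

theorem isUnit_of_injective {T : V →L[ℝ] V} (h : Function.Injective T) : IsUnit T :=
  ContinuousLinearMap.isUnit_iff_bijective.2
    ⟨h, (LinearMap.injective_iff_surjective (f := (T : V →ₗ[ℝ] V))).1 h⟩

theorem isUnit_regGram (A : V →L[ℝ] W) {ε : ℝ} (hε : 0 < ε) : IsUnit (regGram A ε) := by
  refine isUnit_of_injective ((injective_iff_map_eq_zero _).2 fun v hv => ?_)
  have h := mul_norm_le_norm_regGram A (ε := ε) v
  rw [hv, norm_zero] at h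
  exact norm_le_zero_iff.1 (nonpos_of_mul_nonpos_right h hε)

theorem norm_smul_inverse_regGram_le (A : V →L[ℝ] W) {ε : ℝ} (hε : 0 < ε) (w : V) :
    ‖ε • Ring.inverse (regGram A ε) w‖ ≤ ‖w‖ := by
  have h := mul_norm_le_norm_regGram A (ε := ε) (Ring.inverse (regGram A ε) w)
  have h2 : regGram A ε (Ring.inverse (regGram A ε) w) = w :=
    congrArg (fun T : V →L[ℝ] V => T w) (Ring.mul_inverse_cancel _ (isUnit_regGram A hε))
  rw [h2] at h
  rwa [norm_smul, Real.norm_of_nonneg hε.le]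

theorem inverse_regGram_gram (A : V →L[ℝ] W) {ε : ℝ} (hε : 0 < ε) (w : V) :
    Ring.inverse (regGram A ε) (A.adjoint (A w)) = w - ε • Ring.inverse (regGram A ε) w := by
  have h2 : Ring.inverse (regGram A ε) (regGram A ε w) = w :=
    congrArg (fun T : V →L[ℝ] V => T w) (Ring.inverse_mul_cancel _ (isUnit_regGram A hε))
  rw [regGram_apply, map_add, map_smul] at h2
  exact eq_sub_of_add_eq h2

/-- With `X = pinv A`, `Aᵀ = AᵀA X` turns the difference into `-ε (AᵀA + ε)⁻¹ X`. Writing `X = AᵀA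
(X Xᵀ X)` cancels the inverse up to a contraction; the factor 2 is the triangle inequality. -/
theorem norm_tikhonov_sub_pinv_le (A : V →L[ℝ] W) {ε : ℝ} (hε : 0 < ε) :
    ‖Ring.inverse (regGram A ε) ∘L A.adjoint - pinv A‖ ≤
      2 * ε * ‖pinv A ∘L (pinv A).adjoint ∘L pinv A‖ := by
  have hX := isMoorePenrose_pinv A
  refine ContinuousLinearMap.opNorm_le_bound _ (by positivity) fun w => ?_
  set X := pinv A
  set Xc := X ∘L X.adjoint ∘L X
  have h1 : A.adjoint w = A.adjoint (A (X w)) :=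
    congrArg (fun T : W →L[ℝ] V => T w) hX.eq_adjoint_comp
  have h2 : X w = A.adjoint (A (Xc w)) :=
    congrArg (fun T : W →L[ℝ] V => T w) hX.eq_gram_comp
  have h3 : (Ring.inverse (regGram A ε) ∘L A.adjoint - X) w
      = - (ε • (Xc w - ε • Ring.inverse (regGram A ε) (Xc w))) := by
    rw [sub_apply, ContinuousLinearMap.comp_apply, h1,
      inverse_regGram_gram A hε, ← inverse_regGram_gram A hε (Xc w), ← h2]
    abel
  rw [h3, norm_neg, norm_smul, Real.norm_of_nonneg hε.le]
  have h4 := norm_sub_le (Xc w) (ε • Ring.inverse (regGram A ε) (Xc w))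
  have h5 := norm_smul_inverse_regGram_le A hε (Xc w)
  have h6 := Xc.le_opNorm w
  nlinarith

theorem continuous_tikhonov {ε : ℝ} (hε : 0 < ε) :
    Continuous fun A : V →L[ℝ] W => Ring.inverse (regGram A ε) ∘L A.adjoint := by
  have hadj : Continuous fun A : V →L[ℝ] W => A.adjoint :=
    (ContinuousLinearMap.adjoint (𝕜 := ℝ) (E := V) (F := W)).continuous
  have h1 : Continuous fun A : V →L[ℝ] W => regGram A ε :=
    (hadj.clm_comp continuous_id).add continuous_const
  refine Continuous.clm_comp (continuous_iff_continuousAt.2 fun A => ?_) hadj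
  obtain ⟨x, hx⟩ := isUnit_regGram A hε
  have h2 := NormedRing.inverse_continuousAt x
  rw [hx] at h2
  exact ContinuousAt.comp (f := fun A : V →L[ℝ] W => regGram A ε) h2 h1.continuousAt

theorem tendsto_tikhonov (A : V →L[ℝ] W) :
    Tendsto (fun n : ℕ => Ring.inverse (regGram A (1 / ((n : ℝ) + 1))) ∘L A.adjoint) atTop
      (𝓝 (pinv A)) := by
  rw [tendsto_iff_norm_sub_tendsto_zero]
  refine squeeze_zero (fun _ => norm_nonneg _)
    (fun n => norm_tikhonov_sub_pinv_le A Nat.one_div_pos_of_nat) ?_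
  have h := (tendsto_one_div_add_atTop_nhds_zero_nat (𝕜 := ℝ)).const_mul 2
  simpa using h.mul_const ‖pinv A ∘L (pinv A).adjoint ∘L pinv A‖

/-- The pseudoinverse jumps where the rank drops, but it is a pointwise limit of the continuous
Tikhonov inverses. -/
theorem measurable_pinv : Measurable (pinv : (V →L[ℝ] W) → (W →L[ℝ] V)) :=
  measurable_of_tendsto_metrizable
    (fun n : ℕ => (continuous_tikhonov (Nat.one_div_pos_of_nat (n := n))).measurable)
    (tendsto_pi_nhds.2 tendsto_tikhonov)

/-- The Penrose equations are stable under transposition, so the transpose of the pseudoinverse is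
again a pseudoinverse of `A`, and uniqueness applies. -/
theorem isSelfAdjoint_pinv {A : V →L[ℝ] V} (hA : IsSelfAdjoint A) : IsSelfAdjoint (pinv A) := by
  have h := isMoorePenrose_pinv A
  have hA' : A.adjoint = A := hA
  refine IsMoorePenrose.unique (A := A) ⟨?_, ?_, ?_, ?_⟩ h
  · have := congrArg ContinuousLinearMap.adjoint h.mul_mul
    simpa [ContinuousLinearMap.adjoint_comp, hA', ContinuousLinearMap.comp_assoc,
      ContinuousLinearMap.star_eq_adjoint] using this
  · have := congrArg ContinuousLinearMap.adjoint h.mul_mul'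
    simpa [ContinuousLinearMap.adjoint_comp, hA', ContinuousLinearMap.comp_assoc,
      ContinuousLinearMap.star_eq_adjoint] using this
  · have := h.right_symm
    have h2 : (pinv A ∘L A).adjoint = pinv A ∘L A := this
    rw [ContinuousLinearMap.adjoint_comp, hA'] at h2
    change IsSelfAdjoint (A ∘L (pinv A).adjoint)
    rw [h2]; exact this
  · have := h.left_symm
    have h2 : (A ∘L pinv A).adjoint = A ∘L pinv A := this
    rw [ContinuousLinearMap.adjoint_comp, hA'] at h2
    change IsSelfAdjoint ((pinv A).adjoint ∘L A)
    rw [h2]; exact this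

theorem pinv_apply_self {A : V →L[ℝ] V} (hA : Function.Injective A) (v : V) : pinv A (A v) = v :=
  hA (congrArg (fun T : V →L[ℝ] V => T v) (isMoorePenrose_pinv A).mul_mul)

theorem self_apply_pinv {A : V →L[ℝ] V} (hA : Function.Injective A) (v : V) : A (pinv A v) = v := by
  obtain ⟨u, rfl⟩ := (LinearMap.injective_iff_surjective (f := (A : V →ₗ[ℝ] V))).1 hA v
  exact congrArg A (pinv_apply_self hA u)

end PseudoinverseLimit

/-! ### The projection made by one sketching step. -/

section Sketch

variable {d m : ℕ}

/-- `K S (Sᵀ K² S)† Sᵀ K`, the orthogonal projection onto the range of `K S`. -/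
noncomputable def sketchProj (K : PD d m →L[ℝ] PD d m) (A : Sketch d m) : PD d m →L[ℝ] PD d m :=
  sketchGain K A ∘L K

/-- For symmetric `K` the matrix `Sᵀ K² S` is the Gram matrix of `K S`, which makes the projection
property visible. -/
theorem sketchProj_eq {K : PD d m →L[ℝ] PD d m} (hK : IsSelfAdjoint K) (A : Sketch d m) :
    sketchProj K A = (K ∘L A.2) ∘L pinv ((K ∘L A.2).adjoint ∘L (K ∘L A.2)) ∘L (K ∘L A.2).adjoint := by
  have hK' : K.adjoint = K := hK
  rw [ContinuousLinearMap.adjoint_comp, hK']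
  rfl

theorem sketchProj_symm {K : PD d m →L[ℝ] PD d m} (hK : IsSelfAdjoint K) (A : Sketch d m) :
    (sketchProj K A).adjoint = sketchProj K A := by
  rw [sketchProj_eq hK]
  set M := K ∘L A.2
  have h1 : (pinv (M.adjoint ∘L M)).adjoint = pinv (M.adjoint ∘L M) := by
    refine isSelfAdjoint_pinv ?_
    change (M.adjoint ∘L M).adjoint = _
    rw [ContinuousLinearMap.adjoint_comp, ContinuousLinearMap.adjoint_adjoint]
  rw [ContinuousLinearMap.adjoint_comp, ContinuousLinearMap.adjoint_comp, h1,
    ContinuousLinearMap.adjoint_adjoint, ContinuousLinearMap.comp_assoc]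

theorem sketchProj_idem {K : PD d m →L[ℝ] PD d m} (hK : IsSelfAdjoint K) (A : Sketch d m)
    (v : PD d m) : sketchProj K A (sketchProj K A v) = sketchProj K A v := by
  rw [sketchProj_eq hK]
  set M := K ∘L A.2
  exact congrArg (fun T => M (T (M.adjoint v)))
    (isMoorePenrose_pinv (M.adjoint ∘L M)).mul_mul'

theorem inner_sketchProj {K : PD d m →L[ℝ] PD d m} (hK : IsSelfAdjoint K) (A : Sketch d m)
    (v : PD d m) : ⟪sketchProj K A v, v⟫_ℝ = ‖sketchProj K A v‖ ^ 2 := by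
  rw [← real_inner_self_eq_norm_sq, ← ContinuousLinearMap.adjoint_inner_right, sketchProj_symm hK,
    real_inner_comm]
  conv_lhs => rw [← sketchProj_idem hK A v]
  rw [← ContinuousLinearMap.adjoint_inner_right, sketchProj_symm hK]

theorem norm_sketchProj_apply_le {K : PD d m →L[ℝ] PD d m} (hK : IsSelfAdjoint K) (A : Sketch d m)
    (v : PD d m) : ‖sketchProj K A v‖ ≤ ‖v‖ := by
  have h1 := inner_sketchProj hK A v
  have h2 := real_inner_le_norm (sketchProj K A v) v
  by_contra! h
  nlinarith [norm_nonneg v]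

theorem norm_sub_sketchProj_apply_le {K : PD d m →L[ℝ] PD d m} (hK : IsSelfAdjoint K)
    (A : Sketch d m) (v : PD d m) : ‖v - sketchProj K A v‖ ≤ ‖v‖ := by
  have h1 := inner_sketchProj hK A v
  have h2 := norm_sub_sq_real v (sketchProj K A v)
  rw [real_inner_comm, h1] at h2
  refine abs_le_of_sq_le_sq' ?_ (norm_nonneg _) |>.2
  nlinarith [sq_nonneg ‖sketchProj K A v‖]

/-- The number of columns of a sketch is random. There are only countably many values, so joint
measurability can be checked for each fixed number of columns. -/
theorem measurable_sigma_uncurry {E G : Type*} [MeasurableSpace E] [MeasurableSpace G]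
    {B : ℕ → Type*} [∀ q, MeasurableSpace (B q)] [∀ q, Inhabited (B q)]
    {f : E × (Σ q, B q) → G}
    (hf : ∀ q, Measurable fun p : E × B q => f (p.1, ⟨q, p.2⟩)) : Measurable f := by
  have of_fibers : ∀ {C : Type _} [MeasurableSpace C] {g : (Σ q, B q) → C},
      (∀ q, Measurable fun b : B q => g ⟨q, b⟩) → Measurable g := fun hg T hT =>
    MeasurableSpace.measurableSet_iInf.2 fun q => hg q hT
  -- A measurable retraction onto the fibre over `q`; its default value off the fibre is irrelevant,
  -- since `key` intersects with `{q}`.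
  let π : ∀ q, (Σ q, B q) → B q := fun q s => if h : s.1 = q then h ▸ s.2 else default
  have hπ : ∀ q, Measurable (π q) := fun q => of_fibers fun r => by
    by_cases h : r = q
    · subst h
      simpa [π] using measurable_id'
    · simp [π, h]
  have hfst : Measurable fun s : Σ q, B q => s.1 := fun T _ =>
    MeasurableSpace.measurableSet_iInf.2 fun q => measurable_const (a := q) (by trivial : MeasurableSet T)
  intro T hT
  have key : f ⁻¹' T = ⋃ q, ((fun p : E × (Σ q, B q) => p.2.1) ⁻¹' {q} ∩
      (fun p : E × (Σ q, B q) => f (p.1, ⟨q, π q p.2⟩)) ⁻¹' T) := by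
    ext ⟨e, q, b⟩
    simp [π]
  rw [key]
  refine MeasurableSet.iUnion fun q => ?_
  exact ((hfst.comp measurable_snd) (measurableSet_singleton q)).inter
    (((hf q).comp (measurable_fst.prodMk ((hπ q).comp measurable_snd))) hT)

theorem measurable_sketchGain :
    Measurable fun p : (PD d m →L[ℝ] PD d m) × Sketch d m => sketchGain p.1 p.2 := by
  have : ∀ q, Inhabited (Vec q →L[ℝ] PD d m) := fun q => ⟨0⟩
  refine measurable_sigma_uncurry (B := fun q => Vec q →L[ℝ] PD d m) fun q => ?_
  have hadj : Continuous fun B : Vec q →L[ℝ] PD d m => B.adjoint :=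
    (ContinuousLinearMap.adjoint (𝕜 := ℝ) (E := Vec q) (F := PD d m)).continuous
  have h1 : Continuous fun p : (PD d m →L[ℝ] PD d m) × (Vec q →L[ℝ] PD d m) =>
      p.2.adjoint ∘L p.1 ∘L p.1 ∘L p.2 :=
    (hadj.comp continuous_snd).clm_comp
      (continuous_fst.clm_comp (continuous_fst.clm_comp continuous_snd))
  have h2 := measurable_pinv.comp h1.measurable
  have h3 : Measurable fun p : (PD d m →L[ℝ] PD d m) × (Vec q →L[ℝ] PD d m) => p.1 ∘L p.2 :=
    (continuous_fst.clm_comp continuous_snd).measurable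
  have h4 : Measurable fun p : (Vec q →L[ℝ] PD d m) × (Vec q →L[ℝ] Vec q) => p.1 ∘L p.2 :=
    (continuous_fst.clm_comp continuous_snd).measurable
  have h5 : Measurable fun p : (Vec q →L[ℝ] PD d m) × (PD d m →L[ℝ] Vec q) => p.1 ∘L p.2 :=
    (continuous_fst.clm_comp continuous_snd).measurable
  exact h5.comp ((h4.comp (h3.prodMk h2)).prodMk (hadj.measurable.comp measurable_snd))

end Sketch

/-! ### A priori bounds for KKT systems. -/

section KKT

variable {E W : Type*} [NormedAddCommGroup E] [InnerProductSpace ℝ E] [FiniteDimensional ℝ E]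
  [NormedAddCommGroup W] [InnerProductSpace ℝ W] [FiniteDimensional ℝ W]

/-- Throughout, `s` stands for the square root of `γG`, which avoids roots in the estimates. -/
theorem mul_norm_le_norm_adjoint {G : E →L[ℝ] W} {s : ℝ}
    (hG : s ^ 2 • ContinuousLinearMap.id ℝ W ≤ G ∘L G.adjoint) (y : W) :
    s * ‖y‖ ≤ ‖G.adjoint y‖ := by
  have h := ((ContinuousLinearMap.isPositive_iff _).1 hG).2 y
  have h2 : ⟪G (G.adjoint y) - s ^ 2 • y, y⟫_ℝ = ‖G.adjoint y‖ ^ 2 - s ^ 2 * ‖y‖ ^ 2 := by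
    rw [inner_sub_left, real_inner_smul_left, real_inner_self_eq_norm_sq,
      ← ContinuousLinearMap.adjoint_inner_right, real_inner_self_eq_norm_sq]
  have h3 : 0 ≤ ⟪G (G.adjoint y) - s ^ 2 • y, y⟫_ℝ := h
  refine abs_le_of_sq_le_sq' ?_ (norm_nonneg _) |>.2
  nlinarith

/-- Every vector is the sum of an element of `ker G` and one controlled by its image under `G`. -/
theorem exists_ker_decomposition {G : E →L[ℝ] W} {s : ℝ} (hs : 0 < s)
    (hG : s ^ 2 • ContinuousLinearMap.id ℝ W ≤ G ∘L G.adjoint) (x : E) :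
    ∃ v u : E, x = v + u ∧ G v = 0 ∧ s * ‖u‖ ≤ ‖G x‖ := by
  have hnorm : ∀ y, ⟪y, G (G.adjoint y)⟫_ℝ = ‖G.adjoint y‖ ^ 2 := fun y => by
    rw [← ContinuousLinearMap.adjoint_inner_left, real_inner_self_eq_norm_sq]
  have hinj : Function.Injective (G ∘L G.adjoint) := by
    refine (injective_iff_map_eq_zero _).2 fun y hy => ?_
    have h1 := hnorm y
    have h2 := mul_norm_le_norm_adjoint hG y
    rw [show G (G.adjoint y) = 0 from hy, inner_zero_right] at h1
    have h3 : ‖G.adjoint y‖ = 0 := pow_eq_zero_iff two_ne_zero |>.1 h1.symm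
    rw [h3] at h2
    exact norm_le_zero_iff.1 (nonpos_of_mul_nonpos_right h2 hs)
  obtain ⟨y, hy⟩ := (LinearMap.injective_iff_surjective
    (f := ((G ∘L G.adjoint : W →L[ℝ] W) : W →ₗ[ℝ] W))).1 hinj (G x)
  replace hy : G (G.adjoint y) = G x := hy
  -- The normal part is `u = Gᵀ y` with `G Gᵀ y = G x`. Its bound combines `‖u‖² = ⟪y, G x⟫` with `s
  -- ‖y‖ ≤ ‖u‖`.
  refine ⟨x - G.adjoint y, G.adjoint y, by abel, by rw [map_sub, hy, sub_self], ?_⟩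
  have h1 := hnorm y
  have h2 := mul_norm_le_norm_adjoint hG y
  have h3 := real_inner_le_norm y (G x)
  rw [hy] at h1
  rw [h1] at h3
  rcases (norm_nonneg (G.adjoint y)).eq_or_lt with h0 | h0
  · rw [← h0, mul_zero]; exact norm_nonneg _
  · have h4 : s * ‖G.adjoint y‖ ^ 2 ≤ ‖G.adjoint y‖ * ‖G x‖ := by
      nlinarith [norm_nonneg (G x)]
    nlinarith

/-- A priori bounds for the solution `(x, l)` of a KKT system. -/
theorem exists_kkt_bounds {B : E →L[ℝ] E} {G : E →L[ℝ] W} {s γ U : ℝ} (hs : 0 < s)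
    (hG : s ^ 2 • ContinuousLinearMap.id ℝ W ≤ G ∘L G.adjoint) (hBU : ‖B‖ ≤ U)
    (hB : ∀ v, G v = 0 → γ * ‖v‖ ^ 2 ≤ ⟪v, B v⟫_ℝ) (x : E) (l : W) :
    ∃ V : ℝ, 0 ≤ V ∧ ‖x‖ ≤ V + ‖G x‖ / s ∧ s * ‖l‖ ≤ ‖B x + G.adjoint l‖ + U * ‖x‖ ∧
      γ * V ^ 2 - 2 * U * V * (‖G x‖ / s) - U * (‖G x‖ / s) ^ 2 ≤ ⟪x, B x⟫_ℝ ∧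
      γ * V ^ 2 ≤ V * (‖B x + G.adjoint l‖ + U * (‖G x‖ / s)) := by
  obtain ⟨v, u, hx, hv, hu⟩ := exists_ker_decomposition hs hG x
  have hu' : ‖u‖ ≤ ‖G x‖ / s := by rwa [le_div_iff₀ hs, mul_comm]
  have hBy : ∀ y, ‖B y‖ ≤ U * ‖y‖ := fun y => B.le_of_opNorm_le hBU y
  have hU : 0 ≤ U := (norm_nonneg _).trans hBU
  have hin : ∀ y y', |⟪y, B y'⟫_ℝ| ≤ U * ‖y‖ * ‖y'‖ := fun y y' =>
    (abs_real_inner_le_norm _ _).trans (by nlinarith [hBy y', norm_nonneg y])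
  have hUu : ‖v‖ * (U * ‖u‖) ≤ ‖v‖ * (U * (‖G x‖ / s)) := by gcongr
  -- `V` is the length of the tangential part of `x`; the normal part has length at most `‖G x‖ /
  -- s`.
  refine ⟨‖v‖, norm_nonneg _, ?_, ?_, ?_, ?_⟩
  · calc ‖x‖ ≤ ‖v‖ + ‖u‖ := by rw [hx]; exact norm_add_le _ _
      _ ≤ _ := by gcongr
  · refine (mul_norm_le_norm_adjoint hG l).trans ?_
    calc ‖G.adjoint l‖ = ‖(B x + G.adjoint l) - B x‖ := by rw [add_sub_cancel_left]
      _ ≤ _ := (norm_sub_le _ _).trans (by gcongr; exact hBy x)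
  · have e : ⟪x, B x⟫_ℝ = ⟪v, B v⟫_ℝ + ⟪v, B u⟫_ℝ + ⟪u, B v⟫_ℝ + ⟪u, B u⟫_ℝ := by
      rw [hx, map_add, inner_add_left, inner_add_right, inner_add_right]; ring
    have h1 := abs_le.1 (hin v u)
    have h2 := abs_le.1 (hin u v)
    have h3 := abs_le.1 (hin u u)
    have h4 : U * (‖u‖ * ‖u‖) ≤ U * (‖G x‖ / s * (‖G x‖ / s)) := by gcongr
    nlinarith [hB v hv]
  -- Testing the first block row with `v ∈ ker G` removes the multiplier `l`.
  · have e : ⟪v, B x + G.adjoint l⟫_ℝ = ⟪v, B v⟫_ℝ + ⟪v, B u⟫_ℝ := by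
      rw [inner_add_right, ContinuousLinearMap.adjoint_inner_right, hv, inner_zero_left, add_zero]
      conv_lhs => rw [hx]
      rw [map_add, inner_add_right]
    have h0 := real_inner_le_norm v (B x + G.adjoint l)
    have h1 := abs_le.1 (hin v u)
    nlinarith [hB v hv]

/-- The bounds are chained: first the tangential part by curvature, then `x` by adding the normal
part, then `l` because `Gᵀ` is bounded below. -/
theorem norm_kkt_solution_le {B : E →L[ℝ] E} {G : E →L[ℝ] W} {s γ U : ℝ} (hs : 0 < s) (hγ : 0 < γ)
    (hG : s ^ 2 • ContinuousLinearMap.id ℝ W ≤ G ∘L G.adjoint) (hBU : ‖B‖ ≤ U)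
    (hB : ∀ v, G v = 0 → γ * ‖v‖ ^ 2 ≤ ⟪v, B v⟫_ℝ) (x : E) (l : W) :
    ‖x‖ + ‖l‖ ≤ ((1 + U / s) * ((1 + U / s) / γ + 1 / s) + 1 / s) *
      (‖B x + G.adjoint l‖ + ‖G x‖) := by
  obtain ⟨V, hV, h1, h2, -, h3⟩ := exists_kkt_bounds hs hG hBU hB x l
  have hU : 0 ≤ U := (norm_nonneg _).trans hBU
  set A := ‖B x + G.adjoint l‖
  set C := ‖G x‖
  have hA : 0 ≤ A := norm_nonneg _
  have hC : 0 ≤ C := norm_nonneg _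
  have hV' : V ≤ (1 + U / s) / γ * (A + C) := by
    have h4 : γ * V ≤ A + U * (C / s) := by
      rcases hV.eq_or_lt with h0 | h0
      · rw [← h0, mul_zero]; positivity
      · nlinarith
    rw [div_mul_eq_mul_div, le_div_iff₀ hγ]
    have : 0 ≤ U / s * A := by positivity
    have e : U * (C / s) = U / s * C := by ring
    nlinarith
  have hx : ‖x‖ ≤ ((1 + U / s) / γ + 1 / s) * (A + C) := by
    have : 0 ≤ 1 / s * A := by positivity
    have e : C / s = 1 / s * C := by ring
    nlinarith
  have hl : ‖l‖ ≤ 1 / s * (A + C) + U / s * ‖x‖ := by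
    have h5 : ‖l‖ ≤ (A + U * ‖x‖) / s := by rwa [le_div_iff₀ hs, mul_comm]
    have : 0 ≤ 1 / s * C := by positivity
    have e : (A + U * ‖x‖) / s = 1 / s * A + U / s * ‖x‖ := by ring
    nlinarith
  have h6 : (1 + U / s) * ‖x‖ ≤ (1 + U / s) * (((1 + U / s) / γ + 1 / s) * (A + C)) := by gcongr
  nlinarith

end KKT

/-! ### The scalar inequalities behind the descent of the merit function. -/

theorem descent_quadratic_form {a b D : ℝ} (ha : 0 ≤ a) (hD : 0 ≤ D) :
    -a ^ 2 - b ^ 2 + a * b + 4 * a * D + 5 / 2 * b * D - 45 * D ^ 2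
      + 1 / 64 * ((b + D) * (a + b + D)) ≤ -(b ^ 2 / 8) - 12 * D ^ 2 := by
  -- Completes the square in `a`; the coefficient `4 + 1/64` of `a D` may be enlarged to 5 because
  -- `a D ≥ 0`. The remaining form in `b` and `D` is positive thanks to the large multiple of `D²`.
  nlinarith [sq_nonneg (a - 65 / 128 * b - 5 / 2 * D), sq_nonneg (b - 9 * D), sq_nonneg (b - 5 * D),
    sq_nonneg D, sq_nonneg b, sq_nonneg (b - 6 * D), mul_nonneg ha hD]

set_option maxHeartbeats 1000000 in
/-- The decrease of the merit function along an inexact Newton direction, as an inequality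
between norms. -/
theorem descent_inequality {γ s U L ε A C V X l : ℝ} (hγ : 0 < γ) (hγ1 : γ ≤ 1) (hs : 0 < s)
    (hs1 : s ≤ 1) (hU : 1 ≤ U) (hL : 1 ≤ L)
    (hε' : ε ≤ γ ^ 2 * s ^ 4 / (4096 * (U + L) ^ 5)) (hA : 0 ≤ A) (hC : 0 ≤ C) (hV : 0 ≤ V)
    (hX0 : 0 ≤ X) (hX : X ≤ V + C / s) (hl0 : 0 ≤ l) (hl : s * l ≤ A + U * X) :
    -(γ * V ^ 2 - 2 * U * V * (C / s) - U * (C / s) ^ 2) + 2 * C * l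
      - 48 * (U + L) ^ 2 / (s ^ 2 * γ) * C ^ 2
      + γ / (U + L) ^ 2 * (-A ^ 2 - C ^ 2 + (U + L) * A * X)
      + ε * (((A + C) * (1 + γ / (U + L) ^ 2 * L) + 48 * (U + L) ^ 2 / (s ^ 2 * γ) * L * C) * (X + l))
      ≤ -(γ / (8 * (U + L) ^ 2)) * (A ^ 2 + C ^ 2) := by
  -- `A` and `C` are the norms of the two blocks of `∇L`, `X` and `l` those of the Newton direction,
  -- and `V` is the tangential part of `X`. The coefficients of `C²` and of the last bracket contain
  -- `ρ = 48 κ²/(s²γ)` and `ν = γ/κ²`.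
  obtain ⟨κ, hκ⟩ : ∃ κ, κ = U + L := ⟨_, rfl⟩
  rw [← hκ] at hε' ⊢
  obtain ⟨r, hr⟩ : ∃ r, r = Real.sqrt γ := ⟨_, rfl⟩
  have hr0 : 0 < r := by rw [hr]; exact Real.sqrt_pos.2 hγ
  have hr1 : r ≤ 1 := by rw [hr]; exact Real.sqrt_le_one.2 hγ1
  have hγr : γ = r ^ 2 := by rw [hr, Real.sq_sqrt hγ.le]
  clear hr
  subst hγr
  have hκ0 : 0 < κ := by linarith
  have hκ2 : 2 ≤ κ := by linarith
  have hUκ : 1 + U ≤ κ := by linarith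
  have hLκ : L ≤ κ := by linarith
  -- In the scaled variables `a`, `b`, `D` all parameters can be bounded away: each term is at most
  -- an absolute constant times a quadratic monomial, and the weights `ρ`, `ν` are chosen to that
  -- end.
  obtain ⟨a, ha⟩ : ∃ a, a = r * V := ⟨_, rfl⟩
  obtain ⟨b, hb⟩ : ∃ b, b = r * A / κ := ⟨_, rfl⟩
  obtain ⟨D, hD⟩ : ∃ D, D = κ * C / (s * r) := ⟨_, rfl⟩
  have ha0 : 0 ≤ a := by rw [ha]; positivity
  have hb0 : 0 ≤ b := by rw [hb]; positivity
  have hD0 : 0 ≤ D := by rw [hD]; positivity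
  have hVa : V = a / r := by rw [ha]; field_simp
  have hAb : A = κ * b / r := by rw [hb]; field_simp
  have hCD : C = s * r * D / κ := by rw [hD]; field_simp
  have hrκ : r / κ ≤ 1 := by rw [div_le_one hκ0]; linarith
  have hrκ0 : 0 ≤ r / κ := by positivity
  have hUκ1 : U / κ ≤ 1 := by rw [div_le_one hκ0]; linarith
  have hUκ0 : 0 ≤ U / κ := by positivity
  have hCs : C / s = r / κ * D := by rw [hCD]; field_simp
  have hX' : X ≤ a / r + r / κ * D := by rw [← hVa, ← hCs]; exact hX
  have hrX : r * X ≤ a + r ^ 2 / κ * D := by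
    have := mul_le_mul_of_nonneg_left hX' hr0.le
    have e : r * (a / r + r / κ * D) = a + r ^ 2 / κ * D := by field_simp
    linarith
  have hr2κ : r ^ 2 / κ ≤ 1 / 2 := by
    rw [div_le_div_iff₀ hκ0 two_pos]; linarith
  have hrX2 : r * X ≤ a + 1 / 2 * D :=
    hrX.trans (add_le_add_right (mul_le_mul_of_nonneg_right hr2κ hD0) a)
  -- the terms of the exact decrease
  have t1 : r ^ 2 * V ^ 2 = a ^ 2 := by rw [ha]; ring
  have t2 : 2 * U * V * (C / s) ≤ 2 * (a * D) := by
    have e : 2 * U * V * (C / s) = U / κ * (2 * (a * D)) := by rw [hCs, hVa]; field_simp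
    rw [e]
    exact mul_le_of_le_one_left (by positivity) hUκ1
  have t3 : U * (C / s) ^ 2 ≤ D ^ 2 := by
    have e : U * (C / s) ^ 2 = (U / κ) * (r ^ 2 / κ) * D ^ 2 := by rw [hCs]; field_simp
    rw [e]
    exact mul_le_of_le_one_left (by positivity)
      (mul_le_one₀ hUκ1 (by positivity) (hr2κ.trans (by norm_num)))
  have t4 : 2 * C * l ≤ 2 * (b * D) + 2 * (a * D) + D ^ 2 := by
    have h1 : 2 * C * l = 2 * (C / s) * (s * l) := by field_simp
    have h2 : 2 * (C / s) * (s * l) ≤ 2 * (C / s) * (A + U * X) := by gcongr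
    have h3 : 2 * (C / s) * (A + U * X) = 2 * (b * D) + U / κ * (2 * D * (r * X)) := by
      rw [hCs, hAb]; field_simp
    have h4 : U / κ * (2 * D * (r * X)) ≤ 2 * D * (r * X) :=
      mul_le_of_le_one_left (by positivity) hUκ1
    have h5 : 2 * D * (r * X) ≤ 2 * D * (a + 1 / 2 * D) := by gcongr
    rw [h1]
    refine h2.trans (h3.le.trans ?_)
    linarith
  have t5 : 48 * κ ^ 2 / (s ^ 2 * r ^ 2) * C ^ 2 = 48 * D ^ 2 := by rw [hD]; field_simp
  have t6 : r ^ 2 / κ ^ 2 * (-A ^ 2 - C ^ 2 + κ * A * X) ≤ -b ^ 2 + a * b + 1 / 2 * b * D := by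
    have e : r ^ 2 / κ ^ 2 * (-A ^ 2 - C ^ 2 + κ * A * X)
        = -b ^ 2 - r ^ 2 / κ ^ 2 * C ^ 2 + b * (r * X) := by
      rw [hb]; field_simp
    rw [e]
    have h1 : 0 ≤ r ^ 2 / κ ^ 2 * C ^ 2 := by positivity
    have h2 : b * (r * X) ≤ b * (a + 1 / 2 * D) := by gcongr
    linarith
  -- the error terms
  have hsr : s * r ≤ 1 := mul_le_one₀ hs1 hr0.le hr1
  have hsr0 : 0 < s * r := by positivity
  -- For `D`, 50 is 48 from the weight `ρ` plus 2 from `1 + ν L ≤ 2`; for `b` it is generous.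
  have f1 : (A + C) * (1 + r ^ 2 / κ ^ 2 * L) + 48 * κ ^ 2 / (s ^ 2 * r ^ 2) * L * C
      ≤ 50 * κ ^ 2 / (s * r) * (b + D) := by
    have h1 : r ^ 2 / κ ^ 2 * L ≤ 1 := by
      rw [div_mul_eq_mul_div, div_le_one (by positivity)]
      calc r ^ 2 * L ≤ 1 * κ := by gcongr
        _ ≤ κ * κ := by gcongr; linarith
        _ = κ ^ 2 := by ring
    have h2 : 48 * κ ^ 2 / (s ^ 2 * r ^ 2) * L * C ≤ 48 * κ ^ 2 / (s * r) * D := by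
      have e : 48 * κ ^ 2 / (s ^ 2 * r ^ 2) * L * C = (L / κ) * (48 * κ ^ 2 / (s * r) * D) := by
        rw [hD]; field_simp
      rw [e]
      exact mul_le_of_le_one_left (by positivity) ((div_le_one hκ0).2 hLκ)
    have h3 : A ≤ 25 * κ ^ 2 / (s * r) * b := by
      have e : A = s / (25 * κ) * (25 * κ ^ 2 / (s * r) * b) := by rw [hAb]; field_simp
      rw [e]
      refine mul_le_of_le_one_left (by positivity) ((div_le_one (by positivity)).2 (by linarith))
    have h4 : C ≤ κ ^ 2 / (s * r) * D := by
      have e : C = (s * r) ^ 2 / κ ^ 3 * (κ ^ 2 / (s * r) * D) := by rw [hCD]; field_simp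
      rw [e]
      refine mul_le_of_le_one_left (by positivity) ((div_le_one (by positivity)).2 ?_)
      exact (pow_le_one₀ hsr0.le hsr).trans (one_le_pow₀ (by linarith))
    have e : 50 * κ ^ 2 / (s * r) * (b + D) = 2 * (25 * κ ^ 2 / (s * r) * b)
        + 48 * κ ^ 2 / (s * r) * D + 2 * (κ ^ 2 / (s * r) * D) := by ring
    have h5 : (A + C) * (1 + r ^ 2 / κ ^ 2 * L) ≤
        (25 * κ ^ 2 / (s * r) * b + κ ^ 2 / (s * r) * D) * (1 + 1) := by gcongr
    rw [e]
    linarith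
  have f2 : X + l ≤ κ / (s * r) * (a + b + D) := by
    have h1 : s * r * (X + l) ≤ κ * (a + b + D) := by
      have h2 : r * (s * l) ≤ r * (A + U * X) := by gcongr
      have h3 : r * A = κ * b := by rw [hb]; field_simp
      have h4 : s * (r * X) ≤ r * X := mul_le_of_le_one_left (by positivity) hs1
      have h5 : (1 + U) * (r * X) ≤ κ * (a + 1 / 2 * D) := by gcongr
      have e : s * r * (X + l) = s * (r * X) + r * (s * l) := by ring
      have h6 : 0 ≤ κ * D := by positivity
      rw [e]
      linarith
    rw [div_mul_eq_mul_div, le_div_iff₀ hsr0]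
    linarith
  -- The tolerance is made for this step: `f1` and `f2` cost `50 κ³ / (s r)²`, which `κ⁵` and `(s
  -- r)⁴` outweigh, and `50 / 4096 ≤ 1 / 64`.
  have f3 : ε * (((A + C) * (1 + r ^ 2 / κ ^ 2 * L) + 48 * κ ^ 2 / (s ^ 2 * r ^ 2) * L * C) *
      (X + l)) ≤ 1 / 64 * ((b + D) * (a + b + D)) := by
    calc _ ≤ ((r ^ 2) ^ 2 * s ^ 4 / (4096 * κ ^ 5)) *
          ((50 * κ ^ 2 / (s * r) * (b + D)) * (κ / (s * r) * (a + b + D))) := by gcongr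
      _ = (50 * (s * r) ^ 2 / (4096 * κ ^ 2)) * ((b + D) * (a + b + D)) := by field_simp
      _ ≤ _ := by
        refine mul_le_mul_of_nonneg_right ?_ (by positivity)
        rw [div_le_div_iff₀ (by positivity) (by norm_num)]
        have h1 : (s * r) ^ 2 ≤ 1 := pow_le_one₀ hsr0.le hsr
        have h2 : 1 ≤ κ ^ 2 := one_le_pow₀ (by linarith)
        linarith
  have hq := descent_quadratic_form (b := b) ha0 hD0
  have c1 : r ^ 2 / (8 * κ ^ 2) * A ^ 2 = b ^ 2 / 8 := by rw [hb]; field_simp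
  have c2 : r ^ 2 / (8 * κ ^ 2) * C ^ 2 ≤ 12 * D ^ 2 := by
    have e : r ^ 2 / (8 * κ ^ 2) * C ^ 2 = s ^ 2 * r ^ 4 / (96 * κ ^ 4) * (12 * D ^ 2) := by
      rw [hD]; field_simp; ring
    rw [e]
    refine mul_le_of_le_one_left (by positivity) ((div_le_one (by positivity)).2 ?_)
    have h1 : s ^ 2 ≤ 1 := pow_le_one₀ hs.le hs1
    have h2 : r ^ 4 ≤ 1 := pow_le_one₀ hr0.le hr1
    have h3 : 1 ≤ κ ^ 4 := one_le_pow₀ (by linarith)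
    have : s ^ 2 * r ^ 4 ≤ 1 := mul_le_one₀ h1 (by positivity) h2
    linarith
  have c3 : -(r ^ 2 / (8 * κ ^ 2)) * (A ^ 2 + C ^ 2)
      = -(r ^ 2 / (8 * κ ^ 2) * A ^ 2) - r ^ 2 / (8 * κ ^ 2) * C ^ 2 := by ring
  rw [t1, t5, c3, c1]
  -- The terms add up to `-46 D²`, namely `-48` from the weight `ρ` and `1` from each of `t3` and
  -- `t4`; the quadratic form needs only `-45 D²`.
  have := sq_nonneg D
  linarith only [this, t2, t3, t4, t6, f3, hq, c2]

/-! ### Gradients and Hessians on a Hilbert space. -/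

section Gradient

variable {H : Type*} [NormedAddCommGroup H] [InnerProductSpace ℝ H] [CompleteSpace H]

theorem inner_gradient (φ : H → ℝ) (x v : H) : ⟪∇ φ x, v⟫_ℝ = fderiv ℝ φ x v := by
  rw [gradient, ← InnerProductSpace.toDual_apply_apply, LinearIsometryEquiv.apply_symm_apply]

/-- The Riesz isometry reduces this to the symmetry of the second derivative, in the version that
needs differentiability of the gradient at one point only; the sampled functions are not assumed to
be `C²`. -/
theorem isSelfAdjoint_hess {φ : H → ℝ} (h1 : Differentiable ℝ φ) {x : H}
    (h2 : DifferentiableAt ℝ (∇ φ) x) : IsSelfAdjoint (hess φ x) := by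
  rw [ContinuousLinearMap.isSelfAdjoint_iff_isSymmetric]
  intro v w
  have h3 : HasFDerivAt (fun y => fderiv ℝ φ y)
      ((InnerProductSpace.toDual ℝ H).toContinuousLinearEquiv.toContinuousLinearMap ∘L hess φ x)
      x := by
    have e : (fun y => fderiv ℝ φ y) =
        (InnerProductSpace.toDual ℝ H).toContinuousLinearEquiv.toContinuousLinearMap ∘ ∇ φ := by
      ext y w
      exact (inner_gradient φ y w).symm
    rw [e]
    exact (ContinuousLinearMap.hasFDerivAt _).comp x h2.hasFDerivAt
  have h4 := second_derivative_symmetric (𝕜 := ℝ) (fun y => (h1 y).hasFDerivAt) h3 v w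
  have h5 : ⟪hess φ x v, w⟫_ℝ = ⟪hess φ x w, v⟫_ℝ := h4
  exact h5.trans (real_inner_comm _ _)

theorem contDiff_gradient {φ : H → ℝ} (h : ContDiff ℝ 2 φ) : ContDiff ℝ 1 (∇ φ) := by
  have h1 : ContDiff ℝ 1 (fderiv ℝ φ) := h.fderiv_right (by norm_num)
  exact (InnerProductSpace.toDual ℝ H).symm.toContinuousLinearEquiv.contDiff.comp h1

theorem continuous_hess {φ : H → ℝ} (h : ContDiff ℝ 2 φ) : Continuous (hess φ) :=
  (contDiff_gradient h).continuous_fderiv one_ne_zero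

theorem twiceDifferentiable_of_contDiff {φ : H → ℝ} (h : ContDiff ℝ 2 φ) :
    TwiceDifferentiable φ :=
  ⟨h.differentiable two_ne_zero, (contDiff_gradient h).differentiable one_ne_zero⟩

theorem TwiceDifferentiable.isSelfAdjoint_hess {φ : H → ℝ} (h : TwiceDifferentiable φ) (x : H) :
    IsSelfAdjoint (hess φ x) :=
  AIStoSQP.isSelfAdjoint_hess h.1 (h.2 x)

end Gradient

/-! ### KKT matrices, and the descent direction of the merit function. -/

section Blocks

variable {d m : ℕ}

theorem kkt_apply (B : Vec d →L[ℝ] Vec d) (G : Vec d →L[ℝ] Vec m) (p : PD d m) :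
    kkt B G p = WithLp.toLp 2 (B p.fst + G.adjoint p.snd, G p.fst) := rfl

theorem inner_pd (p q : PD d m) : ⟪p, q⟫_ℝ = ⟪p.fst, q.fst⟫_ℝ + ⟪p.snd, q.snd⟫_ℝ := rfl

theorem norm_pd_sq (p : PD d m) : ‖p‖ ^ 2 = ‖p.fst‖ ^ 2 + ‖p.snd‖ ^ 2 :=
  WithLp.prod_norm_sq_eq_of_L2 p

theorem norm_fst_le_pd (p : PD d m) : ‖p.fst‖ ≤ ‖p‖ := by
  have := norm_pd_sq p
  refine abs_le_of_sq_le_sq' ?_ (norm_nonneg _) |>.2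
  nlinarith [sq_nonneg ‖p.snd‖]

theorem norm_snd_le_pd (p : PD d m) : ‖p.snd‖ ≤ ‖p‖ := by
  have := norm_pd_sq p
  refine abs_le_of_sq_le_sq' ?_ (norm_nonneg _) |>.2
  nlinarith [sq_nonneg ‖p.fst‖]

theorem norm_pd_le (p : PD d m) : ‖p‖ ≤ ‖p.fst‖ + ‖p.snd‖ := by
  have := norm_pd_sq p
  refine abs_le_of_sq_le_sq' ?_ (by positivity) |>.2
  nlinarith [norm_nonneg p.fst, norm_nonneg p.snd]

theorem isSelfAdjoint_kkt {B : Vec d →L[ℝ] Vec d} (hB : IsSelfAdjoint B)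
    (G : Vec d →L[ℝ] Vec m) : IsSelfAdjoint (kkt B G) := by
  rw [ContinuousLinearMap.isSelfAdjoint_iff_isSymmetric] at hB ⊢
  intro p q
  have h := hB p.fst q.fst
  change ⟪kkt B G p, q⟫_ℝ = ⟪p, kkt B G q⟫_ℝ
  change ⟪B p.fst, q.fst⟫_ℝ = ⟪p.fst, B q.fst⟫_ℝ at h
  rw [kkt_apply, kkt_apply, inner_pd, inner_pd]
  simp only [WithLp.toLp_fst, WithLp.toLp_snd]
  rw [inner_add_left, inner_add_right, h, ContinuousLinearMap.adjoint_inner_left,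
    ContinuousLinearMap.adjoint_inner_right]
  ring

theorem continuous_kkt :
    Continuous fun p : (Vec d →L[ℝ] Vec d) × (Vec d →L[ℝ] Vec m) => kkt p.1 p.2 := by
  have hadj : Continuous fun B : Vec d →L[ℝ] Vec m => B.adjoint :=
    (ContinuousLinearMap.adjoint (𝕜 := ℝ) (E := Vec d) (F := Vec m)).continuous
  refine continuous_const.clm_comp (Continuous.clm_comp ?_ continuous_const)
  have h1 : Continuous fun p : (Vec d →L[ℝ] Vec d) × (Vec d →L[ℝ] Vec m) =>
      p.1 ∘L ContinuousLinearMap.fst ℝ (Vec d) (Vec m) +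
        p.2.adjoint ∘L ContinuousLinearMap.snd ℝ (Vec d) (Vec m) :=
    (continuous_fst.clm_comp continuous_const).add
      ((hadj.comp continuous_snd).clm_comp continuous_const)
  have h2 : Continuous fun p : (Vec d →L[ℝ] Vec d) × (Vec d →L[ℝ] Vec m) =>
      p.2 ∘L ContinuousLinearMap.fst ℝ (Vec d) (Vec m) := continuous_snd.clm_comp continuous_const
  exact (ContinuousLinearMap.prodₗᵢ ℝ (𝕜 := ℝ) (E := Vec d × Vec m)).continuous.comp (h1.prodMk h2)

/-- The bound on the inverse of a KKT matrix. -/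
noncomputable def kktBound (s γ U : ℝ) : ℝ :=
  2 * ((1 + U / s) * ((1 + U / s) / γ + 1 / s) + 1 / s)

theorem kktBound_nonneg {s γ U : ℝ} (hs : 0 < s) (hγ : 0 < γ) (hU : 0 ≤ U) :
    0 ≤ kktBound s γ U := by
  unfold kktBound; positivity

/-- A bound on the inverse of the KKT matrix, uniform over all iterations. -/
theorem norm_le_norm_kkt {B : Vec d →L[ℝ] Vec d} {G : Vec d →L[ℝ] Vec m} {s γ U : ℝ} (hs : 0 < s)
    (hγ : 0 < γ) (hG : s ^ 2 • ContinuousLinearMap.id ℝ (Vec m) ≤ G ∘L G.adjoint) (hBU : ‖B‖ ≤ U)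
    (hB : ∀ v, G v = 0 → γ * ‖v‖ ^ 2 ≤ ⟪v, B v⟫_ℝ) (z : PD d m) :
    ‖z‖ ≤ kktBound s γ U * ‖kkt B G z‖ := by
  have hU : 0 ≤ U := (norm_nonneg _).trans hBU
  have h1 := norm_kkt_solution_le hs hγ hG hBU hB z.fst z.snd
  have h2 := norm_fst_le_pd (kkt B G z)
  have h3 := norm_snd_le_pd (kkt B G z)
  rw [kkt_apply] at h2 h3
  have h4 : ‖B z.fst + G.adjoint z.snd‖ + ‖G z.fst‖ ≤ 2 * ‖kkt B G z‖ := by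
    rw [kkt_apply, two_mul]; exact add_le_add h2 h3
  refine (norm_pd_le z).trans (h1.trans ?_)
  rw [kktBound, mul_comm 2, mul_assoc]
  gcongr

/-- The gradient of the merit function `φ = L + ρ/2 ‖c‖² + ν/2 ‖∇L‖²` in terms of `g = ∇L` and
`T = ∇²L`. -/
noncomputable def meritGrad (ρ ν : ℝ) (T : PD d m →L[ℝ] PD d m) (g : PD d m) : PD d m :=
  g + ρ • T.adjoint (WithLp.toLp 2 (0, g.snd)) + ν • T.adjoint g

theorem inner_meritGrad (ρ ν : ℝ) (T : PD d m →L[ℝ] PD d m) (g h : PD d m) :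
    ⟪meritGrad ρ ν T g, h⟫_ℝ = ⟪g, h⟫_ℝ + ρ * ⟪g.snd, (T h).snd⟫_ℝ + ν * ⟪g, T h⟫_ℝ := by
  rw [meritGrad, inner_add_left, inner_add_left, real_inner_smul_left, real_inner_smul_left,
    ContinuousLinearMap.adjoint_inner_left, ContinuousLinearMap.adjoint_inner_left, inner_pd
      (WithLp.toLp 2 (0, g.snd))]
  simp

theorem norm_toLp_zero_left (y : Vec m) : ‖(WithLp.toLp 2 ((0 : Vec d), y) : PD d m)‖ = ‖y‖ := by
  have := norm_pd_sq (WithLp.toLp 2 ((0 : Vec d), y) : PD d m)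
  simp only [WithLp.toLp_fst, WithLp.toLp_snd, norm_zero] at this
  exact (pow_left_inj₀ (norm_nonneg _) (norm_nonneg _) two_ne_zero).1 (by linarith)

theorem norm_meritGrad_le {ρ ν L : ℝ} (hρ : 0 ≤ ρ) (hν : 0 ≤ ν) {T : PD d m →L[ℝ] PD d m}
    (hT : ‖T‖ ≤ L) (g : PD d m) :
    ‖meritGrad ρ ν T g‖ ≤ ‖g‖ * (1 + ν * L) + ρ * L * ‖g.snd‖ := by
  have hT' : ‖T.adjoint‖ ≤ L := by rwa [LinearIsometryEquiv.norm_map]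
  have h1 := T.adjoint.le_of_opNorm_le hT' (WithLp.toLp 2 (0, g.snd))
  have h2 := T.adjoint.le_of_opNorm_le hT' g
  rw [norm_toLp_zero_left] at h1
  refine (norm_add₃_le).trans ?_
  rw [norm_smul, norm_smul, Real.norm_of_nonneg hρ, Real.norm_of_nonneg hν]
  have h3 := mul_le_mul_of_nonneg_left h1 hρ
  have h4 := mul_le_mul_of_nonneg_left h2 hν
  linarith

/-- An inexact Newton direction is a descent direction of the merit function. -/
theorem inner_meritGrad_le {B H : Vec d →L[ℝ] Vec d} {G : Vec d →L[ℝ] Vec m} {s γ U L ε : ℝ}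
    (hγ : 0 < γ) (hγ1 : γ ≤ 1) (hs : 0 < s) (hs1 : s ≤ 1) (hU : 1 ≤ U) (hL : 1 ≤ L)
    (hε : 0 ≤ ε) (hε' : ε ≤ γ ^ 2 * s ^ 4 / (4096 * (U + L) ^ 5))
    (hG : s ^ 2 • ContinuousLinearMap.id ℝ (Vec m) ≤ G ∘L G.adjoint) (hBU : ‖B‖ ≤ U)
    (hB : ∀ v, G v = 0 → γ * ‖v‖ ^ 2 ≤ ⟪v, B v⟫_ℝ) (hT : ‖kkt H G‖ ≤ L)
    {g z e : PD d m} (hz : kkt B G z = -g) (he : ‖e - z‖ ≤ ε * ‖z‖) :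
    ⟪meritGrad (48 * (U + L) ^ 2 / (s ^ 2 * γ)) (γ / (U + L) ^ 2) (kkt H G) g, e⟫_ℝ
      ≤ -(γ / (8 * (U + L) ^ 2)) * ‖g‖ ^ 2 := by
  obtain ⟨ρ, hρ⟩ : ∃ ρ, ρ = 48 * (U + L) ^ 2 / (s ^ 2 * γ) := ⟨_, rfl⟩
  obtain ⟨ν, hν⟩ : ∃ ν, ν = γ / (U + L) ^ 2 := ⟨_, rfl⟩
  have hρ0 : 0 ≤ ρ := by rw [hρ]; positivity
  have hν0 : 0 ≤ ν := by rw [hν]; positivity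
  obtain ⟨V, hV, h1, h2, h3, -⟩ := exists_kkt_bounds hs hG hBU hB z.fst z.snd
  have ea : B z.fst + G.adjoint z.snd = -g.fst := congrArg WithLp.fst hz
  have ec : G z.fst = -g.snd := congrArg WithLp.snd hz
  rw [ea, norm_neg] at h2
  rw [ec, norm_neg] at h1 h3
  have key := descent_inequality hγ hγ1 hs hs1 hU hL hε' (norm_nonneg g.fst) (norm_nonneg g.snd)
    hV (norm_nonneg z.fst) h1 (norm_nonneg z.snd) h2
  rw [← hρ, ← hν] at key
  rw [← hρ, ← hν]
  -- Evaluating the full matrix at `(z.fst, 0)` isolates the block `H`.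
  have hH : ‖H z.fst‖ ≤ L * ‖z.fst‖ := by
    have h4 := (kkt H G).le_of_opNorm_le hT (WithLp.toLp 2 (z.fst, 0))
    have h5 := norm_fst_le_pd (kkt H G (WithLp.toLp 2 (z.fst, 0)))
    have h6 := norm_pd_le (WithLp.toLp 2 (z.fst, 0) : PD d m)
    rw [kkt_apply] at h5
    simp only [WithLp.toLp_fst, WithLp.toLp_snd, map_zero, add_zero, norm_zero] at h5 h6
    rw [kkt_apply] at h4
    simp only [WithLp.toLp_fst, WithLp.toLp_snd, map_zero, add_zero] at h4
    exact h5.trans (h4.trans (by gcongr))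
  have hBz := B.le_of_opNorm_le hBU z.fst
  -- the three parts of the exact directional derivative
  have p1 : ⟪g, z⟫_ℝ ≤ -⟪z.fst, B z.fst⟫_ℝ + 2 * ‖g.snd‖ * ‖z.snd‖ := by
    -- The first row of the Newton system replaces `g.fst`; then `G z.fst = -g.snd` makes the two
    -- multiplier terms equal, whence the factor 2.
    have e1 : ⟪g, z⟫_ℝ = -⟪z.fst, B z.fst⟫_ℝ + 2 * ⟪g.snd, z.snd⟫_ℝ := by
      rw [inner_pd, show g.fst = -(B z.fst + G.adjoint z.snd) by rw [ea, neg_neg], inner_neg_left,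
        inner_add_left, ContinuousLinearMap.adjoint_inner_left, ec, inner_neg_right,
        real_inner_comm z.snd, real_inner_comm (z.fst)]
      ring
    have := real_inner_le_norm g.snd z.snd
    linarith
  have p2 : ⟪g.snd, (kkt H G z).snd⟫_ℝ = -‖g.snd‖ ^ 2 := by
    rw [show (kkt H G z).snd = -g.snd from ec, inner_neg_right, real_inner_self_eq_norm_sq]
  have p3 : ⟪g, kkt H G z⟫_ℝ ≤ -‖g.fst‖ ^ 2 - ‖g.snd‖ ^ 2 + (U + L) * ‖g.fst‖ * ‖z.fst‖ := by
    -- The two KKT matrices differ only in the upper left block, so the true Hessian maps `z` to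
    -- `-g` up to `(H - B) z.fst`. Only the crude bound `U + L` for `H - B` is available.
    have e1 : (kkt H G z).fst = H z.fst - B z.fst - g.fst := by
      rw [kkt_apply, WithLp.toLp_fst, show G.adjoint z.snd = -g.fst - B z.fst by rw [← ea]; abel]
      module
    rw [inner_pd, p2, e1, inner_sub_right, real_inner_self_eq_norm_sq]
    have h4 := real_inner_le_norm g.fst (H z.fst - B z.fst)
    have h5 := norm_sub_le (H z.fst) (B z.fst)
    have h6 : ‖g.fst‖ * ‖H z.fst - B z.fst‖ ≤ ‖g.fst‖ * (L * ‖z.fst‖ + U * ‖z.fst‖) := by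
      gcongr; linarith
    linarith
  have p4 : ⟪meritGrad ρ ν (kkt H G) g, e - z⟫_ℝ ≤
      ε * (((‖g.fst‖ + ‖g.snd‖) * (1 + ν * L) + ρ * L * ‖g.snd‖) * (‖z.fst‖ + ‖z.snd‖)) := by
    have h4 := norm_meritGrad_le hρ0 hν0 hT g
    have hL0 : 0 ≤ L := by linarith
    calc _ ≤ ‖meritGrad ρ ν (kkt H G) g‖ * ‖e - z‖ := real_inner_le_norm _ _
      _ ≤ ((‖g.fst‖ + ‖g.snd‖) * (1 + ν * L) + ρ * L * ‖g.snd‖) *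
          (ε * (‖z.fst‖ + ‖z.snd‖)) := by
        gcongr
        · refine h4.trans ?_
          gcongr
          exact norm_pd_le g
        · refine he.trans ?_
          gcongr
          exact norm_pd_le z
      _ = _ := by ring
  have e0 : ⟪meritGrad ρ ν (kkt H G) g, e⟫_ℝ = ⟪g, z⟫_ℝ + ρ * ⟪g.snd, (kkt H G z).snd⟫_ℝ +
      ν * ⟪g, kkt H G z⟫_ℝ + ⟪meritGrad ρ ν (kkt H G) g, e - z⟫_ℝ := by
    rw [← inner_meritGrad, ← inner_add_right, add_sub_cancel]
  have h7 := mul_le_mul_of_nonneg_left p3 hν0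
  rw [e0, p2, norm_pd_sq g]
  linarith

end Blocks

/-! ### Taylor estimates on a convex set. -/

section Growth

variable {H : Type*} [NormedAddCommGroup H] [InnerProductSpace ℝ H] [CompleteSpace H]
  {φ : H → ℝ} {D : Set H} {L Λ : ℝ}

theorem norm_gradient_sub_le (hφ : ContDiff ℝ 2 φ) (hD : Convex ℝ D)
    (hL : ∀ p ∈ D, ‖hess φ p‖ ≤ L) {p q : H} (hp : p ∈ D) (hq : q ∈ D) :
    ‖∇ φ q - ∇ φ p‖ ≤ L * ‖q - p‖ :=
  hD.norm_image_sub_le_of_norm_fderiv_le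
    (fun x _ => (contDiff_gradient hφ).differentiable one_ne_zero x) hL hp hq

/-- The mean value inequality on the segment, applied to the gradient minus its linear part. It
yields `Λ` instead of the sharp `Λ / 2`, which is enough. -/
theorem norm_gradient_sub_sub_le (hφ : ContDiff ℝ 2 φ) (hD : Convex ℝ D) (hΛ : 0 ≤ Λ)
    (hlip : ∀ p ∈ D, ∀ q ∈ D, ‖hess φ p - hess φ q‖ ≤ Λ * ‖p - q‖) {p q : H} (hp : p ∈ D)
    (hq : q ∈ D) : ‖∇ φ q - ∇ φ p - hess φ p (q - p)‖ ≤ Λ * ‖q - p‖ ^ 2 := by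
  rw [pow_two, ← mul_assoc]
  refine (convex_segment p q).norm_image_sub_le_of_norm_fderiv_le' (𝕜 := ℝ)
    (fun x _ => (contDiff_gradient hφ).differentiable one_ne_zero x) (fun x hx => ?_)
    (left_mem_segment ℝ p q) (right_mem_segment ℝ p q)
  refine (hlip x (hD.segment_subset hp hq hx) p hp).trans ?_
  gcongr
  obtain ⟨t, ht, rfl⟩ := (segment_eq_image' ℝ p q) ▸ hx
  rw [add_sub_cancel_left, norm_smul, Real.norm_of_nonneg ht.1]
  exact mul_le_of_le_one_left (norm_nonneg _) ht.2

theorem sub_sub_inner_gradient_le (hφ : ContDiff ℝ 2 φ) (hD : Convex ℝ D) (hL0 : 0 ≤ L)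
    (hL : ∀ p ∈ D, ‖hess φ p‖ ≤ L) {p q : H} (hp : p ∈ D) (hq : q ∈ D) :
    φ q - φ p - ⟪∇ φ p, q - p⟫_ℝ ≤ L * ‖q - p‖ ^ 2 := by
  refine (le_abs_self _).trans ?_
  rw [inner_gradient, pow_two, ← mul_assoc]
  refine (convex_segment p q).norm_image_sub_le_of_norm_fderiv_le' (𝕜 := ℝ)
    (fun x _ => hφ.differentiable two_ne_zero x) (fun x hx => ?_)
    (left_mem_segment ℝ p q) (right_mem_segment ℝ p q)
  have h1 : ‖fderiv ℝ φ x - fderiv ℝ φ p‖ = ‖∇ φ x - ∇ φ p‖ := by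
    rw [gradient, gradient, ← map_sub, LinearIsometryEquiv.norm_map]
  rw [h1]
  refine (norm_gradient_sub_le hφ hD hL hp (hD.segment_subset hp hq hx)).trans ?_
  gcongr
  obtain ⟨t, ht, rfl⟩ := (segment_eq_image' ℝ p q) ▸ hx
  rw [add_sub_cancel_left, norm_smul, Real.norm_of_nonneg ht.1]
  exact mul_le_of_le_one_left (norm_nonneg _) ht.2

end Growth

/-! ### Derivatives of the Lagrangian and the second-order model of the merit function. -/

section Lagrangian

variable {d m : ℕ} {f : Vec d → ℝ} {c : Vec d → Vec m}

theorem contDiff_lagrangian (hf : ContDiff ℝ 2 f) (hc : ContDiff ℝ 2 c) :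
    ContDiff ℝ 2 (lagrangian f c) := by
  have h1 : ContDiff ℝ 2 (WithLp.fstL 2 ℝ (Vec d) (Vec m)) := ContinuousLinearMap.contDiff _
  have h2 : ContDiff ℝ 2 (WithLp.sndL 2 ℝ (Vec d) (Vec m)) := ContinuousLinearMap.contDiff _
  exact (hf.comp h1).add (h2.inner ℝ (hc.comp h1))

section Composition

variable {H E W : Type*} [NormedAddCommGroup H] [NormedSpace ℝ H] [NormedAddCommGroup E]
  [NormedSpace ℝ E] [NormedAddCommGroup W] [InnerProductSpace ℝ W]

theorem fderiv_add_inner_comp {f : E → ℝ} {c : E → W} (hf : Differentiable ℝ f)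
    (hc : Differentiable ℝ c) (π₁ : H →L[ℝ] E) (π₂ : H →L[ℝ] W) (p v : H) :
    fderiv ℝ (fun q => f (π₁ q) + ⟪π₂ q, c (π₁ q)⟫_ℝ) p v =
      fderiv ℝ f (π₁ p) (π₁ v) +
        (⟪π₂ p, fderiv ℝ c (π₁ p) (π₁ v)⟫_ℝ + ⟪π₂ v, c (π₁ p)⟫_ℝ) := by
  have h3 := (hf (π₁ p)).hasFDerivAt.comp p π₁.hasFDerivAt
  have h4 := (hc (π₁ p)).hasFDerivAt.comp p π₁.hasFDerivAt
  exact congrArg (fun T => T v) (h3.add (π₂.hasFDerivAt.inner ℝ h4)).fderiv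

theorem apply_fderiv_eq_of_comp_eq {c : E → W} (hc : Differentiable ℝ c) (π₁ : H →L[ℝ] E)
    (π₂ : H →L[ℝ] W) {g : H → H} {p : H} (hg : DifferentiableAt ℝ g p)
    (h : ∀ q, π₂ (g q) = c (π₁ q)) (v : H) :
    π₂ (fderiv ℝ g p v) = fderiv ℝ c (π₁ p) (π₁ v) := by
  have h1 := (hc (π₁ p)).hasFDerivAt.comp p π₁.hasFDerivAt
  have h2 := π₂.hasFDerivAt.comp p hg.hasFDerivAt
  rw [show π₂ ∘ g = c ∘ π₁ from funext h] at h2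
  exact congrArg (fun T => T v) (h2.unique h1)

end Composition

theorem gradient_lagrangian (hf : Differentiable ℝ f) (hc : Differentiable ℝ c) (p : PD d m) :
    ∇ (lagrangian f c) p =
      WithLp.toLp 2 (∇ f p.fst + (jac c p.fst).adjoint p.snd, c p.fst) := by
  refine ext_inner_right ℝ fun v => ?_
  have h6 : fderiv ℝ (lagrangian f c) p v =
      fderiv ℝ f p.fst v.fst + (⟪p.snd, jac c p.fst v.fst⟫_ℝ + ⟪v.snd, c p.fst⟫_ℝ) :=
    fderiv_add_inner_comp hf hc (WithLp.fstL 2 ℝ (Vec d) (Vec m)) (WithLp.sndL 2 ℝ (Vec d) (Vec m))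
      p v
  rw [inner_gradient, h6, inner_pd]
  change _ = ⟪∇ f p.fst + (jac c p.fst).adjoint p.snd, v.fst⟫_ℝ + ⟪c p.fst, v.snd⟫_ℝ
  rw [inner_add_left, inner_gradient, ContinuousLinearMap.adjoint_inner_left,
    real_inner_comm v.snd, add_assoc]

/-- The second block of `∇L` is `c(x)`, so the lower block row is `(G, 0)`; symmetry of the Hessian
then forces `Gᵀ` in the upper right corner. Nothing about the remaining block is needed except that
it exists. -/
theorem hess_lagrangian (hf : ContDiff ℝ 2 f) (hc : ContDiff ℝ 2 c) (p : PD d m) :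
    ∃ H, hess (lagrangian f c) p = kkt H (jac c p.fst) := by
  have hL := contDiff_lagrangian hf hc
  have hsymm := (twiceDifferentiable_of_contDiff hL).isSelfAdjoint_hess p
  have hsnd : ∀ h, (hess (lagrangian f c) p h).snd = jac c p.fst h.fst := by
    intro h
    refine apply_fderiv_eq_of_comp_eq (hc.differentiable two_ne_zero)
      (WithLp.fstL 2 ℝ (Vec d) (Vec m)) (WithLp.sndL 2 ℝ (Vec d) (Vec m))
      ((contDiff_gradient hL).differentiable one_ne_zero p) (fun q => ?_) h
    rw [gradient_lagrangian (hf.differentiable two_ne_zero) (hc.differentiable two_ne_zero)]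
    rfl
  rw [ContinuousLinearMap.isSelfAdjoint_iff_isSymmetric] at hsymm
  have hfst : ∀ l : Vec m, (hess (lagrangian f c) p (WithLp.toLp 2 (0, l))).fst
      = (jac c p.fst).adjoint l := by
    intro l
    refine ext_inner_right ℝ fun v => ?_
    have h1 : ⟪hess (lagrangian f c) p (WithLp.toLp 2 (0, l)), WithLp.toLp 2 (v, 0)⟫_ℝ
      = ⟪WithLp.toLp 2 (0, l), hess (lagrangian f c) p (WithLp.toLp 2 (v, 0))⟫_ℝ :=
      hsymm (WithLp.toLp 2 (0, l)) (WithLp.toLp 2 (v, 0))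
    rw [inner_pd, inner_pd, hsnd] at h1
    simp only [WithLp.toLp_fst, WithLp.toLp_snd, inner_zero_right, inner_zero_left, add_zero,
      zero_add] at h1
    rw [h1, ContinuousLinearMap.adjoint_inner_left, hsnd]
    rfl
  refine ⟨WithLp.fstL 2 ℝ (Vec d) (Vec m) ∘L hess (lagrangian f c) p ∘L
    (WithLp.prodContinuousLinearEquiv 2 ℝ (Vec d) (Vec m)).symm.toContinuousLinearMap ∘L
      ContinuousLinearMap.inl ℝ (Vec d) (Vec m), ?_⟩
  ext1 h
  rw [kkt_apply]
  have e : h = WithLp.toLp 2 (h.fst, 0) + WithLp.toLp 2 (0, h.snd) := by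
    have : (h.fst, h.snd) = ((h.fst, 0) : Vec d × Vec m) + (0, h.snd) := by simp
    rw [← WithLp.toLp_add, ← this]
    rfl
  have h1 : (hess (lagrangian f c) p h).fst
      = (hess (lagrangian f c) p (WithLp.toLp 2 (h.fst, 0))).fst + (jac c p.fst).adjoint h.snd := by
    rw [← hfst h.snd]
    conv_lhs => rw [e, map_add]
    rfl
  have h2 := hsnd h
  exact congrArg (WithLp.toLp 2) (Prod.ext h1 h2)

/-- The merit function `L + ρ/2 ‖c‖² + ν/2 ‖∇L‖²`. -/
noncomputable def merit (f : Vec d → ℝ) (c : Vec d → Vec m) (ρ ν : ℝ) (p : PD d m) : ℝ :=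
  lagrangian f c p + ρ / 2 * ‖(∇ (lagrangian f c) p).snd‖ ^ 2 + ν / 2 * ‖∇ (lagrangian f c) p‖ ^ 2

/-- Here `x` and `y` are the old and the new value of a map and `T` its linearized change; the rest
is an expansion of the square. -/
theorem half_norm_sq_sub_le {E : Type*} [NormedAddCommGroup E] [InnerProductSpace ℝ E] {x y T : E}
    {M L Λ r : ℝ} (hx : ‖x‖ ≤ M) (h1 : ‖y - x‖ ≤ L * r)
    (h2 : ‖y - x - T‖ ≤ Λ * r ^ 2) :
    ‖y‖ ^ 2 / 2 - ‖x‖ ^ 2 / 2 ≤ ⟪x, T⟫_ℝ + (M * Λ + L ^ 2) * r ^ 2 := by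
  have e1 : ‖y‖ ^ 2 = ‖x‖ ^ 2 + 2 * ⟪x, y - x⟫_ℝ + ‖y - x‖ ^ 2 := by
    rw [← norm_add_sq_real, add_sub_cancel]
  have e2 : ⟪x, y - x⟫_ℝ = ⟪x, T⟫_ℝ + ⟪x, y - x - T⟫_ℝ := by
    rw [← inner_add_right, add_sub_cancel]
  have h3 := real_inner_le_norm x (y - x - T)
  have h4 : ‖x‖ * ‖y - x - T‖ ≤ M * (Λ * r ^ 2) := by
    gcongr
    exact (norm_nonneg x).trans hx
  have h5 : ‖y - x‖ ^ 2 ≤ (L * r) ^ 2 := by gcongr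
  nlinarith [sq_nonneg ‖y - x‖]

/-- The linearization of `∇L` controls both quadratic terms, since `c` is a component of `∇L`. So a
Lipschitz Hessian of `L` suffices, although `∇φ` contains second derivatives. -/
theorem merit_le (hf : ContDiff ℝ 2 f) (hc : ContDiff ℝ 2 c) {D : Set (PD d m)}
    (hD : Convex ℝ D) {L Λ ρ ν : ℝ} (hL0 : 0 ≤ L) (hΛ : 0 ≤ Λ) (hρ : 0 ≤ ρ) (hν : 0 ≤ ν)
    (hL : ∀ p ∈ D, ‖hess (lagrangian f c) p‖ ≤ L)
    (hlip : ∀ p ∈ D, ∀ q ∈ D,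
      ‖hess (lagrangian f c) p - hess (lagrangian f c) q‖ ≤ Λ * ‖p - q‖)
    (hg : ∀ p ∈ D, ‖∇ (lagrangian f c) p‖ ≤ L) {p q : PD d m} (hp : p ∈ D) (hq : q ∈ D) :
    merit f c ρ ν q ≤ merit f c ρ ν p
      + ⟪meritGrad ρ ν (hess (lagrangian f c) p) (∇ (lagrangian f c) p), q - p⟫_ℝ
      + (L + (ρ + ν) * (L * Λ + L ^ 2)) * ‖q - p‖ ^ 2 := by
  have hφ := contDiff_lagrangian hf hc
  have h1 := sub_sub_inner_gradient_le hφ hD hL0 hL hp hq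
  have h2 := norm_gradient_sub_le hφ hD hL hp hq
  have h3 := norm_gradient_sub_sub_le hφ hD hΛ hlip hp hq
  have h4 := half_norm_sq_sub_le (hg p hp) h2 h3
  have h5 : ‖(∇ (lagrangian f c) q).snd‖ ^ 2 / 2 - ‖(∇ (lagrangian f c) p).snd‖ ^ 2 / 2 ≤
      ⟪(∇ (lagrangian f c) p).snd, (hess (lagrangian f c) p (q - p)).snd⟫_ℝ
        + (L * Λ + L ^ 2) * ‖q - p‖ ^ 2 := half_norm_sq_sub_le ((norm_snd_le_pd _).trans (hg p hp))
    ((norm_snd_le_pd (∇ (lagrangian f c) q - ∇ (lagrangian f c) p)).trans h2)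
    ((norm_snd_le_pd (∇ (lagrangian f c) q - ∇ (lagrangian f c) p
      - hess (lagrangian f c) p (q - p))).trans h3)
  rw [inner_meritGrad, merit, merit]
  have h6 := mul_le_mul_of_nonneg_left h4 hν
  have h7 := mul_le_mul_of_nonneg_left h5 hρ
  linarith

end Lagrangian

/-! ### Joint measurability of the stochastic derivatives. -/

section Measurability

variable {d m : ℕ} {S : Type*} [MeasurableSpace S]

/-- Directional derivatives are limits of difference quotients with steps `1 / n`, and these are
jointly measurable. No continuity in the sample is needed. -/
theorem measurable_fderiv_apply_of_uncurry {E : Type*} [NormedAddCommGroup E] [NormedSpace ℝ E]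
    [MeasurableSpace E] [BorelSpace E] [SecondCountableTopology E] {Φ : Vec d → S → E}
    (hΦ : Measurable (Function.uncurry Φ)) (hd : ∀ s, Differentiable ℝ fun x => Φ x s) (v : Vec d) :
    Measurable fun p : Vec d × S => fderiv ℝ (fun x => Φ x p.2) p.1 v := by
  refine measurable_of_tendsto_metrizable (f := fun (n : ℕ) (p : Vec d × S) =>
    (n : ℝ) • (Φ (p.1 + (n : ℝ)⁻¹ • v) p.2 - Φ p.1 p.2)) (fun n => ?_) (tendsto_pi_nhds.2 fun p => ?_)
  · have h1 : Measurable fun p : Vec d × S => (p.1 + (n : ℝ)⁻¹ • v, p.2) :=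
      (measurable_fst.add_const _).prodMk measurable_snd
    exact ((hΦ.comp h1).sub hΦ).const_smul _
  · refine (hd p.2 p.1).hasFDerivAt.lim v ?_
    exact tendsto_norm_atTop_atTop.comp tendsto_natCast_atTop_atTop

theorem measurable_clm_of_apply {Ω E : Type*} [MeasurableSpace Ω] [NormedAddCommGroup E]
    [NormedSpace ℝ E] [FiniteDimensional ℝ E] [MeasurableSpace E] [BorelSpace E]
    {T : Ω → Vec d →L[ℝ] E} (h : ∀ v, Measurable fun ω => T ω v) : Measurable T := by
  have e : T = fun ω => ∑ i, ContinuousLinearMap.smulRightL ℝ (Vec d) E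
      (EuclideanSpace.proj i) (T ω (EuclideanSpace.single i 1)) := by
    ext1 ω
    ext1 v
    conv_lhs => rw [← (EuclideanSpace.basisFun (Fin d) ℝ).sum_repr v, map_sum]
    rw [sum_apply]
    simp
  rw [e]
  have : SecondCountableTopology (Vec d →L[ℝ] E) := by
    have : ProperSpace E := FiniteDimensional.proper ℝ E
    infer_instance
  exact Finset.measurable_sum _ fun i _ =>
    (ContinuousLinearMap.continuous _).measurable.comp (h _)

variable {F : Vec d → S → ℝ} {c : Vec d → Vec m}

theorem measurable_sGrad (hF : Measurable (Function.uncurry F))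
    (hd : ∀ s, TwiceDifferentiable fun x => F x s) : Measurable (Function.uncurry (sGrad F)) := by
  have h1 : Measurable fun p : Vec d × S => fderiv ℝ (fun x => F x p.2) p.1 :=
    measurable_clm_of_apply (measurable_fderiv_apply_of_uncurry hF fun s => (hd s).1)
  exact (InnerProductSpace.toDual ℝ (Vec d)).symm.continuous.measurable.comp h1

theorem measurable_sHess (hF : Measurable (Function.uncurry F))
    (hd : ∀ s, TwiceDifferentiable fun x => F x s) : Measurable (Function.uncurry (sHess F)) :=
  measurable_clm_of_apply
    (measurable_fderiv_apply_of_uncurry (measurable_sGrad hF hd) fun s => (hd s).2)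

theorem continuous_jac (hc : ContDiff ℝ 2 c) : Continuous (jac c) :=
  hc.continuous_fderiv two_ne_zero

theorem measurable_lagGradEst (hF : Measurable (Function.uncurry F))
    (hd : ∀ s, TwiceDifferentiable fun x => F x s) (hc : ContDiff ℝ 2 c) :
    Measurable (Function.uncurry (lagGradEst F c)) := by
  have hfst : Continuous fun p : PD d m => p.fst := (WithLp.fstL 2 ℝ (Vec d) (Vec m)).continuous
  have hsnd : Continuous fun p : PD d m => p.snd := (WithLp.sndL 2 ℝ (Vec d) (Vec m)).continuous
  have h1 : Measurable fun p : PD d m × S => sGrad F p.1.fst p.2 :=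
    (measurable_sGrad hF hd).comp ((hfst.measurable.comp measurable_fst).prodMk measurable_snd)
  have h2 : Continuous fun p : PD d m => (jac c p.fst).adjoint p.snd :=
    ((ContinuousLinearMap.adjoint (𝕜 := ℝ) (E := Vec d) (F := Vec m)).continuous.comp
      ((continuous_jac hc).comp hfst)).clm_apply hsnd
  have h3 : Continuous fun p : PD d m => c p.fst := hc.continuous.comp hfst
  exact (WithLp.prodContinuousLinearEquiv 2 ℝ (Vec d) (Vec m)).symm.continuous.measurable.comp
    ((h1.add (h2.measurable.comp measurable_fst)).prodMk (h3.measurable.comp measurable_fst))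

theorem contDiff_component (hc : ContDiff ℝ 2 c) (i : Fin m) : ContDiff ℝ 2 fun y => c y i :=
  (EuclideanSpace.proj i : Vec m →L[ℝ] ℝ).contDiff.comp hc

theorem measurable_lagHessEst (hF : Measurable (Function.uncurry F))
    (hd : ∀ s, TwiceDifferentiable fun x => F x s) (hc : ContDiff ℝ 2 c) :
    Measurable (Function.uncurry (lagHessEst F c)) := by
  have hfst : Continuous fun p : PD d m => p.fst := (WithLp.fstL 2 ℝ (Vec d) (Vec m)).continuous
  have hsnd : Continuous fun p : PD d m => p.snd := (WithLp.sndL 2 ℝ (Vec d) (Vec m)).continuous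
  have h1 : Measurable fun p : PD d m × S => sHess F p.1.fst p.2 :=
    (measurable_sHess hF hd).comp ((hfst.measurable.comp measurable_fst).prodMk measurable_snd)
  have h2 : Continuous fun p : PD d m => ∑ i, p.snd i • hess (fun y => c y i) p.fst :=
    continuous_finsetSum _ fun i _ =>
      ((EuclideanSpace.proj i : Vec m →L[ℝ] ℝ).continuous.comp hsnd).smul
        ((continuous_hess (contDiff_component hc i)).comp hfst)
  exact h1.add (h2.measurable.comp measurable_fst)

end Measurability

/-! ### Symmetry of the Newton matrix. -/

section Symmetry

variable {d m : ℕ} {S : Type*} {F : Vec d → S → ℝ} {c : Vec d → Vec m}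

theorem isSelfAdjoint_lagHessEst (hd : ∀ s, TwiceDifferentiable fun x => F x s)
    (hc : ContDiff ℝ 2 c) (p : PD d m) (s : S) : IsSelfAdjoint (lagHessEst F c p s) :=
  ((hd s).isSelfAdjoint_hess _).add (isSelfAdjoint_sum _ fun i _ =>
    (IsSelfAdjoint.all _).smul
      ((twiceDifferentiable_of_contDiff (contDiff_component hc i)).isSelfAdjoint_hess _))

theorem isSelfAdjoint_newtonMat (hd : ∀ s, TwiceDifferentiable fun x => F x s)
    (hc : ContDiff ℝ 2 c) (p : ℕ → PD d m) (s : ℕ → S) {R : ℕ → Vec d →L[ℝ] Vec d}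
    (hR : ∀ t, IsSelfAdjoint (R t)) (t : ℕ) : IsSelfAdjoint (newtonMat F c p s R t) := by
  refine isSelfAdjoint_kkt ?_ _
  unfold modHess
  split_ifs
  · exact IsSelfAdjoint.one _
  · refine IsSelfAdjoint.add (R := Vec d →L[ℝ] Vec d) ?_ (hR t)
    exact (IsSelfAdjoint.all _).smul (isSelfAdjoint_sum _ fun i _ =>
      isSelfAdjoint_lagHessEst hd hc _ _)

end Symmetry

/-! ### Independence and the freezing of known variables. -/

section Independence

variable {Ω : Type*} {m₀ : MeasurableSpace Ω} {μ : Measure Ω} [IsProbabilityMeasure μ]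

/-- On sets `a ∩ b` with `a` in `m₁` and `b` in `m₂` the product formula follows by splitting off
`a` first and then `b`; these sets form a generating π-system. -/
theorem indep_sup_left {m₁ m₂ m₃ : MeasurableSpace Ω} (h₁ : m₁ ≤ m₀) (h₂ : m₂ ≤ m₀) (h₃ : m₃ ≤ m₀)
    (h : Indep m₁ (m₂ ⊔ m₃) μ) (h' : Indep m₂ m₃ μ) : Indep (m₁ ⊔ m₂) m₃ μ := by
  let S : Set (Set Ω) := {s | ∃ a b, MeasurableSet[m₁] a ∧ MeasurableSet[m₂] b ∧ s = a ∩ b}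
  have hS : IsPiSystem S := by
    rintro _ ⟨a, b, ha, hb, rfl⟩ _ ⟨a', b', ha', hb', rfl⟩ -
    exact ⟨a ∩ a', b ∩ b', ha.inter ha', hb.inter hb', by ext; simp; tauto⟩
  have hgen : m₁ ⊔ m₂ = MeasurableSpace.generateFrom S := by
    refine le_antisymm (sup_le (fun a ha => ?_) (fun b hb => ?_))
      (MeasurableSpace.generateFrom_le ?_)
    · exact MeasurableSpace.measurableSet_generateFrom
        ⟨a, Set.univ, ha, MeasurableSet.univ, by simp⟩
    · exact MeasurableSpace.measurableSet_generateFrom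
        ⟨Set.univ, b, MeasurableSet.univ, hb, by simp⟩
    · rintro _ ⟨a, b, ha, hb, rfl⟩
      exact (le_sup_left (a := m₁) (b := m₂) a ha).inter (le_sup_right (a := m₁) (b := m₂) b hb)
  refine IndepSets.indep (sup_le h₁ h₂) h₃ hS (@MeasurableSpace.isPiSystem_measurableSet _ m₃)
    hgen (@MeasurableSpace.generateFrom_measurableSet _ m₃).symm ?_
  rw [IndepSets_iff]
  rintro _ c ⟨a, b, ha, hb, rfl⟩ hc
  have hb' : MeasurableSet[m₂ ⊔ m₃] b := le_sup_left (a := m₂) (b := m₃) b hb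
  have hc' : MeasurableSet[m₂ ⊔ m₃] c := le_sup_right (a := m₂) (b := m₃) c hc
  rw [Indep_iff] at h h'
  rw [Set.inter_assoc, h a (b ∩ c) ha (hb'.inter hc'), h a b ha hb', h' b c hb hc, mul_assoc]

variable {𝒳 𝒴 E : Type*} [MeasurableSpace 𝒳] [MeasurableSpace 𝒴] [NormedAddCommGroup E]
  [NormedSpace ℝ E]

theorem integral_comp_of_indep {X : Ω → 𝒳} {Y : Ω → 𝒴} (hX : Measurable X) (hY : Measurable Y)
    (h : IndepFun X Y μ) {g : 𝒳 × 𝒴 → E} (hg : StronglyMeasurable g)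
    (hint : Integrable (fun ω => g (X ω, Y ω)) μ) :
    Integrable (fun ω => ∫ y, g (X ω, y) ∂(μ.map Y)) μ ∧
      ∫ ω, g (X ω, Y ω) ∂μ = ∫ ω, ∫ y, g (X ω, y) ∂(μ.map Y) ∂μ := by
  have hlaw := (indepFun_iff_map_prod_eq_prod_map_map hX.aemeasurable hY.aemeasurable).1 h
  have : IsProbabilityMeasure (μ.map X) := Measure.isProbabilityMeasure_map hX.aemeasurable
  have : IsProbabilityMeasure (μ.map Y) := Measure.isProbabilityMeasure_map hY.aemeasurable
  have hXY := hX.prodMk hY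
  have hint' : Integrable g ((μ.map X).prod (μ.map Y)) := by
    rw [← hlaw]
    exact (integrable_map_measure hg.aestronglyMeasurable hXY.aemeasurable).2 hint
  have hsm : StronglyMeasurable fun x => ∫ y, g (x, y) ∂(μ.map Y) := hg.integral_prod_right'
  refine ⟨(integrable_map_measure hsm.aestronglyMeasurable hX.aemeasurable).1
    hint'.integral_prod_left, ?_⟩
  rw [← integral_map (φ := fun ω => (X ω, Y ω)) hXY.aemeasurable hg.aestronglyMeasurable, hlaw,
    integral_prod _ hint', integral_map hX.aemeasurable hsm.aestronglyMeasurable]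

end Independence

section Freezing

variable {Ω 𝒳 𝒴 E : Type*} {𝒢 m₀ : MeasurableSpace Ω} {μ : Measure Ω} [IsProbabilityMeasure μ]
  [MeasurableSpace 𝒳] [MeasurableSpace 𝒴] [NormedAddCommGroup E] [NormedSpace ℝ E]
  [CompleteSpace E]

/-- Conditional expectation of a function of a known and an independent variable. -/
theorem condExp_comp_of_indep (h𝒢 : 𝒢 ≤ m₀) {X : Ω → 𝒳} {Y : Ω → 𝒴}
    (hX : Measurable[𝒢] X) (hY : Measurable Y)
    (h : Indep 𝒢 (MeasurableSpace.comap Y inferInstance) μ) {g : 𝒳 × 𝒴 → E}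
    (hg : StronglyMeasurable g) (hint : Integrable (fun ω => g (X ω, Y ω)) μ) :
    μ[fun ω => g (X ω, Y ω) | 𝒢] =ᵐ[μ] fun ω => ∫ y, g (X ω, y) ∂(μ.map Y) := by
  have : IsProbabilityMeasure (μ.map Y) := Measure.isProbabilityMeasure_map hY.aemeasurable
  have hX0 : Measurable X := hX.mono h𝒢 le_rfl
  have hi := (integral_comp_of_indep hX0 hY (indep_of_indep_of_le_left h hX.comap_le) hg hint).1
  refine (ae_eq_condExp_of_forall_setIntegral_eq h𝒢 hint (fun s _ _ => hi.integrableOn)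
    (fun s hs _ => ?_) ?_).symm
  · have hs0 := h𝒢 s hs
    -- Adjoining the indicator of `s` to the known variable turns the integral over `s` into one
    -- over `Ω`, to which `integral_comp_of_indep` applies again.
    let X' : Ω → ℝ × 𝒳 := fun ω => (s.indicator 1 ω, X ω)
    have h1 : Measurable[𝒢] (s.indicator (1 : Ω → ℝ)) :=
      Measurable.indicator (m := 𝒢) (measurable_const : Measurable[𝒢] fun _ : Ω => (1 : ℝ)) hs
    have hX' : Measurable[𝒢] X' := h1.prodMk hX
    have hg' : StronglyMeasurable fun p : (ℝ × 𝒳) × 𝒴 => p.1.1 • g (p.1.2, p.2) :=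
      measurable_fst.fst.stronglyMeasurable.smul
        (hg.comp_measurable (measurable_fst.snd.prodMk measurable_snd))
    have e : ∀ G : Ω → E, (fun ω => (s.indicator (1 : Ω → ℝ) ω) • G ω) = s.indicator G := by
      intro G
      ext ω
      by_cases hω : ω ∈ s <;> simp [hω]
    have hint' : Integrable (fun ω => (X' ω).1 • g ((X' ω).2, Y ω)) μ := by
      rw [show (fun ω => (X' ω).1 • g ((X' ω).2, Y ω)) = _ from e fun ω => g (X ω, Y ω)]
      exact hint.indicator hs0
    have := (integral_comp_of_indep (hX'.mono h𝒢 le_rfl) hY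
      (indep_of_indep_of_le_left h hX'.comap_le) hg' hint').2
    simp only [integral_smul] at this
    rw [show (fun ω => (X' ω).1 • g ((X' ω).2, Y ω)) = _ from e fun ω => g (X ω, Y ω),
      show (fun ω => (X' ω).1 • ∫ y, g ((X' ω).2, y) ∂(μ.map Y)) = _ from
        e fun ω => ∫ y, g (X ω, y) ∂(μ.map Y), integral_indicator hs0, integral_indicator hs0] at this
    exact this.symm
  · exact (hg.integral_prod_right'.comp_measurable hX).aestronglyMeasurable

end Freezing

/-! ### Almost sure convergence of random series. -/

section Series

variable {Ω : Type*} {m₀ : MeasurableSpace Ω} {μ : Measure Ω}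

theorem ae_summable_of_summable_integral {X : ℕ → Ω → ℝ} (h0 : ∀ t ω, 0 ≤ X t ω)
    (hX : ∀ t, Integrable (X t) μ) (hs : Summable fun t => ∫ ω, X t ω ∂μ) :
    ∀ᵐ ω ∂μ, Summable fun t => X t ω := by
  have h1 : ∫⁻ ω, ∑' t, ENNReal.ofReal (X t ω) ∂μ ≠ ⊤ := by
    rw [lintegral_tsum fun t => (hX t).aestronglyMeasurable.aemeasurable.ennreal_ofReal]
    have e : ∀ t, ∫⁻ ω, ENNReal.ofReal (X t ω) ∂μ = ENNReal.ofReal (∫ ω, X t ω ∂μ) := fun t =>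
      (ofReal_integral_eq_lintegral_ofReal (hX t) (ae_of_all _ (h0 t))).symm
    simp_rw [e]
    exact hs.tsum_ofReal_ne_top
  have h2 := ae_lt_top' (AEMeasurable.tsum
    fun t => (hX t).aestronglyMeasurable.aemeasurable.ennreal_ofReal) h1
  filter_upwards [h2] with ω hω
  have h3 := ENNReal.summable_toReal hω.ne
  simpa [ENNReal.toReal_ofReal, h0] using h3

variable [IsProbabilityMeasure μ]

/-- The increments are orthogonal, so the partial sums form a martingale bounded in `L²`, hence in
`L¹`, and it converges almost surely. -/
theorem ae_exists_tendsto_sum_of_martingale_diff {ℱ : Filtration ℕ m₀} {b : ℕ → Ω → ℝ}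
    (hb : ∀ t, StronglyMeasurable[ℱ (t + 1)] (b t)) (hL2 : ∀ t, MemLp (b t) 2 μ)
    (h0 : ∀ t, μ[b t | ℱ t] =ᵐ[μ] 0) (hs : Summable fun t => ∫ ω, b t ω ^ 2 ∂μ) :
    ∀ᵐ ω ∂μ, ∃ l, Tendsto (fun n => ∑ t ∈ Finset.range n, b t ω) atTop (𝓝 l) := by
  set N : ℕ → Ω → ℝ := fun n ω => ∑ t ∈ Finset.range n, b t ω with hN
  have hNL2 : ∀ n, MemLp (N n) 2 μ := fun n => memLp_finsetSum _ fun t _ => hL2 t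
  have hNint : ∀ n, Integrable (N n) μ := fun n => (hNL2 n).integrable one_le_two
  have hadapt : ∀ n, StronglyMeasurable[ℱ n] (N n) := fun n =>
    Finset.stronglyMeasurable_fun_sum _ fun t ht =>
      (hb t).mono (ℱ.mono (Nat.succ_le_of_lt (Finset.mem_range.1 ht)))
  have hNsucc : ∀ n, N (n + 1) = N n + b n := fun n => by
    ext ω; simp [hN, Finset.sum_range_succ]
  have hmart : Martingale N ℱ μ := by
    refine martingale_nat hadapt hNint fun n => ?_
    rw [hNsucc]
    have h1 := condExp_add (hNint n) ((hL2 n).integrable one_le_two) (ℱ n)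
    rw [condExp_of_stronglyMeasurable (ℱ.le n) (hadapt n) (hNint n)] at h1
    filter_upwards [h1, h0 n] with ω h2 h3
    rw [h2, Pi.add_apply, h3, Pi.zero_apply, add_zero]
  -- Pythagoras: the cross term vanishes because `N n` is known when `b n` is averaged.
  have hsq : ∀ n, ∫ ω, N n ω ^ 2 ∂μ = ∑ t ∈ Finset.range n, ∫ ω, b t ω ^ 2 ∂μ := by
    intro n
    induction n with
    | zero => simp [hN]
    | succ n ih =>
      have hprod : Integrable (N n * b n) μ := (hNL2 n).integrable_mul (hL2 n)
      have hz : ∫ ω, (N n * b n) ω ∂μ = 0 := by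
        rw [← integral_condExp (ℱ.le n)]
        have h1 := condExp_mul_of_stronglyMeasurable_left (μ := μ) (hadapt n) hprod
          ((hL2 n).integrable one_le_two)
        refine integral_eq_zero_of_ae ?_
        filter_upwards [h1, h0 n] with ω h2 h3
        rw [h2, Pi.mul_apply, h3, Pi.zero_apply, mul_zero]
      rw [Finset.sum_range_succ, ← ih]
      have e : ∀ ω, N (n + 1) ω ^ 2 = N n ω ^ 2 + 2 * (N n * b n) ω + b n ω ^ 2 := fun ω => by
        rw [hNsucc, Pi.add_apply, Pi.mul_apply]; ring
      simp_rw [e]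
      rw [integral_add (f := fun ω => N n ω ^ 2 + 2 * (N n * b n) ω)
          ((hNL2 n).integrable_sq.add (hprod.const_mul 2)) (hL2 n).integrable_sq,
        integral_add (hNL2 n).integrable_sq (hprod.const_mul 2), integral_const_mul, hz]
      ring
  have hbdd : ∀ n, eLpNorm (N n) 1 μ ≤
      ((1 + ∑' t, ∫ ω, b t ω ^ 2 ∂μ).toNNReal : ENNReal) := by
    intro n
    rw [eLpNorm_one_eq_lintegral_enorm, ← ofReal_integral_norm_eq_lintegral_enorm (hNint n)]
    refine ENNReal.ofReal_le_ofReal ?_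
    calc ∫ ω, ‖N n ω‖ ∂μ ≤ ∫ ω, (1 + N n ω ^ 2) ∂μ := by
          refine integral_mono (hNint n).norm
            ((integrable_const 1).add (hNL2 n).integrable_sq) fun ω => ?_
          have := sq_abs (N n ω)
          change |N n ω| ≤ 1 + N n ω ^ 2
          nlinarith [sq_nonneg (|N n ω| - 1)]
      _ = 1 + ∑ t ∈ Finset.range n, ∫ ω, b t ω ^ 2 ∂μ := by
          rw [integral_add (integrable_const 1) (hNL2 n).integrable_sq, hsq]; simp
      _ ≤ _ := by
          gcongr
          exact hs.sum_le_tsum _ fun t _ => integral_nonneg fun ω => sq_nonneg _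
  exact hmart.submartingale.exists_ae_tendsto_of_bdd hbdd

theorem ae_exists_tendsto_sum_of_martingale_diff_vec {H : Type*} [NormedAddCommGroup H]
    [InnerProductSpace ℝ H] [FiniteDimensional ℝ H] {ℱ : Filtration ℕ m₀} {b : ℕ → Ω → H}
    (hb : ∀ t, StronglyMeasurable[ℱ (t + 1)] (b t)) (hL2 : ∀ t, MemLp (b t) 2 μ)
    (h0 : ∀ t, μ[b t | ℱ t] =ᵐ[μ] 0) (hs : Summable fun t => ∫ ω, ‖b t ω‖ ^ 2 ∂μ) :
    ∀ᵐ ω ∂μ, ∃ l, Tendsto (fun n => ∑ t ∈ Finset.range n, b t ω) atTop (𝓝 l) := by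
  have : CompleteSpace H := FiniteDimensional.complete ℝ H
  let B := stdOrthonormalBasis ℝ H
  have hcoord : ∀ k, ∀ᵐ ω ∂μ, ∃ l,
      Tendsto (fun n => ∑ t ∈ Finset.range n, ⟪B k, b t ω⟫_ℝ) atTop (𝓝 l) := by
    intro k
    have hle : ∀ t ω, |⟪B k, b t ω⟫_ℝ| ≤ ‖b t ω‖ := fun t ω => by
      have := abs_real_inner_le_norm (B k) (b t ω)
      rwa [B.orthonormal.1 k, one_mul] at this
    have hmem : ∀ t, MemLp (fun ω => ⟪B k, b t ω⟫_ℝ) 2 μ := fun t => (hL2 t).const_inner (B k)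
    refine ae_exists_tendsto_sum_of_martingale_diff (ℱ := ℱ)
      (b := fun t ω => ⟪B k, b t ω⟫_ℝ) (fun t => ?_) hmem (fun t => ?_) ?_
    · exact (innerSL ℝ (B k)).continuous.comp_stronglyMeasurable (hb t)
    · have h1 := ContinuousLinearMap.comp_condExp_comm (m := ℱ t)
        ((hL2 t).integrable one_le_two) (innerSL ℝ (B k))
      filter_upwards [h1, h0 t] with ω h2 h3
      have h4 : ⟪B k, (μ[b t | ℱ t]) ω⟫_ℝ = (μ[fun ω => ⟪B k, b t ω⟫_ℝ | ℱ t]) ω := h2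
      rw [← h4, h3]
      simp
    · refine Summable.of_nonneg_of_le (fun t => integral_nonneg fun ω => sq_nonneg _)
        (fun t => integral_mono (hmem t).integrable_sq (hL2 t).norm.integrable_sq fun ω => ?_) hs
      exact sq_le_sq' (by linarith [abs_le.1 (hle t ω)]) (abs_le.1 (hle t ω)).2
  rw [← ae_all_iff] at hcoord
  filter_upwards [hcoord] with ω hω
  choose l hl using hω
  refine ⟨∑ k, l k • B k, ?_⟩
  have h1 := tendsto_finsetSum Finset.univ fun k _ => (hl k).smul_const (B k)
  refine h1.congr fun n => ?_
  rw [← B.sum_repr' (∑ t ∈ Finset.range n, b t ω)]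
  simp_rw [inner_sum]

end Series

/-! ### From summability to convergence. -/

section Crossing

variable {H : Type*} [NormedAddCommGroup H] [NormedSpace ℝ H]

/-- Otherwise `β t ≤ β t * a t ^ 2 / ε²` for all late `t`, and `∑ β t` would converge. -/
theorem frequently_lt_of_summable_mul_sq {a β : ℕ → ℝ} (hβ : ∀ t, 0 < β t)
    (hβ_sum : Tendsto (fun n => ∑ t ∈ Finset.range n, β t) atTop atTop)
    (haS : Summable fun t => β t * a t ^ 2) {ε : ℝ} (hε : 0 < ε) (T : ℕ) : ∃ s ≥ T, a s < ε := by
  by_contra! h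
  refine (not_summable_iff_tendsto_nat_atTop_of_nonneg fun t => (hβ t).le).2 hβ_sum ?_
  rw [← summable_nat_add_iff T]
  refine Summable.of_nonneg_of_le (fun t => (hβ _).le) (fun t => ?_)
    (((summable_nat_add_iff T).2 haS).mul_left (1 / ε ^ 2))
  have h1 : ε ^ 2 ≤ a (t + T) ^ 2 := by
    have := h (t + T) (Nat.le_add_left _ _)
    gcongr
  have h2 := hβ (t + T)
  rw [one_div, inv_mul_eq_div, le_div_iff₀ (by positivity)]
  gcongr

/-- A sequence that moves along directions of length `O(a t)` with steps `β t`, up to a convergent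
noise, where `a` is Lipschitz along the sequence and `∑ β t * a t ^ 2 < ∞`, has `a t → 0`. -/
theorem tendsto_zero_of_summable_mul_sq {w e r : ℕ → H} {a β : ℕ → ℝ} {C : ℝ} {l : H} (hC : 0 < C)
    (hβ : ∀ t, 0 < β t) (hβ_sum : Tendsto (fun n => ∑ t ∈ Finset.range n, β t) atTop atTop)
    (hβ0 : Tendsto β atTop (𝓝 0)) (ha0 : ∀ t, 0 ≤ a t) (haS : Summable fun t => β t * a t ^ 2)
    (hw : ∀ t, w (t + 1) = w t + β t • e t + r t) (he : ∀ t, ‖e t‖ ≤ C * a t)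
    (hr : Tendsto (fun n => ∑ t ∈ Finset.range n, r t) atTop (𝓝 l))
    (hlip : ∀ s t, |a s - a t| ≤ C * ‖w s - w t‖) : Tendsto a atTop (𝓝 0) := by
  obtain ⟨N, hN⟩ : ∃ N : ℕ → H, N = fun n => ∑ t ∈ Finset.range n, r t := ⟨_, rfl⟩
  obtain ⟨M, hM⟩ : ∃ M : ℕ → ℝ, M = fun n => ∑ t ∈ Finset.range n, β t * a t ^ 2 := ⟨_, rfl⟩
  have hmove : ∀ s t, s ≤ t → ‖w t - w s‖ ≤ C * ∑ i ∈ Finset.Ico s t, β i * a i + ‖N t - N s‖ := by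
    intro s t hst
    have h1 : w t - w s = ∑ i ∈ Finset.Ico s t, β i • e i + (N t - N s) := by
      rw [hN, ← Finset.sum_Ico_eq_sub _ hst, ← Finset.sum_add_distrib, ← Finset.sum_Ico_sub _ hst]
      refine Finset.sum_congr rfl fun i _ => ?_
      rw [hw i]; abel
    rw [h1]
    refine (norm_add_le _ _).trans (add_le_add_left ((norm_sum_le _ _).trans ?_) _)
    rw [Finset.mul_sum]
    refine Finset.sum_le_sum fun i _ => ?_
    rw [norm_smul, Real.norm_of_nonneg (hβ i).le]
    nlinarith [he i, hβ i]
  have hNc : CauchySeq N := by rw [hN]; exact hr.cauchySeq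
  have hMc : CauchySeq M := by rw [hM]; exact haS.hasSum.tendsto_sum_nat.cauchySeq
  rw [Metric.tendsto_atTop]
  intro ε' hε'
  obtain ⟨ε, hε, rfl⟩ : ∃ ε > 0, ε' = 2 * ε := ⟨ε' / 2, by positivity, by ring⟩
  -- The noise, the excursion and its first step will each contribute at most `ε / 4` to a rise of
  -- `a`, in total `3ε / 4 < ε`.
  obtain ⟨T₁, hT₁⟩ := Metric.cauchySeq_iff.1 hNc (ε / (4 * C)) (by positivity)
  obtain ⟨T₂, hT₂⟩ := Metric.cauchySeq_iff.1 hMc (ε ^ 2 / (4 * C ^ 2)) (by positivity)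
  obtain ⟨T₃, hT₃⟩ := Metric.tendsto_atTop.1 hβ0 (1 / (4 * C ^ 2)) (by positivity)
  obtain ⟨s₀, hs₀, hs₀'⟩ := frequently_lt_of_summable_mul_sq hβ hβ_sum haS hε (max T₁ (max T₂ T₃))
  refine ⟨s₀, fun t ht => ?_⟩
  rw [Real.dist_eq, sub_zero, abs_of_nonneg (ha0 t)]
  by_contra! hat
  -- The last time before `t` with `a s < ε`. From `s` to `t` the sequence rises by more than `ε`.
  obtain ⟨s, hs⟩ : ∃ s, s = Nat.findGreatest (fun i => a i < ε) t := ⟨_, rfl⟩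
  have hsa : a s < ε := by
    rw [hs]; exact Nat.findGreatest_spec (P := fun i => a i < ε) ht hs₀'
  have hs₀s : s₀ ≤ s := by rw [hs]; exact Nat.le_findGreatest ht hs₀'
  have hst : s < t := by
    refine lt_of_le_of_ne (by rw [hs]; exact Nat.findGreatest_le t) fun h => ?_
    rw [h] at hsa; linarith
  have hbig : ∀ i, s < i → i ≤ t → ε ≤ a i := fun i hi hit => by
    rw [hs] at hi
    exact not_lt.1 (Nat.findGreatest_is_greatest (P := fun i => a i < ε) hi hit)
  have hsT : max T₁ (max T₂ T₃) ≤ s := hs₀.trans hs₀s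
  simp only [max_le_iff] at hsT
  have h1 : ‖N t - N s‖ < ε / (4 * C) := by
    rw [← dist_eq_norm]; exact hT₁ _ (by omega) _ (by omega)
  have h2 : ∑ i ∈ Finset.Ico (s + 1) t, β i * a i ^ 2 < ε ^ 2 / (4 * C ^ 2) := by
    have := hT₂ t (by omega) (s + 1) (by omega)
    rw [Real.dist_eq, hM, ← Finset.sum_Ico_eq_sub _ (Nat.succ_le_of_lt hst)] at this
    exact (le_abs_self _).trans_lt this
  have h3 : β s < 1 / (4 * C ^ 2) := by
    have := hT₃ s (by omega)
    rwa [Real.dist_eq, sub_zero, abs_of_pos (hβ s)] at this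
  -- During the excursion `a i ≥ ε`, so one factor `a i / ε` can be inserted. The index `s` is left
  -- out since `a s < ε`; its term is small because `β s` is.
  have h4 : ∑ i ∈ Finset.Ico (s + 1) t, β i * a i ≤
      1 / ε * ∑ i ∈ Finset.Ico (s + 1) t, β i * a i ^ 2 := by
    rw [Finset.mul_sum]
    refine Finset.sum_le_sum fun i hi => ?_
    rw [Finset.mem_Ico] at hi
    have h5 := hbig i (by omega) (by omega)
    have h6 := mul_pos (hβ i) (hε.trans_le h5)
    rw [one_div, inv_mul_eq_div, le_div_iff₀ hε]
    calc β i * a i * ε ≤ β i * a i * a i := by gcongr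
      _ = _ := by ring
  have h5 : ∑ i ∈ Finset.Ico s t, β i * a i ≤ ε / (2 * C ^ 2) := by
    rw [Finset.sum_eq_sum_Ico_succ_bot hst]
    have h6 : β s * a s ≤ 1 / (4 * C ^ 2) * ε :=
      mul_le_mul h3.le hsa.le (ha0 s) (by positivity)
    have h7 : 1 / ε * ∑ i ∈ Finset.Ico (s + 1) t, β i * a i ^ 2 ≤
        1 / ε * (ε ^ 2 / (4 * C ^ 2)) := by gcongr
    have e1 : 1 / ε * (ε ^ 2 / (4 * C ^ 2)) = ε / (4 * C ^ 2) := by field_simp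
    have e2 : ε / (2 * C ^ 2) = 1 / (4 * C ^ 2) * ε + ε / (4 * C ^ 2) := by field_simp; norm_num
    linarith
  have h6 := hlip t s
  have h7 := hmove s t hst.le
  have h8 : C * ‖w t - w s‖ ≤ C * (C * (ε / (2 * C ^ 2)) + ε / (4 * C)) := by
    gcongr
    exact h7.trans (add_le_add (by gcongr) h1.le)
  have e3 : C * (C * (ε / (2 * C ^ 2)) + ε / (4 * C)) = 3 / 4 * ε := by field_simp; norm_num
  have h9 := (le_abs_self _).trans h6
  linarith

end Crossing

/-! ### An abstract stochastic descent method. -/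

section StochasticDescent

variable {Ω : Type*} {m₀ : MeasurableSpace Ω} {μ : Measure Ω} [IsProbabilityMeasure μ]
  {H : Type*} [NormedAddCommGroup H] [InnerProductSpace ℝ H] [FiniteDimensional ℝ H]

/-- Summability of the squared stationarity measure along a stochastic descent method. -/
theorem summable_of_stochastic_descent {ℱ : Filtration ℕ m₀} {z u : ℕ → Ω → H}
    {α Φ a : ℕ → Ω → ℝ} {β χ : ℕ → ℝ} {C δ : ℝ} (hC : 0 < C) (hδ : 0 < δ)
    (hβ : ∀ t, 0 < β t) (hχ : ∀ t, 0 ≤ χ t) (hη : Summable fun t => (β t + χ t) ^ 2)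
    (hχs : Summable χ) (hu : ∀ t, StronglyMeasurable[ℱ t] (u t))
    (hz : ∀ t, MemLp (z t) 2 μ) (hzC : ∀ t, ∫ ω, ‖z t ω‖ ^ 2 ∂μ ≤ C)
    (hα_mem : ∀ t ω, α t ω ∈ Set.Icc (β t) (β t + χ t))
    (hΦ : ∀ t, AEStronglyMeasurable (Φ t) μ) (hΦC : ∀ᵐ ω ∂μ, ∀ t, |Φ t ω| ≤ C)
    (huC : ∀ᵐ ω ∂μ, ∀ t, ‖u t ω‖ ≤ C) (ha : ∀ t, AEStronglyMeasurable (a t) μ)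
    (ha0 : ∀ t ω, 0 ≤ a t ω) (haC : ∀ᵐ ω ∂μ, ∀ t, a t ω ≤ C)
    (hstep : ∀ᵐ ω ∂μ, ∀ t,
      Φ (t + 1) ω ≤ Φ t ω + ⟪u t ω, α t ω • z t ω⟫_ℝ + C * ‖α t ω • z t ω‖ ^ 2)
    (hdesc : ∀ t, ∀ᵐ ω ∂μ, ⟪u t ω, (μ[z t | ℱ t]) ω⟫_ℝ ≤ -δ * a t ω ^ 2) :
    Summable fun t => ∫ ω, β t * a t ω ^ 2 ∂μ := by
  have : CompleteSpace H := FiniteDimensional.complete ℝ H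
  have hzi : ∀ t, Integrable (z t) μ := fun t => (hz t).integrable one_le_two
  have hzsq : ∀ t, Integrable (fun ω => ‖z t ω‖ ^ 2) μ := fun t => (hz t).norm.integrable_sq
  have hu0 : ∀ t, AEStronglyMeasurable (u t) μ := fun t =>
    ((hu t).mono (ℱ.le t)).aestronglyMeasurable
  have hasq : ∀ t, Integrable (fun ω => a t ω ^ 2) μ := fun t => by
    refine Integrable.of_bound ((ha t).pow 2) (C ^ 2) ?_
    filter_upwards [haC] with ω hω
    rw [Real.norm_of_nonneg (sq_nonneg _)]
    exact pow_le_pow_left₀ (ha0 t ω) (hω t) 2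
  have hΦi : ∀ t, Integrable (Φ t) μ := fun t => by
    refine Integrable.of_bound (hΦ t) C ?_
    filter_upwards [hΦC] with ω hω using hω t
  have huz : ∀ t, Integrable (fun ω => ⟪u t ω, z t ω⟫_ℝ) μ := fun t => by
    refine ((hzi t).norm.const_mul C).mono' ((hu0 t).inner (hzi t).1) ?_
    filter_upwards [huC] with ω hω
    exact (norm_inner_le_norm _ _).trans (by gcongr; exact hω t)
  have hmean : ∀ t, ∫ ω, ⟪u t ω, z t ω⟫_ℝ ∂μ ≤ -δ * ∫ ω, a t ω ^ 2 ∂μ := by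
    intro t
    have h1 : μ[fun ω => ⟪u t ω, z t ω⟫_ℝ | ℱ t] =ᵐ[μ] fun ω => ⟪u t ω, (μ[z t | ℱ t]) ω⟫_ℝ :=
      condExp_bilin_of_stronglyMeasurable_left (innerSL ℝ) (hu t) (huz t) (hzi t)
    rw [← integral_condExp (ℱ.le t), ← integral_const_mul]
    refine integral_mono_ae integrable_condExp ((hasq t).const_mul _) ?_
    filter_upwards [h1, hdesc t] with ω h2 h3
    rw [h2]; exact h3
  -- the one-step inequality, in expectation
  have hone : ∀ t, ∫ ω, Φ (t + 1) ω ∂μ + δ * ∫ ω, β t * a t ω ^ 2 ∂μ ≤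
      ∫ ω, Φ t ω ∂μ + (χ t * (C * (1 + C)) + (β t + χ t) ^ 2 * C ^ 2) := by
    intro t
    have h1 : ∫ ω, Φ (t + 1) ω ∂μ ≤ ∫ ω, (Φ t ω + β t * ⟪u t ω, z t ω⟫_ℝ +
        (χ t * (C * (1 + ‖z t ω‖ ^ 2)) + (β t + χ t) ^ 2 * (C * ‖z t ω‖ ^ 2))) ∂μ := by
      refine integral_mono_ae (hΦi _) (((hΦi t).add ((huz t).const_mul _)).add
        (((((integrable_const 1).add (hzsq t)).const_mul _).const_mul _).add
          (((hzsq t).const_mul _).const_mul _))) ?_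
      filter_upwards [hstep, huC] with ω h2 h3
      obtain ⟨h4, h5⟩ := hα_mem t ω
      have h6 : ⟪u t ω, α t ω • z t ω⟫_ℝ =
          β t * ⟪u t ω, z t ω⟫_ℝ + (α t ω - β t) * ⟪u t ω, z t ω⟫_ℝ := by
        rw [real_inner_smul_right]; ring
      -- The stepsize may be correlated with `z t`, so no conditional expectation is taken here:
      -- only its excess over `β t`, at most `χ t`, is bounded pathwise.
      have h7 : (α t ω - β t) * ⟪u t ω, z t ω⟫_ℝ ≤ χ t * (C * (1 + ‖z t ω‖ ^ 2)) := by
        have h8 : ⟪u t ω, z t ω⟫_ℝ ≤ C * (1 + ‖z t ω‖ ^ 2) := by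
          refine (real_inner_le_norm _ _).trans (mul_le_mul (h3 t) ?_ (norm_nonneg _) hC.le)
          nlinarith [sq_nonneg (‖z t ω‖ - 1)]
        have h9 : 0 ≤ C * (1 + ‖z t ω‖ ^ 2) := by positivity
        calc _ ≤ (α t ω - β t) * (C * (1 + ‖z t ω‖ ^ 2)) := by
              gcongr
          _ ≤ _ := by gcongr; linarith
      have h10 : ‖α t ω • z t ω‖ ^ 2 ≤ (β t + χ t) ^ 2 * ‖z t ω‖ ^ 2 := by
        have h11 : 0 ≤ α t ω := (hβ t).le.trans h4
        rw [norm_smul, mul_pow, Real.norm_of_nonneg h11]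
        gcongr
      have h12 := mul_le_mul_of_nonneg_left h10 hC.le
      have := h2 t
      linarith
    have h13 : ∫ ω, (Φ t ω + β t * ⟪u t ω, z t ω⟫_ℝ +
        (χ t * (C * (1 + ‖z t ω‖ ^ 2)) + (β t + χ t) ^ 2 * (C * ‖z t ω‖ ^ 2))) ∂μ =
        ∫ ω, Φ t ω ∂μ + β t * ∫ ω, ⟪u t ω, z t ω⟫_ℝ ∂μ + (χ t * (C * (1 + ∫ ω, ‖z t ω‖ ^ 2 ∂μ)) +
          (β t + χ t) ^ 2 * (C * ∫ ω, ‖z t ω‖ ^ 2 ∂μ)) := by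
      have i1 : Integrable (fun ω => β t * ⟪u t ω, z t ω⟫_ℝ) μ := (huz t).const_mul _
      have i2 : Integrable (fun ω => 1 + ‖z t ω‖ ^ 2) μ := (integrable_const 1).add (hzsq t)
      have i3 : Integrable (fun ω => χ t * (C * (1 + ‖z t ω‖ ^ 2))) μ :=
        (i2.const_mul _).const_mul _
      have i4 : Integrable (fun ω => (β t + χ t) ^ 2 * (C * ‖z t ω‖ ^ 2)) μ :=
        ((hzsq t).const_mul _).const_mul _
      rw [integral_add (f := fun ω => Φ t ω + β t * ⟪u t ω, z t ω⟫_ℝ) (g := fun ω =>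
          χ t * (C * (1 + ‖z t ω‖ ^ 2)) + (β t + χ t) ^ 2 * (C * ‖z t ω‖ ^ 2))
          ((hΦi t).add i1) (i3.add i4),
        integral_add (hΦi t) i1, integral_add i3 i4, integral_const_mul, integral_const_mul,
        integral_const_mul, integral_const_mul, integral_const_mul,
        integral_add (integrable_const 1) (hzsq t)]
      simp
    rw [h13] at h1
    rw [integral_const_mul]
    have h14 := mul_le_mul_of_nonneg_left (hmean t) (hβ t).le
    have h15 : χ t * (C * (1 + ∫ ω, ‖z t ω‖ ^ 2 ∂μ)) ≤ χ t * (C * (1 + C)) := by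
      have := hχ t
      gcongr
      exact hzC t
    have h16 : (β t + χ t) ^ 2 * (C * ∫ ω, ‖z t ω‖ ^ 2 ∂μ) ≤ (β t + χ t) ^ 2 * C ^ 2 := by
      rw [pow_two C]
      gcongr
      exact hzC t
    linarith
  obtain ⟨ρ, hρ⟩ : ∃ ρ : ℕ → ℝ, ρ = fun t => χ t * (C * (1 + C)) + (β t + χ t) ^ 2 * C ^ 2 :=
    ⟨_, rfl⟩
  have hρs : Summable ρ := by rw [hρ]; exact (hχs.mul_right _).add (hη.mul_right _)
  have hρ0 : ∀ t, 0 ≤ ρ t := fun t => by rw [hρ]; have := hχ t; positivity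
  have hΦb : ∀ t, |∫ ω, Φ t ω ∂μ| ≤ C := fun t => by
    have h1 : ‖∫ ω, Φ t ω ∂μ‖ ≤ C * μ.real Set.univ := by
      refine norm_integral_le_of_norm_le_const ?_
      filter_upwards [hΦC] with ω hω using hω t
    simpa using h1
  have htel : ∀ n, ∫ ω, Φ n ω ∂μ + δ * ∑ t ∈ Finset.range n, ∫ ω, β t * a t ω ^ 2 ∂μ ≤
      ∫ ω, Φ 0 ω ∂μ + ∑ t ∈ Finset.range n, ρ t := by
    intro n
    induction n with
    | zero => simp
    | succ n ih =>
      rw [Finset.sum_range_succ, Finset.sum_range_succ]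
      have := hone n
      have e : ρ n = χ n * (C * (1 + C)) + (β n + χ n) ^ 2 * C ^ 2 := by rw [hρ]
      rw [← e] at this
      linarith
  refine summable_of_sum_range_le (c := (2 * C + ∑' t, ρ t) / δ)
    (fun t => integral_nonneg fun ω => mul_nonneg (hβ t).le (sq_nonneg _)) fun n => ?_
  rw [le_div_iff₀ hδ]
  have h1 := htel n
  have h2 := abs_le.1 (hΦb n)
  have h3 := abs_le.1 (hΦb 0)
  have h4 := hρs.sum_le_tsum (Finset.range n) fun t _ => hρ0 t
  linarith

/-- Almost sure convergence of a stochastic descent method. -/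
theorem tendsto_of_stochastic_descent {ℱ : Filtration ℕ m₀} {w z u : ℕ → Ω → H}
    {α Φ a : ℕ → Ω → ℝ} {β χ : ℕ → ℝ} {C δ : ℝ} (hC : 0 < C) (hδ : 0 < δ)
    (hβ : ∀ t, 0 < β t) (hχ : ∀ t, 0 ≤ χ t)
    (hβ_sum : Tendsto (fun n => ∑ t ∈ Finset.range n, β t) atTop atTop)
    (hη : Summable fun t => (β t + χ t) ^ 2) (hχs : Summable χ)
    (hu : ∀ t, StronglyMeasurable[ℱ t] (u t)) (hzm : ∀ t, StronglyMeasurable[ℱ (t + 1)] (z t))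
    (hz : ∀ t, MemLp (z t) 2 μ) (hzC : ∀ t, ∫ ω, ‖z t ω‖ ^ 2 ∂μ ≤ C)
    (hα_mem : ∀ t ω, α t ω ∈ Set.Icc (β t) (β t + χ t))
    (hΦ : ∀ t, AEStronglyMeasurable (Φ t) μ) (hΦC : ∀ᵐ ω ∂μ, ∀ t, |Φ t ω| ≤ C)
    (huC : ∀ᵐ ω ∂μ, ∀ t, ‖u t ω‖ ≤ C) (ha : ∀ t, AEStronglyMeasurable (a t) μ)
    (ha0 : ∀ t ω, 0 ≤ a t ω) (haC : ∀ᵐ ω ∂μ, ∀ t, a t ω ≤ C)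
    (hstep : ∀ᵐ ω ∂μ, ∀ t,
      Φ (t + 1) ω ≤ Φ t ω + ⟪u t ω, α t ω • z t ω⟫_ℝ + C * ‖α t ω • z t ω‖ ^ 2)
    (hdesc : ∀ t, ∀ᵐ ω ∂μ, ⟪u t ω, (μ[z t | ℱ t]) ω⟫_ℝ ≤ -δ * a t ω ^ 2)
    (he : ∀ t, ∀ᵐ ω ∂μ, ‖(μ[z t | ℱ t]) ω‖ ≤ C * a t ω)
    (hw : ∀ᵐ ω ∂μ, ∀ t, w (t + 1) ω = w t ω + α t ω • z t ω)
    (hlip : ∀ᵐ ω ∂μ, ∀ s t, |a s ω - a t ω| ≤ C * ‖w s ω - w t ω‖) :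
    ∀ᵐ ω ∂μ, Tendsto (fun t => ‖w (t + 1) ω - w t ω‖) atTop (𝓝 0) ∧
      Tendsto (fun t => a t ω) atTop (𝓝 0) := by
  have : CompleteSpace H := FiniteDimensional.complete ℝ H
  have hzi : ∀ t, Integrable (z t) μ := fun t => (hz t).integrable one_le_two
  have hzsq : ∀ t, Integrable (fun ω => ‖z t ω‖ ^ 2) μ := fun t => (hz t).norm.integrable_sq
  have hη0 : ∀ t, 0 < β t + χ t := fun t => add_pos_of_pos_of_nonneg (hβ t) (hχ t)
  have hasq : ∀ t, Integrable (fun ω => β t * a t ω ^ 2) μ := fun t => by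
    refine (Integrable.of_bound ((ha t).pow 2) (C ^ 2) ?_).const_mul _
    filter_upwards [haC] with ω hω
    rw [Pi.pow_apply, Real.norm_of_nonneg (sq_nonneg _)]
    exact pow_le_pow_left₀ (ha0 t ω) (hω t) 2
  have s1 : ∀ᵐ ω ∂μ, Summable fun t => β t * a t ω ^ 2 :=
    ae_summable_of_summable_integral (fun t ω => mul_nonneg (hβ t).le (sq_nonneg _)) hasq
      (summable_of_stochastic_descent hC hδ hβ hχ hη hχs hu hz hzC hα_mem hΦ hΦC huC ha ha0 haC
        hstep hdesc)
  have s2 : ∀ᵐ ω ∂μ, Summable fun t => (β t + χ t) ^ 2 * ‖z t ω‖ ^ 2 := by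
    refine ae_summable_of_summable_integral (fun t ω => by positivity)
      (fun t => (hzsq t).const_mul _) ?_
    refine Summable.of_nonneg_of_le (fun t => integral_nonneg fun ω => by positivity) (fun t => ?_)
      (hη.mul_right C)
    rw [integral_const_mul]
    exact mul_le_mul_of_nonneg_left (hzC t) (sq_nonneg _)
  have s3 : ∀ᵐ ω ∂μ, Summable fun t => χ t * ‖z t ω‖ := by
    refine ae_summable_of_summable_integral (fun t ω => mul_nonneg (hχ t) (norm_nonneg _))
      (fun t => (hzi t).norm.const_mul _) ?_
    refine Summable.of_nonneg_of_le
      (fun t => integral_nonneg fun ω => mul_nonneg (hχ t) (norm_nonneg _)) (fun t => ?_)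
      (hχs.mul_right (1 + C))
    rw [integral_const_mul]
    refine mul_le_mul_of_nonneg_left ?_ (hχ t)
    calc ∫ ω, ‖z t ω‖ ∂μ ≤ ∫ ω, (1 + ‖z t ω‖ ^ 2) ∂μ := by
          refine integral_mono (hzi t).norm ((integrable_const 1).add (hzsq t)) fun ω => ?_
          change ‖z t ω‖ ≤ 1 + ‖z t ω‖ ^ 2
          nlinarith [sq_nonneg (‖z t ω‖ - 1)]
      _ = 1 + ∫ ω, ‖z t ω‖ ^ 2 ∂μ := by
          rw [integral_add (integrable_const 1) (hzsq t)]; simp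
      _ ≤ _ := by gcongr; exact hzC t
  -- The noise is weighted with the deterministic `β t`. With `α t` in its place it would not be a
  -- martingale difference in general.
  have s4 : ∀ᵐ ω ∂μ, ∃ l, Tendsto (fun n => ∑ t ∈ Finset.range n,
      β t • (z t ω - (μ[z t | ℱ t]) ω)) atTop (𝓝 l) := by
    have hmem : ∀ t, MemLp (fun ω => z t ω - (μ[z t | ℱ t]) ω) 2 μ := fun t =>
      (hz t).sub ((hz t).condExp one_le_two)
    have hmem' : ∀ t, MemLp (fun ω => β t • (z t ω - (μ[z t | ℱ t]) ω)) 2 μ := fun t =>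
      (hmem t).const_smul (β t)
    refine ae_exists_tendsto_sum_of_martingale_diff_vec (ℱ := ℱ) (fun t => ?_) hmem' (fun t => ?_) ?_
    · exact ((hzm t).sub (stronglyMeasurable_condExp.mono (ℱ.mono t.le_succ))).const_smul (β t)
    · have h1 := condExp_smul (μ := μ) (β t) (z t - μ[z t | ℱ t]) (ℱ t)
      have h2 := condExp_sub (hzi t) (integrable_condExp (f := z t) (m := ℱ t)) (ℱ t)
      rw [condExp_of_stronglyMeasurable (ℱ.le t) (stronglyMeasurable_condExp (f := z t))
        integrable_condExp] at h2
      filter_upwards [h1, h2] with ω h3 h4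
      refine h3.trans ?_
      rw [Pi.smul_apply, h4]
      simp
    · refine Summable.of_nonneg_of_le (fun t => integral_nonneg fun ω => by positivity) (fun t => ?_)
        (hη.mul_right (2 * C + 2 * (C * C) ^ 2))
      have h1 : ∫ ω, ‖z t ω - (μ[z t | ℱ t]) ω‖ ^ 2 ∂μ ≤ 2 * C + 2 * (C * C) ^ 2 := by
        calc _ ≤ ∫ ω, (2 * ‖z t ω‖ ^ 2 + 2 * (C * C) ^ 2) ∂μ := by
              refine integral_mono_ae (hmem t).norm.integrable_sq
                (((hzsq t).const_mul 2).add (integrable_const _)) ?_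
              filter_upwards [he t, haC] with ω h2 h3
              have h4 : ‖(μ[z t | ℱ t]) ω‖ ≤ C * C := h2.trans (by gcongr; exact h3 t)
              have h5 := norm_sub_le (z t ω) ((μ[z t | ℱ t]) ω)
              have h6 : ‖z t ω - (μ[z t | ℱ t]) ω‖ ^ 2 ≤ (‖z t ω‖ + C * C) ^ 2 := by
                gcongr; linarith
              change ‖z t ω - (μ[z t | ℱ t]) ω‖ ^ 2 ≤ 2 * ‖z t ω‖ ^ 2 + 2 * (C * C) ^ 2
              nlinarith [sq_nonneg (‖z t ω‖ - C * C)]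
          _ = 2 * ∫ ω, ‖z t ω‖ ^ 2 ∂μ + 2 * (C * C) ^ 2 := by
              rw [integral_add ((hzsq t).const_mul 2) (integrable_const _), integral_const_mul]
              simp
          _ ≤ _ := by gcongr; exact hzC t
      have h2 : ∀ ω, ‖β t • (z t ω - (μ[z t | ℱ t]) ω)‖ ^ 2 =
          β t ^ 2 * ‖z t ω - (μ[z t | ℱ t]) ω‖ ^ 2 := fun ω => by
        rw [norm_smul, mul_pow, Real.norm_of_nonneg (hβ t).le]
      simp_rw [h2]
      rw [integral_const_mul]
      have h3 : β t ^ 2 ≤ (β t + χ t) ^ 2 := by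
        have := hβ t
        gcongr
        linarith [hχ t]
      gcongr
  have hη_lim : Tendsto (fun t => β t + χ t) atTop (𝓝 0) := by
    have h1 := (Real.continuous_sqrt.tendsto 0).comp hη.tendsto_atTop_zero
    rw [Real.sqrt_zero] at h1
    exact h1.congr fun t => Real.sqrt_sq (hη0 t).le
  have hβ0 : Tendsto β atTop (𝓝 0) :=
    squeeze_zero (fun t => (hβ t).le) (fun t => by linarith [hχ t]) hη_lim
  filter_upwards [s1, s2, s3, s4, hw, hlip, ae_all_iff.2 he] with ω h1 h2 h3 h4 h5 h6 h7
  constructor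
  · have h8 := (Real.continuous_sqrt.tendsto 0).comp h2.tendsto_atTop_zero
    rw [Real.sqrt_zero] at h8
    refine squeeze_zero (fun t => norm_nonneg _) (fun t => ?_) h8
    obtain ⟨h9, h10⟩ := hα_mem t ω
    rw [h5 t, add_sub_cancel_left, norm_smul, Real.norm_of_nonneg ((hβ t).le.trans h9),
      Function.comp_apply, ← mul_pow, Real.sqrt_sq (by have := hη0 t; positivity)]
    gcongr
  · obtain ⟨l, hl⟩ := h4
    have h8 : Summable fun t => (α t ω - β t) • z t ω := by
      refine Summable.of_norm_bounded h3 fun t => ?_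
      obtain ⟨h9, h10⟩ := hα_mem t ω
      rw [norm_smul, Real.norm_of_nonneg (by linarith)]
      gcongr
      linarith
    have h9 := hl.add h8.hasSum.tendsto_sum_nat
    simp_rw [← Finset.sum_add_distrib] at h9
    -- The movement along the conditional mean is the drift; the noise sequence joins the martingale
    -- differences and the excess steps `(α t - β t) • z t`.
    refine tendsto_zero_of_summable_mul_sq (e := fun t => (μ[z t | ℱ t]) ω) hC hβ hβ_sum hβ0
      (fun t => ha0 t ω) h1 (fun t => ?_) h7 h9 h6
    rw [h5 t]
    module

end StochasticDescent

/-! ### The error of the sketch-and-project solver. -/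

section Residual

variable {d m : ℕ}

/-- The error `z_j - z` of the sketch-and-project iterates for `K z = -b`. -/
noncomputable def sketchResidual (K : PD d m →L[ℝ] PD d m) (b : PD d m) (A : ℕ → Sketch d m) :
    ℕ → PD d m
  | 0 => pinv K b
  | j + 1 => sketchResidual K b A j - sketchProj K (A j) (sketchResidual K b A j)

/-- The solution is `-K⁻¹ b`, so starting at zero the error is `K⁻¹ b`, and each step removes its
projection. -/
theorem sketchSolve_eq {K : PD d m →L[ℝ] PD d m} (hK : Function.Injective K) (b : PD d m)
    (A : ℕ → Sketch d m) (j : ℕ) :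
    sketchSolve K b A j = sketchResidual K b A j - pinv K b := by
  induction j with
  | zero => simp [sketchSolve, sketchResidual]
  | succ j ih =>
    have h : K (sketchSolve K b A j) + b = K (sketchResidual K b A j) := by
      rw [ih, map_sub, self_apply_pinv hK, sub_add_cancel]
    rw [sketchSolve, h, ih, sketchResidual, sketchProj, ContinuousLinearMap.comp_apply]
    abel

theorem norm_sketchResidual_le {K : PD d m →L[ℝ] PD d m} (hK : IsSelfAdjoint K) (b : PD d m)
    (A : ℕ → Sketch d m) (j : ℕ) : ‖sketchResidual K b A j‖ ≤ ‖pinv K b‖ := by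
  induction j with
  | zero => rfl
  | succ j ih => exact (norm_sub_sketchProj_apply_le hK _ _).trans ih

theorem measurable_sketchProj :
    Measurable fun p : (PD d m →L[ℝ] PD d m) × Sketch d m => sketchProj p.1 p.2 := by
  have h : Measurable fun p : (PD d m →L[ℝ] PD d m) × (PD d m →L[ℝ] PD d m) => p.1 ∘L p.2 :=
    (continuous_fst.clm_comp continuous_snd).measurable
  exact h.comp (measurable_sketchGain.prodMk measurable_fst)

theorem measurable_eval :
    Measurable fun p : (PD d m →L[ℝ] PD d m) × PD d m => p.1 p.2 :=
  (continuous_fst.clm_apply continuous_snd).measurable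

variable {Ω : Type*} {𝒢 : MeasurableSpace Ω}

theorem measurable_sketchResidual {K : Ω → PD d m →L[ℝ] PD d m} {b : Ω → PD d m}
    {A : Ω → ℕ → Sketch d m} (hK : Measurable K) (hb : Measurable b) {n : ℕ}
    (hA : ∀ j < n, Measurable fun ω => A ω j) :
    Measurable fun ω => sketchResidual (K ω) (b ω) (A ω) n := by
  induction n with
  | zero => exact measurable_eval.comp ((measurable_pinv.comp hK).prodMk hb)
  | succ n ih =>
    have h1 := ih fun j hj => hA j (hj.trans n.lt_succ_self)
    have h2 := measurable_sketchProj.comp (hK.prodMk (hA n n.lt_succ_self))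
    exact h1.sub (measurable_eval.comp (h2.prodMk h1))

theorem measurable_sketchSolve {K : Ω → PD d m →L[ℝ] PD d m} {b : Ω → PD d m}
    {A : Ω → ℕ → Sketch d m} (hK : Measurable K) (hb : Measurable b) {n : ℕ}
    (hA : ∀ j < n, Measurable fun ω => A ω j) :
    Measurable fun ω => sketchSolve (K ω) (b ω) (A ω) n := by
  induction n with
  | zero => exact measurable_const
  | succ n ih =>
    have h1 := ih fun j hj => hA j (hj.trans n.lt_succ_self)
    have h2 := measurable_sketchGain.comp (hK.prodMk (hA n n.lt_succ_self))
    exact h1.sub (measurable_eval.comp (h2.prodMk ((measurable_eval.comp (hK.prodMk h1)).add hb)))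

theorem measurable_modHess {S : Type*} [MeasurableSpace S] {F : Vec d → S → ℝ}
    {c : Vec d → Vec m} (hF : Measurable (Function.uncurry F))
    (hd : ∀ s, TwiceDifferentiable fun x => F x s) (hc : ContDiff ℝ 2 c) {w : ℕ → Ω → PD d m}
    {ξ : ℕ → Ω → S} {R : ℕ → Ω → Vec d →L[ℝ] Vec d} {t : ℕ} (hw : ∀ i ≤ t, Measurable (w i))
    (hξ : ∀ i < t, Measurable (ξ i)) (hR : Measurable (R t)) :
    Measurable fun ω =>
      modHess F c (fun i => w i ω) (fun i => ξ i ω) (fun i => R i ω) t := by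
  have hsum : ∀ i ∈ Finset.range t, Measurable fun ω => lagHessEst F c (w i ω) (ξ i ω) := by
    intro i hi
    have hi' := Finset.mem_range.1 hi
    have h0 := (measurable_lagHessEst hF hd hc).comp ((hw i hi'.le).prodMk (hξ i hi'))
    exact h0
  unfold modHess
  split_ifs
  · exact measurable_const
  · generalize lagHessEst F c = h at hsum ⊢
    have h1 : Measurable fun ω => ∑ i ∈ Finset.range t, h (w i ω) (ξ i ω) :=
      Finset.measurable_fun_sum _ hsum
    exact (h1.const_smul ((t : ℝ)⁻¹)).add hR

theorem measurable_newtonMat {S : Type*} [MeasurableSpace S] {F : Vec d → S → ℝ}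
    {c : Vec d → Vec m} (hF : Measurable (Function.uncurry F))
    (hd : ∀ s, TwiceDifferentiable fun x => F x s) (hc : ContDiff ℝ 2 c) {w : ℕ → Ω → PD d m}
    {ξ : ℕ → Ω → S} {R : ℕ → Ω → Vec d →L[ℝ] Vec d} {t : ℕ} (hw : ∀ i ≤ t, Measurable (w i))
    (hξ : ∀ i < t, Measurable (ξ i)) (hR : Measurable (R t)) :
    Measurable fun ω =>
      newtonMat F c (fun i => w i ω) (fun i => ξ i ω) (fun i => R i ω) t := by
  have h1 := measurable_modHess hF hd hc hw hξ hR
  have hj : Measurable fun p : PD d m => jac c p.fst :=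
    ((continuous_jac hc).comp (WithLp.fstL 2 ℝ (Vec d) (Vec m)).continuous).measurable
  have h2 : Measurable fun ω => jac c (w t ω).fst := hj.comp (hw t le_rfl)
  unfold newtonMat
  have h3 := continuous_kkt.measurable.comp (h1.prodMk h2)
  exact h3

end Residual

/-! ### Norms of symmetric operators between `0` and `q`. -/

section Contraction

variable {H : Type*} [NormedAddCommGroup H] [InnerProductSpace ℝ H]

theorem norm_apply_le_of_inner_le {T : H →L[ℝ] H} (hT : (T : H →ₗ[ℝ] H).IsSymmetric) {q : ℝ}
    (hq : 0 ≤ q) (h0 : ∀ v, 0 ≤ ⟪T v, v⟫_ℝ) (h1 : ∀ v, ⟪T v, v⟫_ℝ ≤ q * ‖v‖ ^ 2) (v : H) :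
    ‖T v‖ ≤ q * ‖v‖ := by
  -- Positivity of `T` at `v - s • T v`. The choice `s = 1 / q` minimizes the right side; for `q =
  -- 0` the value `s = 1` suffices.
  have key : ∀ s : ℝ, 0 ≤ q * ‖v‖ ^ 2 - 2 * s * ‖T v‖ ^ 2 + s ^ 2 * (q * ‖T v‖ ^ 2) := by
    intro s
    have h2 := h0 (v - s • T v)
    have h3 : ⟪T (T v), v⟫_ℝ = ‖T v‖ ^ 2 := by
      rw [← real_inner_self_eq_norm_sq]; exact hT (T v) v
    have h4 : ⟪T (v - s • T v), v - s • T v⟫_ℝ =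
        ⟪T v, v⟫_ℝ - 2 * s * ‖T v‖ ^ 2 + s ^ 2 * ⟪T (T v), T v⟫_ℝ := by
      rw [map_sub, map_smul, inner_sub_left, inner_sub_right, inner_sub_right, real_inner_smul_left,
        real_inner_smul_left, real_inner_smul_right, real_inner_smul_right, h3,
        real_inner_self_eq_norm_sq]
      ring
    have h5 := mul_le_mul_of_nonneg_left (h1 (T v)) (sq_nonneg s)
    rw [h4] at h2
    linarith [h1 v]
  rcases hq.eq_or_lt with rfl | hq'
  · have := key 1
    have h2 : ‖T v‖ ^ 2 ≤ 0 := by linarith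
    have h3 : ‖T v‖ = 0 := by nlinarith [sq_nonneg ‖T v‖, norm_nonneg (T v)]
    rw [h3, zero_mul]
  · have h2 := key (1 / q)
    have h3 : q * ‖v‖ ^ 2 - 2 * (1 / q) * ‖T v‖ ^ 2 + (1 / q) ^ 2 * (q * ‖T v‖ ^ 2) =
        ((q * ‖v‖) ^ 2 - ‖T v‖ ^ 2) / q := by field_simp; ring
    rw [h3] at h2
    have h4 : ‖T v‖ ^ 2 ≤ (q * ‖v‖) ^ 2 := by
      by_contra! h
      exact absurd h2 (not_le.2 (div_neg_of_neg_of_pos (by linarith) hq'))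
    exact abs_le_of_sq_le_sq' h4 (by positivity) |>.2

/-- The operator `1 - T` lies between `0` and `1 - γ`. The maximum with `0` covers `γ > 1`, which
can occur only on the zero space. -/
theorem norm_sub_apply_le_of_smul_id_le [CompleteSpace H] {T : H →L[ℝ] H} {γ : ℝ}
    (hγ : γ • ContinuousLinearMap.id ℝ H ≤ T) (h1 : ‖T‖ ≤ 1) (v : H) :
    ‖v - T v‖ ≤ max (1 - γ) 0 * ‖v‖ := by
  have hpos := (ContinuousLinearMap.isPositive_iff _).1 hγ
  have hin : ∀ v, γ * ‖v‖ ^ 2 ≤ ⟪T v, v⟫_ℝ := fun v => by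
    have h2 : 0 ≤ ⟪T v - γ • v, v⟫_ℝ := hpos.2 v
    rw [inner_sub_left, real_inner_smul_left, real_inner_self_eq_norm_sq] at h2
    linarith
  have hsymm : ∀ v w, ⟪T v, w⟫_ℝ = ⟪v, T w⟫_ℝ := fun v w => by
    have h2 : ⟪T v - γ • v, w⟫_ℝ = ⟪v, T w - γ • w⟫_ℝ := hpos.1 v w
    rw [inner_sub_left, inner_sub_right, real_inner_smul_left, real_inner_smul_right] at h2
    linarith
  refine norm_apply_le_of_inner_le (T := ContinuousLinearMap.id ℝ H - T) (fun v w => ?_)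
    (le_max_right _ _) (fun v => ?_) (fun v => ?_) v
  · change ⟪v - T v, w⟫_ℝ = ⟪v, w - T w⟫_ℝ
    rw [inner_sub_left, inner_sub_right, hsymm]
  · change 0 ≤ ⟪v - T v, v⟫_ℝ
    have h2 := real_inner_le_norm (T v) v
    have h3 := T.le_of_opNorm_le h1 v
    rw [inner_sub_left, real_inner_self_eq_norm_sq]
    nlinarith [norm_nonneg v]
  · change ⟪v - T v, v⟫_ℝ ≤ _
    rw [inner_sub_left, real_inner_self_eq_norm_sq]
    have h2 := mul_le_mul_of_nonneg_right (le_max_left (1 - γ) 0) (sq_nonneg ‖v‖)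
    linarith [hin v]

end Contraction

/-! ### Contraction of the conditional mean of the solver error. -/

section CondExp

theorem completeSpace_clm {E : Type*} [NormedAddCommGroup E] [NormedSpace ℝ E] [CompleteSpace E] :
    CompleteSpace (E →L[ℝ] E) :=
  inferInstance

theorem completeSpace_clm_pd (d m : ℕ) : CompleteSpace (PD d m →L[ℝ] PD d m) :=
  completeSpace_clm (E := PD d m)

variable {Ω Z : Type*} {ℱ 𝒢 m₀ : MeasurableSpace Ω} {μ : Measure Ω} [MeasurableSpace Z] {d m : ℕ}

theorem condExp_apply_of_stronglyMeasurable {E G : Type*} [NormedAddCommGroup E] [NormedSpace ℝ E]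
    [CompleteSpace E] [NormedAddCommGroup G] [NormedSpace ℝ G] [CompleteSpace G]
    {T : Ω → E →L[ℝ] G} {r : Ω → E} (hT : StronglyMeasurable[ℱ] T)
    (hTr : Integrable (fun ω => T ω (r ω)) μ) (hr : Integrable r μ) :
    μ[fun ω => T ω (r ω) | ℱ] =ᵐ[μ] fun ω => T ω ((μ[r | ℱ]) ω) :=
  condExp_bilin_of_stronglyMeasurable_left (ContinuousLinearMap.id ℝ (E →L[ℝ] G)) hT hTr hr

/-- Conditional expectation of one step of the sketch-and-project error. -/
theorem condExp_sub_sketchProj [IsProbabilityMeasure μ] (hℱ : ℱ ≤ 𝒢) (h𝒢 : 𝒢 ≤ m₀) {A : Z → Sketch d m} (hA : Measurable A)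
    {Y : Ω → Z} (hY : Measurable Y) (hind : Indep 𝒢 (MeasurableSpace.comap Y inferInstance) μ)
    {K : Ω → PD d m →L[ℝ] PD d m} (hK : Measurable[ℱ] K) (hKs : ∀ ω, IsSelfAdjoint (K ω))
    {r : Ω → PD d m} (hr : Measurable[𝒢] r) (hri : Integrable r μ) :
    (∀ᵐ ω ∂μ, ‖(μ[fun ω => sketchProj (K ω) (A (Y ω)) | ℱ]) ω‖ ≤ 1) ∧
    μ[fun ω => r ω - sketchProj (K ω) (A (Y ω)) (r ω) | ℱ] =ᵐ[μ] fun ω =>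
      (μ[r | ℱ]) ω - (μ[fun ω => sketchProj (K ω) (A (Y ω)) | ℱ]) ω ((μ[r | ℱ]) ω) := by
  have := completeSpace_clm_pd d m
  have hK𝒢 : Measurable[𝒢] K := hK.mono hℱ le_rfl
  have hK0 : Measurable[m₀] K := hK𝒢.mono h𝒢 le_rfl
  have hr0 : Measurable[m₀] r := hr.mono h𝒢 le_rfl
  have hnorm : ∀ ω y, ‖sketchProj (K ω) (A y)‖ ≤ 1 := fun ω y =>
    ContinuousLinearMap.opNorm_le_bound _ zero_le_one fun v => by
      rw [one_mul]; exact norm_sketchProj_apply_le (hKs ω) _ v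
  have hPm : Measurable fun p : (PD d m →L[ℝ] PD d m) × Z => sketchProj p.1 (A p.2) :=
    measurable_sketchProj.comp (measurable_fst.prodMk (hA.comp measurable_snd))
  have hPω : Measurable[m₀] fun ω => sketchProj (K ω) (A (Y ω)) := hPm.comp (hK0.prodMk hY)
  have hPi : Integrable (fun ω => sketchProj (K ω) (A (Y ω))) μ :=
    Integrable.of_bound hPω.aestronglyMeasurable 1 (ae_of_all _ fun ω => hnorm ω _)
  have hPri : Integrable (fun ω => sketchProj (K ω) (A (Y ω)) (r ω)) μ := by
    refine hri.norm.mono' (measurable_eval.comp (hPω.prodMk hr0)).aestronglyMeasurable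
      (ae_of_all _ fun ω => norm_sketchProj_apply_le (hKs ω) _ _)
  have : IsProbabilityMeasure (μ.map Y) := Measure.isProbabilityMeasure_map hY.aemeasurable
  have h1 : μ[fun ω => sketchProj (K ω) (A (Y ω)) | ℱ] =ᵐ[μ]
      fun ω => ∫ y, sketchProj (K ω) (A y) ∂(μ.map Y) :=
    condExp_comp_of_indep (hℱ.trans h𝒢) (g := fun p => sketchProj p.1 (A p.2)) hK hY
      (indep_of_indep_of_le_left hind hℱ) hPm.stronglyMeasurable hPi
  have hgm : Measurable fun p : ((PD d m →L[ℝ] PD d m) × PD d m) × Z =>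
      sketchProj p.1.1 (A p.2) p.1.2 :=
    measurable_eval.comp ((hPm.comp (measurable_fst.fst.prodMk measurable_snd)).prodMk
      measurable_fst.snd)
  have h2 : μ[fun ω => sketchProj (K ω) (A (Y ω)) (r ω) | 𝒢] =ᵐ[μ]
      fun ω => ∫ y, sketchProj (K ω) (A y) (r ω) ∂(μ.map Y) :=
    condExp_comp_of_indep h𝒢 (X := fun ω => (K ω, r ω))
      (g := fun p => sketchProj p.1.1 (A p.2) p.1.2) (hK𝒢.prodMk hr) hY hind
      hgm.stronglyMeasurable hPri
  have hint : ∀ ω, Integrable (fun y => sketchProj (K ω) (A y)) (μ.map Y) := fun ω =>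
    Integrable.of_bound (hPm.comp measurable_prodMk_left).aestronglyMeasurable 1
      (ae_of_all _ fun y => hnorm ω y)
  have h3 : ∀ ω, ∫ y, sketchProj (K ω) (A y) (r ω) ∂(μ.map Y) =
      (∫ y, sketchProj (K ω) (A y) ∂(μ.map Y)) (r ω) := fun ω =>
    (ContinuousLinearMap.integral_apply (hint ω) (r ω)).symm
  -- `𝒢` also knows the sample and the earlier sketches, but the new projection depends on them only
  -- through `K`. Its mean given `𝒢` is thus its mean given `ℱ`, and this factor can be taken out
  -- when averaging down to `ℱ`.
  have h4 : μ[fun ω => sketchProj (K ω) (A (Y ω)) (r ω) | 𝒢] =ᵐ[μ]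
      fun ω => (μ[fun ω => sketchProj (K ω) (A (Y ω)) | ℱ]) ω (r ω) := by
    filter_upwards [h1, h2] with ω h5 h6
    rw [h6, h5, h3]
  have h5 : μ[fun ω => sketchProj (K ω) (A (Y ω)) (r ω) | ℱ] =ᵐ[μ]
      fun ω => (μ[fun ω => sketchProj (K ω) (A (Y ω)) | ℱ]) ω ((μ[r | ℱ]) ω) := by
    have h6 : μ[fun ω => sketchProj (K ω) (A (Y ω)) (r ω) | ℱ] =ᵐ[μ]
        μ[μ[fun ω => sketchProj (K ω) (A (Y ω)) (r ω) | 𝒢] | ℱ] :=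
      (condExp_condExp_of_le hℱ h𝒢).symm
    have h7 := condExp_congr_ae (m := ℱ) h4
    have h8 : Integrable (fun ω => (μ[fun ω => sketchProj (K ω) (A (Y ω)) | ℱ]) ω (r ω)) μ :=
      integrable_condExp.congr h4
    have h9 : μ[fun ω => (μ[fun ω => sketchProj (K ω) (A (Y ω)) | ℱ]) ω (r ω) | ℱ] =ᵐ[μ]
        fun ω => (μ[fun ω => sketchProj (K ω) (A (Y ω)) | ℱ]) ω ((μ[r | ℱ]) ω) :=
      condExp_apply_of_stronglyMeasurable stronglyMeasurable_condExp h8 hri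
    exact h6.trans (h7.trans h9)
  refine ⟨?_, ?_⟩
  · filter_upwards [h1] with ω h6
    rw [h6]
    have := norm_integral_le_of_norm_le_const (μ := μ.map Y) (ae_of_all _ fun y => hnorm ω y)
    simpa using this
  · have h6 := condExp_sub hri hPri ℱ
    filter_upwards [h5, h6] with ω h7 h8
    rw [← h7]
    exact h8

end CondExp

section CondExpResidual

variable {Ω Z : Type*} {ℱ m₀ : MeasurableSpace Ω} {μ : Measure Ω} [IsProbabilityMeasure μ]
  [MeasurableSpace Z] {d m : ℕ}

/-- The conditional mean of the sketch-and-project error contracts geometrically. -/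
theorem norm_condExp_sketchResidual_le {𝒢 : ℕ → MeasurableSpace Ω} (hℱ : ∀ j, ℱ ≤ 𝒢 j)
    (h𝒢 : ∀ j, 𝒢 j ≤ m₀) {A : Z → Sketch d m} (hA : Measurable A) {Y : ℕ → Ω → Z} {τ : ℕ}
    (hY : ∀ j, Measurable (Y j))
    (hind : ∀ j < τ, Indep (𝒢 j) (MeasurableSpace.comap (Y j) inferInstance) μ)
    {K : Ω → PD d m →L[ℝ] PD d m} (hK : Measurable[ℱ] K) (hKs : ∀ ω, IsSelfAdjoint (K ω))
    {b : Ω → PD d m}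
    (hres : ∀ j < τ, Measurable[𝒢 j] fun ω => sketchResidual (K ω) (b ω) (fun i => A (Y i ω)) j)
    (hint : Integrable (fun ω => pinv (K ω) (b ω)) μ) {γ : ℝ}
    (hγ : ∀ j < τ, ∀ᵐ ω ∂μ, γ • ContinuousLinearMap.id ℝ (PD d m) ≤
      (μ[fun ω => sketchProj (K ω) (A (Y j ω)) | ℱ]) ω) :
    ∀ j ≤ τ, ∀ᵐ ω ∂μ,
      ‖(μ[fun ω => sketchResidual (K ω) (b ω) (fun i => A (Y i ω)) j | ℱ]) ω‖ ≤
        max (1 - γ) 0 ^ j * ‖(μ[fun ω => pinv (K ω) (b ω) | ℱ]) ω‖ := by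
  intro j
  induction j with
  | zero =>
    intro _
    refine ae_of_all _ fun ω => ?_
    rw [pow_zero, one_mul]
    exact le_rfl
  | succ j ih =>
    intro hj
    have hj' : j < τ := hj
    have hri : Integrable (fun ω => sketchResidual (K ω) (b ω) (fun i => A (Y i ω)) j) μ :=
      hint.norm.mono' ((hres j hj').mono (h𝒢 j) le_rfl).aestronglyMeasurable
        (ae_of_all _ fun ω => norm_sketchResidual_le (hKs ω) _ _ _)
    obtain ⟨h1, h2⟩ := condExp_sub_sketchProj (hℱ j) (h𝒢 j) hA (hY j) (hind j hj') hK hKs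
      (hres j hj') hri
    filter_upwards [ih hj'.le, h1, h2, hγ j hj'] with ω h3 h4 h5 h6
    have h7 : (μ[fun ω => sketchResidual (K ω) (b ω) (fun i => A (Y i ω)) (j + 1) | ℱ]) ω = _ := h5
    rw [h7]
    refine (norm_sub_apply_le_of_smul_id_le h6 h4 _).trans ?_
    rw [pow_succ', mul_assoc]
    gcongr

end CondExpResidual

/-! ### Adaptedness and independence along a run. -/

section Run

variable {Ω S Z Y : Type*} [MeasurableSpace S] [MeasurableSpace Z] [MeasurableSpace Y]

section History

variable (ξ : ℕ → Ω → S) (ζ : ℕ → ℕ → Ω → Z) (ψ : ℕ → Ω → Y) (τ : ℕ)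

theorem history_mono : Monotone (history ξ ζ ψ τ) := fun _ _ hst =>
  biSup_mono fun _ hi => Finset.range_mono hst hi

theorem measurable_sample_history {i t : ℕ} (h : i < t) : Measurable[history ξ ζ ψ τ t] (ξ i) := by
  refine Measurable.of_comap_le ?_
  refine le_trans ?_ (le_iSup₂_of_le i (Finset.mem_range.2 h) le_rfl)
  exact le_sup_of_le_left le_sup_left

theorem measurable_sketchVar_history {i j t : ℕ} (h : i < t) (hj : j < τ) :
    Measurable[history ξ ζ ψ τ t] (ζ i j) := by
  refine Measurable.of_comap_le ?_
  refine le_trans ?_ (le_iSup₂_of_le i (Finset.mem_range.2 h) le_rfl)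
  refine le_sup_of_le_left (le_sup_of_le_right ?_)
  exact le_iSup₂_of_le (f := fun j _ => MeasurableSpace.comap (ζ i j) inferInstance) j
    (Finset.mem_range.2 hj) le_rfl

end History

variable [MeasurableSpace Ω] {d m : ℕ} {μ : Measure Ω} {F : Vec d → S → ℝ} {c : Vec d → Vec m}
  {P : Measure S} {Q : Measure Z} {A : Z → Sketch d m} {τ : ℕ} {β χ : ℕ → ℝ}
  {ξ : ℕ → Ω → S} {ζ : ℕ → ℕ → Ω → Z} {ψ : ℕ → Ω → Y} {R : ℕ → Ω → Vec d →L[ℝ] Vec d}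
  {α : ℕ → Ω → ℝ} {w₀ : PD d m} {w : ℕ → Ω → PD d m}

theorem IsRun.history_le (hrun : IsRun μ F c P Q A τ β χ ξ ζ ψ R α w₀ w) (t : ℕ) :
    history ξ ζ ψ τ t ≤ ‹MeasurableSpace Ω› := by
  refine iSup₂_le fun i _ => sup_le (sup_le ?_ (iSup₂_le fun j _ => ?_)) ?_
  · exact (hrun.measurable_sample i).comap_le
  · exact (hrun.measurable_sketchVar i j).comap_le
  · exact (hrun.measurable_stepVar i).comap_le

/-- The filtration of the past of a run. -/
def IsRun.filtration (hrun : IsRun μ F c P Q A τ β χ ξ ζ ψ R α w₀ w) :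
    Filtration ℕ ‹MeasurableSpace Ω› where
  seq := history ξ ζ ψ τ
  mono' := history_mono ξ ζ ψ τ
  le' := hrun.history_le

theorem IsRun.measurable_newtonMat_of_iterate (hrun : IsRun μ F c P Q A τ β χ ξ ζ ψ R α w₀ w)
    (hF : Measurable (Function.uncurry F)) (hd : ∀ s, TwiceDifferentiable fun x => F x s)
    (hc : ContDiff ℝ 2 c) {t : ℕ} (hw : ∀ i ≤ t, Measurable[history ξ ζ ψ τ t] (w i)) :
    Measurable[history ξ ζ ψ τ t] fun ω =>
      newtonMat F c (fun i => w i ω) (fun i => ξ i ω) (fun i => R i ω) t :=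
  measurable_newtonMat hF hd hc hw (fun _ hi => measurable_sample_history ξ ζ ψ τ hi)
    (hrun.reg_measurable t)

theorem IsRun.measurable_direction_of_iterate (hrun : IsRun μ F c P Q A τ β χ ξ ζ ψ R α w₀ w)
    (hF : Measurable (Function.uncurry F)) (hd : ∀ s, TwiceDifferentiable fun x => F x s)
    (hc : ContDiff ℝ 2 c) {t : ℕ} (hw : ∀ i ≤ t, Measurable[history ξ ζ ψ τ t] (w i)) :
    Measurable[history ξ ζ ψ τ (t + 1)] fun ω =>
      sketchSolve (newtonMat F c (fun i => w i ω) (fun i => ξ i ω) (fun i => R i ω) t)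
        (lagGradEst F c (w t ω) (ξ t ω)) (fun j => A (ζ t j ω)) τ := by
  have hle := history_mono ξ ζ ψ τ t.le_succ
  have h1 := (hrun.measurable_newtonMat_of_iterate hF hd hc hw).mono hle le_rfl
  have h2 : Measurable[history ξ ζ ψ τ (t + 1)] fun ω => (w t ω, ξ t ω) :=
    ((hw t le_rfl).mono hle le_rfl).prodMk (measurable_sample_history ξ ζ ψ τ t.lt_succ_self)
  have h3 := (measurable_lagGradEst hF hd hc).comp h2
  exact measurable_sketchSolve h1 h3 fun j hj =>
    hrun.measurable_sketch.comp (measurable_sketchVar_history ξ ζ ψ τ t.lt_succ_self hj)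

/-- Strong induction is needed, since the averaged Hessian involves all earlier iterates. -/
theorem IsRun.measurable_iterate (hrun : IsRun μ F c P Q A τ β χ ξ ζ ψ R α w₀ w)
    (hF : Measurable (Function.uncurry F)) (hd : ∀ s, TwiceDifferentiable fun x => F x s)
    (hc : ContDiff ℝ 2 c) (t : ℕ) : Measurable[history ξ ζ ψ τ t] (w t) := by
  induction t using Nat.strong_induction_on with
  | _ t ih =>
    cases t with
    | zero =>
      rw [show w 0 = fun _ => w₀ from funext hrun.init]
      exact measurable_const
    | succ t =>
      have hw : ∀ i ≤ t, Measurable[history ξ ζ ψ τ t] (w i) := fun i hi =>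
        (ih i (Nat.lt_succ_of_le hi)).mono (history_mono ξ ζ ψ τ hi) le_rfl
      have hz := hrun.measurable_direction_of_iterate hF hd hc hw
      have hwt := (hw t le_rfl).mono (history_mono ξ ζ ψ τ t.le_succ) le_rfl
      rw [show w (t + 1) = _ from funext (hrun.update t)]
      exact hwt.add ((hrun.step_measurable t).smul hz)

/-- A sketch variable is independent of all that enters the solver error before it is used.
`indep_sup_left` first joins the sample to the earlier sketches, then the past. -/
theorem IsRun.indep_sketchVar [IsProbabilityMeasure μ]
    (hrun : IsRun μ F c P Q A τ β χ ξ ζ ψ R α w₀ w) (t : ℕ) (j : Fin τ) :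
    Indep (history ξ ζ ψ τ t ⊔ (MeasurableSpace.comap (ξ t) inferInstance ⊔
      ⨆ i ∈ {i : Fin τ | i < j}, MeasurableSpace.comap (ζ t i) inferInstance))
      (MeasurableSpace.comap (ζ t j) inferInstance) μ := by
  have hζ : ∀ i : Fin τ, MeasurableSpace.comap (ζ t i) inferInstance ≤
      MeasurableSpace.comap (fun ω (j : Fin τ) => ζ t j ω) inferInstance := fun i => by
    have h : Measurable[MeasurableSpace.comap (fun ω (j : Fin τ) => ζ t j ω) inferInstance]
        (ζ t i) :=
      (measurable_pi_apply i).comp (comap_measurable fun ω (j : Fin τ) => ζ t j ω)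
    exact h.comap_le
  have hle : ∀ i : Fin τ, MeasurableSpace.comap (ζ t i) inferInstance ≤ ‹MeasurableSpace Ω› :=
    fun i => (hrun.measurable_sketchVar t i).comap_le
  have hpast : (⨆ i ∈ {i : Fin τ | i < j}, MeasurableSpace.comap (ζ t i) inferInstance) ≤
      MeasurableSpace.comap (fun ω (j : Fin τ) => ζ t j ω) inferInstance :=
    iSup₂_le fun i _ => hζ i
  have hpast_le : (⨆ i ∈ {i : Fin τ | i < j}, MeasurableSpace.comap (ζ t i) inferInstance) ≤
      ‹MeasurableSpace Ω› := iSup₂_le fun i _ => hle i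
  have hξ := (hrun.measurable_sample t).comap_le
  have h1 : Indep (⨆ i ∈ {i : Fin τ | i < j}, MeasurableSpace.comap (ζ t i) inferInstance)
      (MeasurableSpace.comap (ζ t j) inferInstance) μ := by
    have h := indep_iSup_of_disjoint (μ := μ)
      (m := fun i : Fin τ => MeasurableSpace.comap (ζ t i) inferInstance) hle
      (hrun.indep_sketch t) (S := {i : Fin τ | i < j}) (T := {j}) (by simp)
    simpa using h
  have h2 := indep_sup_left hξ hpast_le (hle j)
    (indep_of_indep_of_le_right (hrun.indep_sample_sketch t) (sup_le hpast (hζ j))) h1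
  have hpair : MeasurableSpace.comap (ξ t) inferInstance ⊔
      MeasurableSpace.comap (fun ω (j : Fin τ) => ζ t j ω) inferInstance ≤
      MeasurableSpace.comap (fun ω => (ξ t ω, fun j : Fin τ => ζ t j ω)) inferInstance := by
    have h : Measurable[MeasurableSpace.comap (fun ω => (ξ t ω, fun j : Fin τ => ζ t j ω))
        inferInstance] (fun ω => (ξ t ω, fun j : Fin τ => ζ t j ω)) := comap_measurable _
    have h3 := (measurable_fst.comp h).comap_le
    have h4 := (measurable_snd.comp h).comap_le
    exact sup_le h3 h4
  refine indep_sup_left (hrun.history_le t) (sup_le hξ hpast_le) (hle j)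
    (indep_of_indep_of_le_right (hrun.indep_history t) ?_) h2
  exact (sup_le (sup_le_sup_left hpast _) (le_sup_of_le_right (hζ j))).trans hpair

/-- The conditional mean of the error of the sketched Newton step is small. -/
theorem IsRun.norm_condExp_residual_le [IsProbabilityMeasure μ]
    (hrun : IsRun μ F c P Q A τ β χ ξ ζ ψ R α w₀ w)
    (hF : Measurable (Function.uncurry F)) (hd : ∀ s, TwiceDifferentiable fun x => F x s)
    (hc : ContDiff ℝ 2 c) (t : ℕ)
    (hint : Integrable (fun ω =>
      pinv (newtonMat F c (fun i => w i ω) (fun i => ξ i ω) (fun i => R i ω) t)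
        (lagGradEst F c (w t ω) (ξ t ω))) μ) {γ : ℝ}
    (hγ : ∀ j < τ, ∀ᵐ ω ∂μ, γ • ContinuousLinearMap.id ℝ (PD d m) ≤
      (μ[fun ω => sketchGain
            (newtonMat F c (fun i => w i ω) (fun i => ξ i ω) (fun i => R i ω) t) (A (ζ t j ω)) ∘L
          newtonMat F c (fun i => w i ω) (fun i => ξ i ω) (fun i => R i ω) t |
        history ξ ζ ψ τ t]) ω) :
    ∀ᵐ ω ∂μ, ‖(μ[fun ω => sketchResidual
          (newtonMat F c (fun i => w i ω) (fun i => ξ i ω) (fun i => R i ω) t)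
          (lagGradEst F c (w t ω) (ξ t ω)) (fun j => A (ζ t j ω)) τ | history ξ ζ ψ τ t]) ω‖ ≤
      max (1 - γ) 0 ^ τ * ‖(μ[fun ω =>
        pinv (newtonMat F c (fun i => w i ω) (fun i => ξ i ω) (fun i => R i ω) t)
          (lagGradEst F c (w t ω) (ξ t ω)) | history ξ ζ ψ τ t]) ω‖ := by
  have hw := hrun.measurable_iterate hF hd hc
  have hK := hrun.measurable_newtonMat_of_iterate hF hd hc (t := t) fun i hi =>
    (hw i).mono (history_mono ξ ζ ψ τ hi) le_rfl
  have hKs : ∀ ω, IsSelfAdjoint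
      (newtonMat F c (fun i => w i ω) (fun i => ξ i ω) (fun i => R i ω) t) := fun ω =>
    isSelfAdjoint_newtonMat hd hc _ _ (fun t => hrun.reg_symm t ω) t
  obtain ⟨K, hKeq⟩ : ∃ K : Ω → PD d m →L[ℝ] PD d m, K = fun ω =>
    newtonMat F c (fun i => w i ω) (fun i => ξ i ω) (fun i => R i ω) t := ⟨_, rfl⟩
  have hKω : ∀ ω, newtonMat F c (fun i => w i ω) (fun i => ξ i ω) (fun i => R i ω) t = K ω :=
    fun ω => by rw [hKeq]
  simp_rw [hKω] at hint hγ hKs hK ⊢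
  -- What is known just before sketch `j` is drawn: the past, the sample and the sketches with
  -- smaller index.
  let 𝒢 : ℕ → MeasurableSpace Ω := fun j => history ξ ζ ψ τ t ⊔
    (MeasurableSpace.comap (ξ t) inferInstance ⊔
      ⨆ i ∈ {i : Fin τ | i.1 < j}, MeasurableSpace.comap (ζ t i) inferInstance)
  have h𝒢 : ∀ j, 𝒢 j ≤ ‹MeasurableSpace Ω› := fun j =>
    sup_le (hrun.history_le t) (sup_le (hrun.measurable_sample t).comap_le
      (iSup₂_le fun i _ => (hrun.measurable_sketchVar t i).comap_le))
  have hℱ : ∀ j, history ξ ζ ψ τ t ≤ 𝒢 j := fun j => le_sup_left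
  refine norm_condExp_sketchResidual_le (τ := τ) hℱ h𝒢 hrun.measurable_sketch
    (hrun.measurable_sketchVar t) (fun j hj => hrun.indep_sketchVar t ⟨j, hj⟩) hK hKs
    (fun j hj => ?_) hint hγ τ le_rfl
  have h1 : Measurable[𝒢 j] (ξ t) :=
    Measurable.of_comap_le (le_sup_of_le_right le_sup_left)
  have h2 : Measurable[𝒢 j] fun ω => (w t ω, ξ t ω) := ((hw t).mono (hℱ j) le_rfl).prodMk h1
  have h3 := (measurable_lagGradEst hF hd hc).comp h2
  refine measurable_sketchResidual (hK.mono (hℱ j) le_rfl) h3 fun i hi => ?_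
  refine hrun.measurable_sketch.comp (Measurable.of_comap_le ?_)
  refine le_sup_of_le_right (le_sup_of_le_right ?_)
  exact le_iSup₂_of_le (f := fun (i : Fin τ) (_ : i ∈ {i : Fin τ | i.1 < j}) =>
    MeasurableSpace.comap (ζ t i) inferInstance) ⟨i, hi.trans hj⟩ hi le_rfl

end Run

/-- For `γ ≥ 1` the base is zero and `τ > 0` makes the power vanish. At `γ = 1` the quotient in `h`
is zero by convention, so `h` is then no condition. -/
theorem max_one_sub_pow_le {γ N : ℝ} {τ : ℕ} (hτ : 0 < τ) (h : N / Real.log (1 / (1 - γ)) ≤ τ)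
    (hγ : 0 < γ) : max (1 - γ) 0 ^ τ ≤ Real.exp (-N) := by
  rcases le_or_gt 1 γ with h1 | h1
  · rw [max_eq_right (by linarith), zero_pow hτ.ne']
    exact (Real.exp_pos _).le
  · have h2 : 0 < 1 - γ := by linarith
    rw [max_eq_left h2.le]
    have h3 : Real.log (1 / (1 - γ)) = -Real.log (1 - γ) := by rw [one_div, Real.log_inv]
    have h4 : Real.log (1 - γ) < 0 := Real.log_neg h2 (by linarith)
    rw [h3, div_le_iff₀ (by linarith)] at h
    rw [← Real.exp_log h2, ← Real.exp_nat_mul]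
    exact Real.exp_le_exp.2 (by linarith)

/-- Taking `γ' = s ^ 2`, this matches the required number of sketching steps with the tolerance of
`descent_inequality`; `4096 = 2 ^ 12`. -/
theorem exp_neg_log_threshold {κ γ γ' : ℝ} (hκ : 0 < κ) (hγ : 0 < γ) (hγ' : 0 < γ') :
    Real.exp (-(12 * Real.log 2 + 5 * Real.log κ + 2 * Real.log (1 / (γ * γ')))) =
      γ ^ 2 * γ' ^ 2 / (4096 * κ ^ 5) := by
  have h1 : Real.log (1 / (γ * γ')) = -(Real.log γ + Real.log γ') := by
    rw [one_div, Real.log_inv, Real.log_mul hγ.ne' hγ'.ne']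
  have h2 : Real.log (γ ^ 2 * γ' ^ 2 / (4096 * κ ^ 5)) =
      2 * Real.log γ + 2 * Real.log γ' - (12 * Real.log 2 + 5 * Real.log κ) := by
    rw [Real.log_div (by positivity) (by positivity), Real.log_mul (by positivity) (by positivity),
      Real.log_mul (by norm_num) (by positivity), show (4096 : ℝ) = 2 ^ 12 by norm_num,
      Real.log_pow, Real.log_pow, Real.log_pow, Real.log_pow]
    push_cast
    ring
  have e : -(12 * Real.log 2 + 5 * Real.log κ + 2 * Real.log (1 / (γ * γ'))) =
      Real.log (γ ^ 2 * γ' ^ 2 / (4096 * κ ^ 5)) := by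
    rw [h1, h2]
    ring
  rw [e, Real.exp_log (by positivity)]

/-! ### Mean and second moment of an inexact Newton direction. -/

section InexactDirection

variable {Ω E : Type*} {ℱ m₀ : MeasurableSpace Ω} {μ : Measure Ω} [NormedAddCommGroup E]
  [NormedSpace ℝ E]

theorem integrable_clm_apply_of_norm_le {T : Ω → E →L[ℝ] E} {b : Ω → E} {M : ℝ}
    (hT : AEStronglyMeasurable T μ) (hTM : ∀ᵐ ω ∂μ, ‖T ω‖ ≤ M) (hb : Integrable b μ) :
    Integrable (fun ω => T ω (b ω)) μ := by
  refine (hb.norm.const_mul M).mono' ?_ ?_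
  · have h : Continuous fun p : (E →L[ℝ] E) × E => p.1 p.2 :=
      continuous_fst.clm_apply continuous_snd
    exact h.comp_aestronglyMeasurable (hT.prodMk hb.1)
  · filter_upwards [hTM] with ω h
    exact (T ω).le_of_opNorm_le h _

/-- Moments of the direction `r - T b`, where `T` is the inverse of the Newton matrix, `b = g + n`
is an unbiased estimate of `g`, and `r` is the error of the inner solver. -/
theorem inexact_direction_bounds [IsProbabilityMeasure μ] [CompleteSpace E] (hℱ : ℱ ≤ m₀) {T : Ω → E →L[ℝ] E} {b g n r z : Ω → E}
    {M U V ε : ℝ} (hM : 0 ≤ M)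
    (hT : StronglyMeasurable[ℱ] T) (hTM : ∀ᵐ ω ∂μ, ‖T ω‖ ≤ M) (hb : Integrable b μ)
    (hbg : μ[b | ℱ] =ᵐ[μ] g) (hbn : ∀ ω, b ω = n ω + g ω) (hgU : ∀ᵐ ω ∂μ, ‖g ω‖ ≤ U)
    (hn : Integrable (fun ω => ‖n ω‖ ^ 2) μ) (hnV : ∫ ω, ‖n ω‖ ^ 2 ∂μ ≤ V)
    (hr : AEStronglyMeasurable r μ) (hrb : ∀ ω, ‖r ω‖ ≤ ‖T ω (b ω)‖)
    (hrε : ∀ᵐ ω ∂μ, ‖(μ[r | ℱ]) ω‖ ≤ ε * ‖(μ[fun ω => T ω (b ω) | ℱ]) ω‖)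
    (hz : z =ᵐ[μ] fun ω => r ω - T ω (b ω)) :
    MemLp z 2 μ ∧ ∫ ω, ‖z ω‖ ^ 2 ∂μ ≤ 8 * M ^ 2 * (V + U ^ 2) ∧
      ∀ᵐ ω ∂μ, ‖(μ[z | ℱ]) ω - -(T ω (g ω))‖ ≤ ε * ‖-(T ω (g ω))‖ := by
  have hTb := integrable_clm_apply_of_norm_le (hT.mono hℱ).aestronglyMeasurable hTM hb
  have hri : Integrable r μ := hTb.norm.mono' hr (ae_of_all _ hrb)
  have hzm : AEStronglyMeasurable z μ := (hr.sub hTb.1).congr hz.symm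
  -- Pathwise the error `r` is no longer than `T b`, so `‖z‖ ≤ 2 M (‖n‖ + U)`; squaring gives the 8.
  have hbd : ∀ᵐ ω ∂μ, ‖z ω‖ ^ 2 ≤ 8 * M ^ 2 * (‖n ω‖ ^ 2 + U ^ 2) := by
    filter_upwards [hz, hTM, hgU] with ω h1 h2 h3
    have h4 : ‖z ω‖ ≤ 2 * (M * (‖n ω‖ + U)) := by
      rw [h1]
      have h5 := norm_sub_le (r ω) (T ω (b ω))
      have h6 := hrb ω
      have h7 := (T ω).le_of_opNorm_le h2 (b ω)
      have h8 : ‖b ω‖ ≤ ‖n ω‖ + U := by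
        rw [hbn]; exact (norm_add_le _ _).trans (by gcongr)
      have h9 := mul_le_mul_of_nonneg_left h8 hM
      linarith
    calc ‖z ω‖ ^ 2 ≤ (2 * (M * (‖n ω‖ + U))) ^ 2 := by gcongr
      _ = 4 * M ^ 2 * (‖n ω‖ + U) ^ 2 := by ring
      _ ≤ 4 * M ^ 2 * (2 * (‖n ω‖ ^ 2 + U ^ 2)) := by gcongr; exact add_sq_le
      _ = _ := by ring
  have hbi : Integrable (fun ω => 8 * M ^ 2 * (‖n ω‖ ^ 2 + U ^ 2)) μ :=
    (hn.add (integrable_const _)).const_mul _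
  have hzi : Integrable (fun ω => ‖z ω‖ ^ 2) μ := by
    refine hbi.mono' (hzm.norm.pow 2) ?_
    filter_upwards [hbd] with ω h
    rwa [Real.norm_of_nonneg (by positivity)]
  refine ⟨(memLp_two_iff_integrable_sq_norm hzm).2 hzi, ?_, ?_⟩
  · refine (integral_mono_ae hzi hbi hbd).trans ?_
    rw [integral_const_mul, integral_add hn (integrable_const _)]
    simp only [integral_const, probReal_univ, one_smul]
    gcongr
  -- As `T` is known and `b` unbiased, `T b` has conditional mean `T g`. Hence the deviation of the
  -- mean of `z` from `-T g` is the mean of `r`.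
  · have h1 := condExp_congr_ae (m := ℱ) hz
    have h2 := condExp_sub hri hTb ℱ
    have h3 := condExp_apply_of_stronglyMeasurable hT hTb hb
    filter_upwards [h1, h2, h3, hrε, hbg] with ω h4 h5 h6 h7 h8
    have h9 : (μ[fun ω => r ω - T ω (b ω) | ℱ]) ω =
        (μ[r | ℱ]) ω - (μ[fun ω => T ω (b ω) | ℱ]) ω := h5
    rw [h6, h8] at h7 h9
    rw [h4, h9, sub_neg_eq_add, sub_add_cancel, norm_neg]
    exact h7

end InexactDirection

/-! ### The sketched Newton direction along a run. -/

section Run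

variable {Ω S Z Y : Type*} [MeasurableSpace S] [MeasurableSpace Z] [MeasurableSpace Y]
  [MeasurableSpace Ω] {d m : ℕ} {μ : Measure Ω} {F : Vec d → S → ℝ} {f : Vec d → ℝ}
  {c : Vec d → Vec m}
  {P : Measure S} {Q : Measure Z} {A : Z → Sketch d m} {τ : ℕ} {β χ : ℕ → ℝ}
  {ξ : ℕ → Ω → S} {ζ : ℕ → ℕ → Ω → Z} {ψ : ℕ → Ω → Y} {R : ℕ → Ω → Vec d →L[ℝ] Vec d}
  {α : ℕ → Ω → ℝ} {w₀ : PD d m} {w : ℕ → Ω → PD d m}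

omit [MeasurableSpace S] in
theorem lagGradEst_eq (hf : ContDiff ℝ 2 f) (hc : ContDiff ℝ 2 c) (p : PD d m) (s : S) :
    lagGradEst F c p s =
      WithLp.toLp 2 (sGrad F p.fst s - ∇ f p.fst, 0) + ∇ (lagrangian f c) p := by
  rw [gradient_lagrangian (hf.differentiable two_ne_zero) (hc.differentiable two_ne_zero)]
  refine congrArg (WithLp.toLp 2) (Prod.ext ?_ (zero_add _).symm)
  change _ = sGrad F p.fst s - ∇ f p.fst + (∇ f p.fst + (jac c p.fst).adjoint p.snd)
  rw [← add_assoc, sub_add_cancel]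

theorem norm_toLp_zero_right (x : Vec d) : ‖(WithLp.toLp 2 (x, (0 : Vec m)) : PD d m)‖ = ‖x‖ := by
  have := norm_pd_sq (WithLp.toLp 2 (x, (0 : Vec m)) : PD d m)
  simp only [WithLp.toLp_fst, WithLp.toLp_snd, norm_zero] at this
  exact (pow_left_inj₀ (norm_nonneg _) (norm_nonneg _) two_ne_zero).1 (by linarith)

/-- The estimate of the gradient of the Lagrangian is conditionally unbiased. -/
theorem IsRun.condExp_lagGradEst [IsProbabilityMeasure μ]
    (hrun : IsRun μ F c P Q A τ β χ ξ ζ ψ R α w₀ w)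
    (hF : Measurable (Function.uncurry F)) (hd : ∀ s, TwiceDifferentiable fun x => F x s)
    (hf : ContDiff ℝ 2 f) (hc : ContDiff ℝ 2 c) (t : ℕ) {U : ℝ}
    (hU : ∀ᵐ ω ∂μ, ‖∇ (lagrangian f c) (w t ω)‖ ≤ U) (hU' : ∀ᵐ ω ∂μ, ‖∇ f (w t ω).fst‖ ≤ U)
    (hint : Integrable (fun ω => sGrad F (w t ω).fst (ξ t ω)) μ)
    (hmean : μ[fun ω => sGrad F (w t ω).fst (ξ t ω) | history ξ ζ ψ τ t]
      =ᵐ[μ] fun ω => ∇ f (w t ω).fst) :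
    Integrable (fun ω => lagGradEst F c (w t ω) (ξ t ω)) μ ∧
      μ[fun ω => lagGradEst F c (w t ω) (ξ t ω) | history ξ ζ ψ τ t]
        =ᵐ[μ] fun ω => ∇ (lagrangian f c) (w t ω) := by
  have hle := hrun.history_le t
  have hw := hrun.measurable_iterate hF hd hc t
  have hgm : StronglyMeasurable[history ξ ζ ψ τ t] fun ω => ∇ (lagrangian f c) (w t ω) := by
    have h := (contDiff_gradient (contDiff_lagrangian hf hc)).continuous.measurable.comp hw
    exact h.stronglyMeasurable
  have hfm : StronglyMeasurable[history ξ ζ ψ τ t] fun ω => ∇ f (w t ω).fst := by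
    have h := ((contDiff_gradient hf).continuous.comp
      (WithLp.fstL 2 ℝ (Vec d) (Vec m)).continuous).measurable.comp hw
    exact h.stronglyMeasurable
  have hgi := Integrable.of_bound (hgm.mono hle).aestronglyMeasurable U hU
  have hfi := Integrable.of_bound (hfm.mono hle).aestronglyMeasurable U hU'
  let ι : Vec d →L[ℝ] PD d m :=
    (WithLp.prodContinuousLinearEquiv 2 ℝ (Vec d) (Vec m)).symm.toContinuousLinearMap ∘L
      ContinuousLinearMap.inl ℝ (Vec d) (Vec m)
  have hni : Integrable (fun ω => sGrad F (w t ω).fst (ξ t ω) - ∇ f (w t ω).fst) μ := hint.sub hfi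
  have hιi : Integrable (fun ω => ι (sGrad F (w t ω).fst (ξ t ω) - ∇ f (w t ω).fst)) μ :=
    ι.integrable_comp hni
  have hb : (fun ω => lagGradEst F c (w t ω) (ξ t ω)) = (fun ω =>
      ι (sGrad F (w t ω).fst (ξ t ω) - ∇ f (w t ω).fst)) + fun ω => ∇ (lagrangian f c) (w t ω) :=
    funext fun ω => lagGradEst_eq hf hc _ _
  rw [hb]
  refine ⟨hιi.add hgi, ?_⟩
  have h1 := condExp_add hιi hgi (history ξ ζ ψ τ t)
  rw [condExp_of_stronglyMeasurable hle hgm hgi] at h1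
  have h2 := ι.comp_condExp_comm (m := history ξ ζ ψ τ t) hni
  have h3 := condExp_sub hint hfi (history ξ ζ ψ τ t)
  rw [condExp_of_stronglyMeasurable hle hfm hfi] at h3
  filter_upwards [h1, h2, h3, hmean] with ω h4 h5 h6 h7
  have h8 : (μ[fun ω => sGrad F (w t ω).fst (ξ t ω) - ∇ f (w t ω).fst | history ξ ζ ψ τ t]) ω = 0 := by
    refine h6.trans ?_
    rw [Pi.sub_apply, h7, sub_self]
  have h9 : ι ((μ[fun ω => sGrad F (w t ω).fst (ξ t ω) - ∇ f (w t ω).fst |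
      history ξ ζ ψ τ t]) ω) = (μ[fun ω => ι (sGrad F (w t ω).fst (ξ t ω) - ∇ f (w t ω).fst) |
      history ξ ζ ψ τ t]) ω := h5
  rw [h8, map_zero] at h9
  rw [h4, Pi.add_apply, ← h9, zero_add]

/-- Moments of the sketched Newton direction. -/
theorem IsRun.direction_bounds [IsProbabilityMeasure μ]
    (hrun : IsRun μ F c P Q A τ β χ ξ ζ ψ R α w₀ w)
    (hF : Measurable (Function.uncurry F)) (hd : ∀ s, TwiceDifferentiable fun x => F x s)
    (hf : ContDiff ℝ 2 f) (hc : ContDiff ℝ 2 c) (t : ℕ) {U V M : ℝ} (hM : 0 ≤ M)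
    (hKM : ∀ᵐ ω ∂μ, ∀ z, ‖z‖ ≤
      M * ‖newtonMat F c (fun i => w i ω) (fun i => ξ i ω) (fun i => R i ω) t z‖)
    (hU : ∀ᵐ ω ∂μ, ‖∇ (lagrangian f c) (w t ω)‖ ≤ U) (hU' : ∀ᵐ ω ∂μ, ‖∇ f (w t ω).fst‖ ≤ U)
    (hint : Integrable (fun ω => sGrad F (w t ω).fst (ξ t ω)) μ)
    (hmean : μ[fun ω => sGrad F (w t ω).fst (ξ t ω) | history ξ ζ ψ τ t]
      =ᵐ[μ] fun ω => ∇ f (w t ω).fst)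
    (hsq : Integrable (fun ω => ‖sGrad F (w t ω).fst (ξ t ω) - ∇ f (w t ω).fst‖ ^ 2) μ)
    (hV : ∫ ω, ‖sGrad F (w t ω).fst (ξ t ω) - ∇ f (w t ω).fst‖ ^ 2 ∂μ ≤ V) {γ : ℝ}
    (hγ : ∀ j < τ, ∀ᵐ ω ∂μ, γ • ContinuousLinearMap.id ℝ (PD d m) ≤
      (μ[fun ω => sketchGain
            (newtonMat F c (fun i => w i ω) (fun i => ξ i ω) (fun i => R i ω) t) (A (ζ t j ω)) ∘L
          newtonMat F c (fun i => w i ω) (fun i => ξ i ω) (fun i => R i ω) t |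
        history ξ ζ ψ τ t]) ω) {z : Ω → PD d m}
    (hz : ∀ ω, z ω =
      sketchSolve (newtonMat F c (fun i => w i ω) (fun i => ξ i ω) (fun i => R i ω) t)
        (lagGradEst F c (w t ω) (ξ t ω)) (fun j => A (ζ t j ω)) τ) :
    MemLp z 2 μ ∧ ∫ ω, ‖z ω‖ ^ 2 ∂μ ≤ 8 * M ^ 2 * (V + U ^ 2) ∧
      ∀ᵐ ω ∂μ, ∃ v, newtonMat F c (fun i => w i ω) (fun i => ξ i ω) (fun i => R i ω) t v =
          -∇ (lagrangian f c) (w t ω) ∧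
        ‖(μ[z | history ξ ζ ψ τ t]) ω - v‖ ≤ max (1 - γ) 0 ^ τ * ‖v‖ := by
  have hle := hrun.history_le t
  obtain ⟨hbi, hbg⟩ := hrun.condExp_lagGradEst hF hd hf hc t hU hU' hint hmean
  have hw := hrun.measurable_iterate hF hd hc
  have hK := hrun.measurable_newtonMat_of_iterate hF hd hc (t := t) fun i hi =>
    (hw i).mono (history_mono ξ ζ ψ τ hi) le_rfl
  have hKs : ∀ ω, IsSelfAdjoint
      (newtonMat F c (fun i => w i ω) (fun i => ξ i ω) (fun i => R i ω) t) := fun ω =>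
    isSelfAdjoint_newtonMat hd hc _ _ (fun t => hrun.reg_symm t ω) t
  have hres := hrun.norm_condExp_residual_le hF hd hc t (γ := γ)
  obtain ⟨K, hKeq⟩ : ∃ K : Ω → PD d m →L[ℝ] PD d m, K = fun ω =>
    newtonMat F c (fun i => w i ω) (fun i => ξ i ω) (fun i => R i ω) t := ⟨_, rfl⟩
  have hKω : ∀ ω, newtonMat F c (fun i => w i ω) (fun i => ξ i ω) (fun i => R i ω) t = K ω :=
    fun ω => by rw [hKeq]
  simp_rw [hKω] at hKM hγ hz hK hKs hres ⊢
  -- Almost surely `K` is invertible, and its pseudoinverse is the inverse; only there do the solver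
  -- iterates equal the error minus `K⁻¹ b`.
  have hinj : ∀ᵐ ω ∂μ, Function.Injective (K ω) := by
    filter_upwards [hKM] with ω h
    refine (injective_iff_map_eq_zero _).2 fun v hv => ?_
    have h1 := h v
    rw [hv, norm_zero, mul_zero] at h1
    exact norm_le_zero_iff.1 h1
  have hpm : Measurable[history ξ ζ ψ τ t] fun ω => pinv (K ω) := measurable_pinv.comp hK
  have hpM : ∀ᵐ ω ∂μ, ‖pinv (K ω)‖ ≤ M := by
    filter_upwards [hKM, hinj] with ω h1 h2
    refine ContinuousLinearMap.opNorm_le_bound _ hM fun v => ?_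
    have h3 := h1 (pinv (K ω) v)
    rwa [self_apply_pinv h2] at h3
  have hpi := integrable_clm_apply_of_norm_le (hpm.mono hle le_rfl).aestronglyMeasurable hpM hbi
  have hzr : z =ᵐ[μ] fun ω => sketchResidual (K ω) (lagGradEst F c (w t ω) (ξ t ω))
      (fun j => A (ζ t j ω)) τ - pinv (K ω) (lagGradEst F c (w t ω) (ξ t ω)) := by
    filter_upwards [hinj] with ω h
    rw [hz, sketchSolve_eq h]
  have hbm : Measurable fun ω => lagGradEst F c (w t ω) (ξ t ω) :=
    (measurable_lagGradEst hF hd hc).comp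
      (((hw t).mono hle le_rfl).prodMk (hrun.measurable_sample t))
  have hrm : Measurable fun ω => sketchResidual (K ω) (lagGradEst F c (w t ω) (ξ t ω))
      (fun j => A (ζ t j ω)) τ :=
    measurable_sketchResidual (hK.mono hle le_rfl) hbm fun j _ =>
      hrun.measurable_sketch.comp (hrun.measurable_sketchVar t j)
  obtain ⟨h1, h2, h3⟩ := inexact_direction_bounds hle hM hpm.stronglyMeasurable hpM hbi hbg
    (fun ω => lagGradEst_eq hf hc _ _) hU (by simpa only [norm_toLp_zero_right] using hsq)
    (by simpa only [norm_toLp_zero_right] using hV) hrm.aestronglyMeasurable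
    (fun ω => norm_sketchResidual_le (hKs ω) _ _ _) (hres hpi hγ) hzr
  refine ⟨h1, h2, ?_⟩
  filter_upwards [h3, hinj] with ω h4 h5
  refine ⟨-(pinv (K ω) (∇ (lagrangian f c) (w t ω))), ?_, ?_⟩
  · rw [map_neg, self_apply_pinv h5]
  · with_reducible_and_instances exact h4

end Run

/-! ### Continuity of the merit function and of its gradient formula. -/

section MeritContinuity

variable {d m : ℕ} {f : Vec d → ℝ} {c : Vec d → Vec m}

theorem continuous_toLp_zero_snd :
    Continuous fun p : PD d m => (WithLp.toLp 2 ((0 : Vec d), p.snd) : PD d m) :=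
  (WithLp.prodContinuousLinearEquiv 2 ℝ (Vec d) (Vec m)).symm.continuous.comp
    (continuous_const.prodMk (WithLp.sndL 2 ℝ (Vec d) (Vec m)).continuous)

theorem continuous_add_smul_adjoint {E : Type*} [NormedAddCommGroup E] [InnerProductSpace ℝ E]
    [CompleteSpace E] (ρ ν : ℝ) {h : E → E} (hh : Continuous h) :
    Continuous fun p : (E →L[ℝ] E) × E =>
      p.2 + ρ • p.1.adjoint (h p.2) + ν • p.1.adjoint p.2 := by
  have h1 : Continuous fun p : (E →L[ℝ] E) × E => p.1.adjoint :=
    (ContinuousLinearMap.adjoint (𝕜 := ℝ) (E := E) (F := E)).continuous.comp continuous_fst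
  have h2 := h1.clm_apply (hh.comp continuous_snd)
  have h3 := h1.clm_apply continuous_snd
  exact (continuous_snd.add (h2.const_smul ρ)).add (h3.const_smul ν)

theorem continuous_meritGrad (ρ ν : ℝ) :
    Continuous fun p : (PD d m →L[ℝ] PD d m) × PD d m => meritGrad ρ ν p.1 p.2 := by
  have h := continuous_add_smul_adjoint (E := PD d m) ρ ν continuous_toLp_zero_snd
  refine h.congr fun p => ?_
  rw [meritGrad]

theorem continuous_merit (hf : ContDiff ℝ 2 f) (hc : ContDiff ℝ 2 c) (ρ ν : ℝ) :
    Continuous (merit f c ρ ν) := by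
  have hL := contDiff_lagrangian hf hc
  have hg : Continuous (∇ (lagrangian f c)) := (contDiff_gradient hL).continuous
  have hs : Continuous fun p => (∇ (lagrangian f c) p).snd :=
    (WithLp.sndL 2 ℝ (Vec d) (Vec m)).continuous.comp hg
  exact (hL.continuous.add ((hs.norm.pow 2).const_mul _)).add ((hg.norm.pow 2).const_mul _)

end MeritContinuity

/-- Almost sure convergence of the KKT residual, for an objective `f` that need not be given as an
expectation: only the conditional means of the gradient estimates matter. -/
theorem IsRun.tendsto_kkt_residual
    {Ω S Z Y : Type*} [MeasurableSpace Ω] [MeasurableSpace S] [MeasurableSpace Z]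
    [MeasurableSpace Y] {μ : Measure Ω} [IsProbabilityMeasure μ] {d m : ℕ}
    {F : Vec d → S → ℝ} {f : Vec d → ℝ} {c : Vec d → Vec m} {P : Measure S}
    {Q : Measure Z} {A : Z → Sketch d m} {τ : ℕ} {β χ : ℕ → ℝ}
    {ξ : ℕ → Ω → S} {ζ : ℕ → ℕ → Ω → Z} {ψ : ℕ → Ω → Y} {R : ℕ → Ω → Vec d →L[ℝ] Vec d}
    {α : ℕ → Ω → ℝ} {w₀ : PD d m} {w : ℕ → Ω → PD d m}
    (hrun : IsRun μ F c P Q A τ β χ ξ ζ ψ R α w₀ w)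
    (hF_meas : Measurable (Function.uncurry F))
    (hF_diff : ∀ s, TwiceDifferentiable (fun x => F x s))
    (hf : ContDiff ℝ 2 f) (hc : ContDiff ℝ 2 c)
    (hτ_pos : 0 < τ) (hβ_pos : ∀ t, 0 < β t) (hχ_nonneg : ∀ t, 0 ≤ χ t)
    {X : Set (Vec d)} {Λ : Set (Vec m)}
    (hX_conv : Convex ℝ X) (hX_comp : IsCompact X) (hΛ_conv : Convex ℝ Λ) (hΛ_comp : IsCompact Λ)
    (hw_mem : ∀ᵐ ω ∂μ, ∀ t, (w t ω).fst ∈ X ∧ (w t ω).snd ∈ Λ) {ΥL Υu : ℝ}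
    (hlip_hess : ∀ p q : PD d m, p.fst ∈ X → p.snd ∈ Λ → q.fst ∈ X → q.snd ∈ Λ →
      ‖hess (lagrangian f c) p - hess (lagrangian f c) q‖ ≤ ΥL * ‖p - q‖)
    (hΥu : 1 ≤ Υu)
    (hbound : ∀ p : PD d m, p.fst ∈ X → p.snd ∈ Λ → ‖hess (lagrangian f c) p‖ ≤ Υu ∧
      ‖∇ (lagrangian f c) p‖ ≤ Υu ∧ ‖∇ f p.fst‖ ≤ Υu)
    {γG : ℝ} (hγG : 0 < γG) (hγG_le : γG ≤ 1)
    (hG : ∀ᵐ ω ∂μ, ∀ t, γG • ContinuousLinearMap.id ℝ (Vec m) ≤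
      jac c (w t ω).fst ∘L (jac c (w t ω).fst).adjoint)
    {ΥB γRH : ℝ} (hΥB : 1 ≤ ΥB) (hγRH : 0 < γRH) (hγRH_le : γRH ≤ 1)
    (hB : ∀ᵐ ω ∂μ, ∀ t,
      ‖modHess F c (fun i => w i ω) (fun i => ξ i ω) (fun i => R i ω) t‖ ≤ ΥB ∧
      ∀ v : Vec d, jac c (w t ω).fst v = 0 → γRH * ‖v‖ ^ 2 ≤
        inner ℝ v (modHess F c (fun i => w i ω) (fun i => ξ i ω) (fun i => R i ω) t v))
    {Υm : ℝ} (hΥm : 0 ≤ Υm)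
    (hgrad_int : ∀ t, Integrable (fun ω => sGrad F (w t ω).fst (ξ t ω)) μ)
    (hgrad_mean : ∀ t, μ[fun ω => sGrad F (w t ω).fst (ξ t ω) | history ξ ζ ψ τ t]
      =ᵐ[μ] fun ω => ∇ f (w t ω).fst)
    (hgrad_sq_int : ∀ t, Integrable
      (fun ω => ‖sGrad F (w t ω).fst (ξ t ω) - ∇ f (w t ω).fst‖ ^ 2) μ)
    (hgrad_sq : ∀ t, ∀ᵐ ω ∂μ,
      (μ[fun ω => ‖sGrad F (w t ω).fst (ξ t ω) - ∇ f (w t ω).fst‖ ^ 2 |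
        history ξ ζ ψ τ t]) ω ≤ Υm)
    {γS : ℝ} (hγS : 0 < γS)
    (hsketch : ∀ t, ∀ j < τ, ∀ᵐ ω ∂μ, γS • ContinuousLinearMap.id ℝ (PD d m) ≤
      (μ[fun ω => sketchGain
            (newtonMat F c (fun i => w i ω) (fun i => ξ i ω) (fun i => R i ω) t) (A (ζ t j ω)) ∘L
          newtonMat F c (fun i => w i ω) (fun i => ξ i ω) (fun i => R i ω) t |
        history ξ ζ ψ τ t]) ω)
    (hτ : (12 * Real.log 2 + 5 * Real.log (ΥB + Υu) + 2 * Real.log (1 / (γRH * γG))) /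
      Real.log (1 / (1 - γS)) ≤ τ)
    (hβ_sum : Tendsto (fun n => ∑ t ∈ Finset.range n, β t) atTop atTop)
    (hη_sum : Summable (fun t => (β t + χ t) ^ 2)) (hχ_sum : Summable χ) :
    ∀ᵐ ω ∂μ,
      Tendsto (fun t => ‖w (t + 1) ω - w t ω‖) atTop (𝓝 0) ∧
      Tendsto (fun t => ‖∇ (lagrangian f c) (w t ω)‖) atTop (𝓝 0) := by
  obtain ⟨s, hs, hs1, hsG⟩ : ∃ s : ℝ, 0 < s ∧ s ≤ 1 ∧ s ^ 2 = γG :=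
    ⟨√γG, Real.sqrt_pos.2 hγG, Real.sqrt_le_one.2 hγG_le, Real.sq_sqrt hγG.le⟩
  rw [← hsG] at hG hτ
  have hκ : 0 < ΥB + Υu := by linarith
  have hε0 : 0 ≤ max (1 - γS) 0 ^ τ := pow_nonneg (le_max_right _ _) _
  have hε : max (1 - γS) 0 ^ τ ≤ γRH ^ 2 * s ^ 4 / (4096 * (ΥB + Υu) ^ 5) := by
    have h := max_one_sub_pow_le hτ_pos hτ hγS
    rwa [exp_neg_log_threshold hκ hγRH (by positivity), ← pow_mul] at h
  have hε1 : max (1 - γS) 0 ^ τ ≤ 1 :=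
    pow_le_one₀ (le_max_right _ _) (max_le (by linarith) zero_le_one)
  have hL := contDiff_lagrangian hf hc
  have hgc : Continuous (∇ (lagrangian f c)) := (contDiff_gradient hL).continuous
  have hTc : Continuous (hess (lagrangian f c)) := continuous_hess hL
  have hw := hrun.measurable_iterate hF_meas hF_diff hc
  have hle := hrun.history_le
  let D : Set (PD d m) := {p | p.fst ∈ X ∧ p.snd ∈ Λ}
  have hD : Convex ℝ D := (hX_conv.linear_preimage (WithLp.fstL 2 ℝ (Vec d) (Vec m)).toLinearMap).inter
    (hΛ_conv.linear_preimage (WithLp.sndL 2 ℝ (Vec d) (Vec m)).toLinearMap)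
  have hDT : ∀ p ∈ D, ‖hess (lagrangian f c) p‖ ≤ Υu := fun p hp => (hbound p hp.1 hp.2).1
  have hDg : ∀ p ∈ D, ‖∇ (lagrangian f c) p‖ ≤ Υu := fun p hp => (hbound p hp.1 hp.2).2.1
  -- No sign of `ΥL` is assumed, hence the maximum with `0`.
  have hDlip : ∀ p ∈ D, ∀ q ∈ D, ‖hess (lagrangian f c) p - hess (lagrangian f c) q‖ ≤
      max ΥL 0 * ‖p - q‖ := fun p hp q hq =>
    (hlip_hess p q hp.1 hp.2 hq.1 hq.2).trans
      (mul_le_mul_of_nonneg_right (le_max_left _ _) (norm_nonneg _))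
  obtain ⟨ρ, hρ⟩ : ∃ ρ, ρ = 48 * (ΥB + Υu) ^ 2 / (s ^ 2 * γRH) := ⟨_, rfl⟩
  obtain ⟨ν, hν⟩ : ∃ ν, ν = γRH / (ΥB + Υu) ^ 2 := ⟨_, rfl⟩
  obtain ⟨M, hM⟩ : ∃ M, M = kktBound s γRH ΥB := ⟨_, rfl⟩
  have hρ0 : 0 ≤ ρ := by rw [hρ]; positivity
  have hν0 : 0 ≤ ν := by rw [hν]; positivity
  have hM0 : 0 ≤ M := by rw [hM]; exact kktBound_nonneg hs hγRH (by linarith)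
  have hΥu0 : 0 ≤ Υu := by linarith
  have hΥL0 : 0 ≤ max ΥL 0 := le_max_right _ _
  obtain ⟨Cf, hCf⟩ := hX_comp.exists_bound_of_continuousOn hf.continuous.continuousOn
  obtain ⟨CΛ, hCΛ⟩ := hΛ_comp.exists_bound_of_continuousOn continuous_id.continuousOn
  -- Compactness bounds `f` and the multiplier, while `c` is bounded as a component of `∇L`.
  have hmerit : ∀ p ∈ D, |merit f c ρ ν p| ≤
      |Cf| + |CΛ| * Υu + ρ / 2 * Υu ^ 2 + ν / 2 * Υu ^ 2 := by
    intro p hp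
    have h1 : ‖(∇ (lagrangian f c) p).snd‖ ≤ Υu := (norm_snd_le_pd _).trans (hDg p hp)
    have h2 : ‖c p.fst‖ ≤ Υu := by
      rwa [gradient_lagrangian (hf.differentiable two_ne_zero)
        (hc.differentiable two_ne_zero)] at h1
    have h3 : |f p.fst| ≤ |Cf| := (hCf _ hp.1).trans (le_abs_self _)
    have h4 : |⟪p.snd, c p.fst⟫_ℝ| ≤ |CΛ| * Υu :=
      (abs_real_inner_le_norm _ _).trans (mul_le_mul ((hCΛ _ hp.2).trans (le_abs_self _)) h2
        (norm_nonneg _) (abs_nonneg _))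
    have h5 : ‖(∇ (lagrangian f c) p).snd‖ ^ 2 ≤ Υu ^ 2 := by gcongr
    have h6 : ‖∇ (lagrangian f c) p‖ ^ 2 ≤ Υu ^ 2 := by gcongr; exact hDg p hp
    have h7 : |ρ / 2 * ‖(∇ (lagrangian f c) p).snd‖ ^ 2| ≤ ρ / 2 * Υu ^ 2 := by
      rw [abs_of_nonneg (by positivity)]; gcongr
    have h8 : |ν / 2 * ‖∇ (lagrangian f c) p‖ ^ 2| ≤ ν / 2 * Υu ^ 2 := by
      rw [abs_of_nonneg (by positivity)]; gcongr
    exact (abs_add_le _ _).trans (add_le_add ((abs_add_le _ _).trans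
      (add_le_add ((abs_add_le _ _).trans (add_le_add h3 h4)) h7)) h8)
  obtain ⟨C₁, hC₁⟩ : ∃ C₁, C₁ = 8 * M ^ 2 * (Υm + Υu ^ 2) := ⟨_, rfl⟩
  obtain ⟨C₂, hC₂⟩ : ∃ C₂, C₂ = |Cf| + |CΛ| * Υu + ρ / 2 * Υu ^ 2 + ν / 2 * Υu ^ 2 := ⟨_, rfl⟩
  obtain ⟨C₃, hC₃⟩ : ∃ C₃, C₃ = Υu * (1 + ν * Υu) + ρ * Υu * Υu := ⟨_, rfl⟩
  obtain ⟨C₄, hC₄⟩ : ∃ C₄, C₄ = Υu + (ρ + ν) * (Υu * max ΥL 0 + Υu ^ 2) := ⟨_, rfl⟩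
  have hC₁0 : 0 ≤ C₁ := by rw [hC₁]; positivity
  have hC₂0 : 0 ≤ C₂ := by rw [hC₂]; positivity
  have hC₃0 : 0 ≤ C₃ := by rw [hC₃]; positivity
  have hC₄0 : 0 ≤ C₄ := by rw [hC₄]; positivity
  -- One constant for every bound required by the abstract descent theorem: second moments, merit
  -- function, its gradient, the quadratic remainder, the mean direction and `∇L` with its Lipschitz
  -- constant.
  obtain ⟨C, hC⟩ : ∃ C, C = C₁ + C₂ + C₃ + C₄ + 2 * M + Υu := ⟨_, rfl⟩
  let z : ℕ → Ω → PD d m := fun t ω =>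
    sketchSolve (newtonMat F c (fun i => w i ω) (fun i => ξ i ω) (fun i => R i ω) t)
      (lagGradEst F c (w t ω) (ξ t ω)) (fun j => A (ζ t j ω)) τ
  have hKM : ∀ t, ∀ᵐ ω ∂μ, ∀ z, ‖z‖ ≤
      M * ‖newtonMat F c (fun i => w i ω) (fun i => ξ i ω) (fun i => R i ω) t z‖ := by
    intro t
    filter_upwards [hG, hB] with ω h1 h2 z
    rw [hM]
    exact norm_le_norm_kkt hs hγRH (h1 t) (h2 t).1 (h2 t).2 z
  have hgU : ∀ t, ∀ᵐ ω ∂μ, ‖∇ (lagrangian f c) (w t ω)‖ ≤ Υu := fun t =>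
    hw_mem.mono fun ω h => hDg _ (h t)
  have hdir : ∀ t, MemLp (z t) 2 μ ∧ ∫ ω, ‖z t ω‖ ^ 2 ∂μ ≤ C₁ ∧
      ∀ᵐ ω ∂μ, ∃ v, newtonMat F c (fun i => w i ω) (fun i => ξ i ω) (fun i => R i ω) t v =
          -∇ (lagrangian f c) (w t ω) ∧
        ‖(μ[z t | history ξ ζ ψ τ t]) ω - v‖ ≤ max (1 - γS) 0 ^ τ * ‖v‖ := by
    intro t
    rw [hC₁]
    refine hrun.direction_bounds hF_meas hF_diff hf hc t hM0 (hKM t) (hgU t)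
      (hw_mem.mono fun ω h => (hbound _ (h t).1 (h t).2).2.2) (hgrad_int t) (hgrad_mean t)
      (hgrad_sq_int t) ?_ (hsketch t) fun ω => rfl
    rw [← integral_condExp (hle t)]
    refine (integral_mono_ae integrable_condExp (integrable_const Υm) (hgrad_sq t)).trans ?_
    simp
  refine tendsto_of_stochastic_descent (ℱ := hrun.filtration) (z := z)
    (u := fun t ω => meritGrad ρ ν (hess (lagrangian f c) (w t ω)) (∇ (lagrangian f c) (w t ω)))
    (α := α) (Φ := fun t ω => merit f c ρ ν (w t ω)) (C := C)
    (δ := γRH / (8 * (ΥB + Υu) ^ 2)) (by rw [hC]; linarith) (by positivity) hβ_pos hχ_nonneg hβ_sum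
    hη_sum hχ_sum (fun t => ?_) (fun t => ?_) (fun t => (hdir t).1)
    (fun t => (hdir t).2.1.trans (by rw [hC]; linarith)) hrun.step_mem (fun t => ?_) ?_ ?_
    (fun t => ?_) (fun t ω => norm_nonneg _) ?_ ?_ (fun t => ?_) (fun t => ?_)
    (ae_of_all _ fun ω t => hrun.update t ω) ?_
  · have h1 := ((continuous_meritGrad ρ ν).comp (hTc.prodMk hgc)).measurable.comp (hw t)
    exact h1.stronglyMeasurable
  · have h1 := hrun.measurable_direction_of_iterate hF_meas hF_diff hc (t := t) fun i hi =>
      (hw i).mono (history_mono ξ ζ ψ τ hi) le_rfl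
    exact h1.stronglyMeasurable
  · have h1 := (continuous_merit hf hc ρ ν).measurable.comp ((hw t).mono (hle t) le_rfl)
    exact h1.aestronglyMeasurable
  · filter_upwards [hw_mem] with ω h t
    refine (hmerit _ (h t)).trans ?_
    rw [← hC₂, hC]
    linarith
  · filter_upwards [hw_mem] with ω h t
    refine (norm_meritGrad_le hρ0 hν0 (hDT _ (h t)) _).trans ?_
    have h1 := hDg _ (h t)
    have h2 : ‖∇ (lagrangian f c) (w t ω)‖ * (1 + ν * Υu) +
        ρ * Υu * ‖(∇ (lagrangian f c) (w t ω)).snd‖ ≤ C₃ := by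
      rw [hC₃]
      gcongr
      exact (norm_snd_le_pd _).trans h1
    refine h2.trans ?_
    rw [hC]
    linarith
  · have h1 := hgc.norm.measurable.comp ((hw t).mono (hle t) le_rfl)
    exact h1.aestronglyMeasurable
  · filter_upwards [hw_mem] with ω h t
    refine (hDg _ (h t)).trans ?_
    rw [hC]
    linarith
  · filter_upwards [hw_mem] with ω h t
    have h1 := merit_le hf hc hD hΥu0 hΥL0 hρ0 hν0 hDT hDlip hDg (h t) (h (t + 1))
    have h2 : w (t + 1) ω - w t ω = α t ω • z t ω := by
      rw [hrun.update t ω, add_sub_cancel_left]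
    rw [h2, ← hC₄] at h1
    refine h1.trans ?_
    gcongr
    rw [hC]
    linarith
  · filter_upwards [hw_mem, hG, hB, (hdir t).2.2] with ω h1 h2 h3 h4
    obtain ⟨v, h5, h6⟩ := h4
    obtain ⟨H, hH⟩ := hess_lagrangian hf hc (w t ω)
    have h7 := hDT _ (h1 t)
    rw [hH] at h7 ⊢
    rw [hρ, hν]
    exact inner_meritGrad_le hγRH hγRH_le hs hs1 hΥB hΥu hε0 hε (h2 t) (h3 t).1 (h3 t).2 h7 h5 h6
  · filter_upwards [hKM t, (hdir t).2.2] with ω h3 h4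
    obtain ⟨v, h5, h6⟩ := h4
    have h7 := h3 v
    rw [h5, norm_neg] at h7
    -- The relative error is at most 1, so the mean direction is at most twice as long as the exact
    -- one.
    have h8 := norm_le_norm_sub_add ((μ[z t | history ξ ζ ψ τ t]) ω) v
    have h9 := mul_le_mul_of_nonneg_right hε1 (norm_nonneg v)
    have h10 : ‖(μ[z t | history ξ ζ ψ τ t]) ω‖ ≤ 2 * M * ‖∇ (lagrangian f c) (w t ω)‖ := by
      linarith
    refine h10.trans ?_
    gcongr
    rw [hC]
    linarith
  · filter_upwards [hw_mem] with ω h i t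
    refine (abs_norm_sub_norm_le _ _).trans ?_
    refine (norm_gradient_sub_le hL hD hDT (h t) (h i)).trans ?_
    gcongr
    rw [hC]
    linarith

end AIStoSQP

theorem theorem1
    {Ω S Z Y : Type*} [MeasurableSpace Ω] [MeasurableSpace S] [MeasurableSpace Z]
    [MeasurableSpace Y] (μ : Measure Ω) [IsProbabilityMeasure μ] {d m : ℕ}
    -- the problem `min E[F(x; ξ)]` subject to `c(x) = 0`, with `ξ ∼ P`
    (F : Vec d → S → ℝ) (P : Measure S) [IsProbabilityMeasure P] (c : Vec d → Vec m)
    (hF_meas : Measurable (Function.uncurry F)) (hF_int : ∀ x, Integrable (F x) P)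
    (hF_diff : ∀ s, TwiceDifferentiable (fun x => F x s))
    -- the algorithm
    (Q : Measure Z) (A : Z → Sketch d m) (τ : ℕ) (hτ_pos : 0 < τ) (β χ : ℕ → ℝ)
    (hβ_pos : ∀ t, 0 < β t) (hχ_nonneg : ∀ t, 0 ≤ χ t)
    (ξ : ℕ → Ω → S) (ζ : ℕ → ℕ → Ω → Z) (ψ : ℕ → Ω → Y)
    (R : ℕ → Ω → Vec d →L[ℝ] Vec d) (α : ℕ → Ω → ℝ) (w₀ : PD d m) (w : ℕ → Ω → PD d m)
    (hrun : IsRun μ F c P Q A τ β χ ξ ζ ψ R α w₀ w)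
    -- smoothness; a convex compact set that contains the iterates; Lipschitz continuity
    (hf : ContDiff ℝ 2 (objective F P)) (hc : ContDiff ℝ 2 c)
    (X : Set (Vec d)) (Λ : Set (Vec m))
    (hX_conv : Convex ℝ X) (hX_comp : IsCompact X) (hΛ_conv : Convex ℝ Λ) (hΛ_comp : IsCompact Λ)
    (hw_mem : ∀ᵐ ω ∂μ, ∀ t, (w t ω).fst ∈ X ∧ (w t ω).snd ∈ Λ)
    (ΥL : ℝ)
    (hlip_hess : ∀ p q : PD d m, p.fst ∈ X → p.snd ∈ Λ → q.fst ∈ X → q.snd ∈ Λ →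
      ‖hess (lagrangian (objective F P) c) p - hess (lagrangian (objective F P) c) q‖
        ≤ ΥL * ‖p - q‖)
    (hlip_grad : ∀ x ∈ X, ∀ y ∈ X,
      ‖∇ (objective F P) x - ∇ (objective F P) y‖ ≤ ΥL * ‖x - y‖)
    -- an upper bound of the derivatives on that set
    (Υu : ℝ) (hΥu : 1 ≤ Υu)
    (hbound : ∀ p : PD d m, p.fst ∈ X → p.snd ∈ Λ →
      ‖hess (lagrangian (objective F P) c) p‖ ≤ Υu ∧
      ‖∇ (lagrangian (objective F P) c) p‖ ≤ Υu ∧ ‖∇ (objective F P) p.fst‖ ≤ Υu)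
    -- `G_t` has full row rank, with `G_t G_tᵀ ≥ γG I`
    (γG : ℝ) (hγG : 0 < γG) (hγG_le : γG ≤ 1)
    (hG : ∀ᵐ ω ∂μ, ∀ t, γG • ContinuousLinearMap.id ℝ (Vec m) ≤
      jac c (w t ω).fst ∘L (jac c (w t ω).fst).adjoint)
    -- `B_t` is bounded, and positive definite on the kernel of `G_t`
    (ΥB γRH : ℝ) (hΥB : 1 ≤ ΥB) (hγRH : 0 < γRH) (hγRH_le : γRH ≤ 1)
    (hB : ∀ᵐ ω ∂μ, ∀ t,
      ‖modHess F c (fun i => w i ω) (fun i => ξ i ω) (fun i => R i ω) t‖ ≤ ΥB ∧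
      ∀ v : Vec d, jac c (w t ω).fst v = 0 → γRH * ‖v‖ ^ 2 ≤
        inner ℝ v (modHess F c (fun i => w i ω) (fun i => ξ i ω) (fun i => R i ω) t v))
    -- unbiased gradient and Hessian estimates, bounded second moment of the gradient estimate
    (Υm : ℝ) (hΥm : 1 ≤ Υm)
    (hgrad_int : ∀ t, Integrable (fun ω => sGrad F (w t ω).fst (ξ t ω)) μ)
    (hgrad_mean : ∀ t, μ[fun ω => sGrad F (w t ω).fst (ξ t ω) | history ξ ζ ψ τ t]
      =ᵐ[μ] fun ω => ∇ (objective F P) (w t ω).fst)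
    (hhess_int : ∀ t, Integrable (fun ω => sHess F (w t ω).fst (ξ t ω)) μ)
    (hhess_mean : ∀ t, μ[fun ω => sHess F (w t ω).fst (ξ t ω) | history ξ ζ ψ τ t]
      =ᵐ[μ] fun ω => hess (objective F P) (w t ω).fst)
    (hgrad_sq_int : ∀ t, Integrable
      (fun ω => ‖sGrad F (w t ω).fst (ξ t ω) - ∇ (objective F P) (w t ω).fst‖ ^ 2) μ)
    (hgrad_sq : ∀ t, ∀ᵐ ω ∂μ,
      (μ[fun ω => ‖sGrad F (w t ω).fst (ξ t ω) - ∇ (objective F P) (w t ω).fst‖ ^ 2 |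
        history ξ ζ ψ τ t]) ω ≤ Υm)
    -- the sketching condition
    (γS : ℝ) (hγS : 0 < γS)
    (hsketch : ∀ t, ∀ j < τ, ∀ᵐ ω ∂μ, γS • ContinuousLinearMap.id ℝ (PD d m) ≤
      (μ[fun ω => sketchGain
            (newtonMat F c (fun i => w i ω) (fun i => ξ i ω) (fun i => R i ω) t) (A (ζ t j ω)) ∘L
          newtonMat F c (fun i => w i ω) (fun i => ξ i ω) (fun i => R i ω) t |
        history ξ ζ ψ τ t]) ω)
    -- the number of sketching steps is large enough
    (hτ : (12 * Real.log 2 + 5 * Real.log (ΥB + Υu) + 2 * Real.log (1 / (γRH * γG))) /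
      Real.log (1 / (1 - γS)) ≤ τ)
    -- the stepsize sequences
    (hβ_sum : Tendsto (fun n => ∑ t ∈ Finset.range n, β t) atTop atTop)
    (hη_sum : Summable (fun t => (β t + χ t) ^ 2)) (hχ_sum : Summable χ) :
    ∀ᵐ ω ∂μ,
      Tendsto (fun t => ‖w (t + 1) ω - w t ω‖) atTop (𝓝 0) ∧
      Tendsto (fun t => ‖∇ (lagrangian (objective F P) c) (w t ω)‖) atTop (𝓝 0) :=
  hrun.tendsto_kkt_residual hF_meas hF_diff hf hc hτ_pos hβ_pos hχ_nonneg hX_conv hX_comp hΛ_conv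
    hΛ_comp hw_mem hlip_hess hΥu hbound hγG hγG_le hG hΥB hγRH hγRH_le hB (by linarith) hgrad_int
    hgrad_mean hgrad_sq_int hgrad_sq hγS hsketch hτ hβ_sum hη_sum hχ_sum
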